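/- **Theorem (growth of the universal enveloping algebra).** Let $\Bbbk$ be a field, $X$ a finite-dimensional commutative $\Bbbk$-algebra, and $L$ a self-similar Lie algebra over $\Bbbk$ with alphabet $X$: a Lie algebra with a homomorphism $\psi:L\to (X\otimes L)\rtimes\operatorname{Der}X$, restricted (with $\psi$ preserving the $p$-mapping) if $\operatorname{char}\Bbbk=p>0$. It acts on $T(X)=\bigoplus_n X^{\otimes n}$ by $a\cdot 1=0$ and $a\cdot(x\otimes w)=\sum_i xy_i\otimes (a_i\cdot w)+\delta(x)\otimes w$ for $\psi(a)=\sum_i y_i\otimes a_i+\delta$; assume that this action is faithful. Assume that $L$ is contracting: there is a finite-dimensional subspace $N\le L$ such that for every $a\in L$ one has $\psi^n(a)\in X^{\otimes n}\otimes N\oplus\operatorname{Der}(X^{\otimes n})$ for all large $n$. Assume that $L$ is $\mathbb R_+$-graded with dilation $\lambda>1$: $X$ and $L$ are graded by real numbers (as a ring, respectively as a restricted Lie algebra), the degrees of $L$ are $\ge 0$, and for $a$ homogeneous and $\psi(a)=\sum y_i\otimes a_i+\delta$ as above one has $\deg y_i+\lambda\deg a_i=\deg a=\deg\delta$. Assume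 finally that $L$ is generated, as a restricted Lie algebra, by finitely many homogeneous elements of positive degree. Let $U(L)$ be the universal enveloping algebra (the restricted one if $\operatorname{char}\Bbbk>0$) with the induced grading, and let $L_{\le d}$ and $U(L)_{\le d}$ be the spans of the homogeneous elements of degree $\le d$. Let $\theta=\operatorname{GKdim}L=\sup_S\limsup_n \log\dim(S^{\le n})/\log n$, where $S$ runs through the finite-dimensional subspaces of $L$ and $S^{\le n}$ is spanned by the products of at most $n$ elements of $S$ (a $p$-th power counting as $p$ factors). Put $\theta_0=\log(\dim X)/\log\lambda$ (with $\log 0:=0$), and write $f\precsim g$ if there is $C>0$ with $f(d)\le C\,g(Cd)$ for all real $d\ge1$. Then all $L_{\le d}$ and $U(L)_{\le d}$ are finite-dimensional, $0\le\theta\le\theta_0<\infty$, and: 1. $U(L)$ has subexponential growth: $\frac1d\log\dim U(L)_{\le d}\to0$ as $d\to\infty$. More precisely, $\dim U(L)_{\le d}\precsim \exp\big(d^{\eta/(\eta+1)}\big)$ for every $\eta>\theta$, and also for $\eta=\theta_0$. If $\theta>0$ and $\dim L_{\le d}\precsim d^\theta$, then moreover $\dim U(L)_{\le d}\precsim\exp\big(d^{\theta/(\theta+1)}\big)$.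 2. Suppose that $L$ is regularly weakly branched, that is: $X=\Bbbk[x]/(x^m)$ with $m\ge 1$ carries the derivation $\partial_x=d/dx$, and the image of $L$ in $\operatorname{Der}X$ is $\Bbbk\partial_x$; $L$ is recurrent, i.e. with $\varepsilon:X\to\Bbbk$ the augmentation, $(\varepsilon\otimes1)\psi$ maps the kernel of $L\to\operatorname{Der}X$ onto $L$; $L$ is transitive, i.e. $U(L)\cdot (x^{m-1})^{\otimes n}=X^{\otimes n}$ for all $n$; and there is a non-zero ideal $K$ of $L$ with $X\otimes K\le\psi(K)$. Then $\theta=\theta_0>0$ and the exponent is attained and sharp: $$\dim U(L)_{\le d}\precsim \exp\big(d^{\theta/(\theta+1)}\big)\quad\text{and}\quad \exp\big(d^{\theta/(\theta+1)}\big)\precsim\dim U(L)_{\le d}.$$ -/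

import Mathlib

open scoped TensorProduct

noncomputable section

namespace SelfSimilarLie

/-! ### Restricted Lie algebras -/

section Restricted

variable (k : Type*) {M : Type*} [Field k] [LieRing M] [LieAlgebra k M]

/-- Jacobson's Lie polynomial `s_i(a, b)`: `i * s_i(a, b)` is the coefficient of `t ^ (i - 1)` in
`ad (t a + b) ^ (p - 1) (a)`. The subset `T` records in which of the `p - 1` factors one picks
the summand `t a`. -/
def jacobsonTerm (p i : ℕ) (a b : M) : M :=
  (i : k)⁻¹ • ∑ T ∈ (Finset.univ : Finset (Fin (p - 1))).powersetCard (i - 1),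
    (List.ofFn fun j : Fin (p - 1) =>
      if j ∈ T then LieAlgebra.ad k M a else LieAlgebra.ad k M b).prod a

/-- `f` is a `p`-mapping `a ↦ a ^ p` on the Lie algebra `M` over a field of characteristic `p`
(the usual axioms of a restricted Lie algebra). -/
structure IsPMap (p : ℕ) (f : M → M) : Prop where
  smul : ∀ (c : k) (a : M), f (c • a) = c ^ p • f a
  ad_pow : ∀ a : M, LieAlgebra.ad k M (f a) = LieAlgebra.ad k M a ^ p
  add : ∀ a b : M, f (a + b) = f a + f b + ∑ i ∈ Finset.Icc 1 (p - 1), jacobsonTerm k p i a b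

end Restricted

/-! ### Wreath products and self-similarity structures -/

section Wreath

variable (k X L : Type*) [Field k] [CommRing X] [Algebra k X] [LieRing L] [LieAlgebra k L]

/-- A derivation of `X` acts on `X ⊗ L` by deriving the first coordinate. -/
def derAction : Derivation k X X →ₗ⁅k⁆ LieDerivation k (X ⊗[k] L) (X ⊗[k] L) where
  toFun δ :=
    { toLinearMap := (δ : X →ₗ[k] X).rTensor L
      leibniz' := by
        intro u v
        induction u with
        | zero => simp
        | add u₁ u₂ h₁ h₂ => simp only [add_lie, map_add, h₁, h₂, lie_add]; abel
        | tmul x a =>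
          induction v with
          | zero => simp
          | add v₁ v₂ h₁ h₂ => simp only [add_lie, map_add, h₁, h₂, lie_add]; abel
          | tmul y b =>
            simp only [LieAlgebra.ExtendScalars.bracket_tmul, LinearMap.rTensor_tmul,
              Derivation.coeFn_coe, Derivation.leibniz, smul_eq_mul, TensorProduct.add_tmul]
            rw [← lie_skew b a, TensorProduct.tmul_neg, sub_neg_eq_add] }
  map_add' δ ε := by
    ext u
    simp [LinearMap.rTensor_add]
  map_smul' c δ := by
    ext u
    simp [LinearMap.rTensor_smul]
  map_lie' := by
    intro δ ε
    ext u
    induction u with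
    | zero => simp
    | add u₁ u₂ h₁ h₂ => simp only [map_add, h₁, h₂]
    | tmul x a =>
      change (⁅δ, ε⁆ x) ⊗ₜ[k] a = _
      rw [LieDerivation.commutator_apply, Derivation.commutator_apply, TensorProduct.sub_tmul]
      rfl

/-- The wreath product `L ≀ Der X = (X ⊗ L) ⋊ Der X`. -/
abbrev Wreath : Type _ := (X ⊗[k] L) ⋊⁅derAction k X L⁆ (Derivation k X X)

variable {k X L}

/-- The component of `ψ` in `X ⊗ L`. -/
def coord (ψ : L →ₗ⁅k⁆ Wreath k X L) : L →ₗ[k] X ⊗[k] L :=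
  LieAlgebra.SemiDirectSum.projl (derAction k X L) ∘ₗ (ψ : L →ₗ[k] Wreath k X L)

/-- The component of `ψ` in `Der X`. -/
def top (ψ : L →ₗ⁅k⁆ Wreath k X L) : L →ₗ[k] Derivation k X X :=
  (LieAlgebra.SemiDirectSum.projr (derAction k X L) : Wreath k X L →ₗ[k] Derivation k X X) ∘ₗ
    (ψ : L →ₗ[k] Wreath k X L)

/-- In positive characteristic `p`: `pw` is a `p`-mapping of `L`, and the self-similarity structure
`ψ` preserves `p`-mappings, where `L ≀ Der X` carries the `p`-mapping `q` that extends the natural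
ones `(x ⊗ a) ^ p = x ^ p ⊗ a ^ p` on `X ⊗ L` and `δ ↦ δ ^ p` on `Der X`.
In characteristic `0` there is no condition (and `pw` plays no role). -/
def IsRestricted (p : ℕ) (pw : L → L) (ψ : L →ₗ⁅k⁆ Wreath k X L) : Prop :=
  p ≠ 0 → IsPMap k p pw ∧ ∃ q : Wreath k X L → Wreath k X L, IsPMap k p q ∧
    (∀ (x : X) (a : L), q ⟨x ⊗ₜ[k] a, 0⟩ = ⟨(x ^ p) ⊗ₜ[k] pw a, 0⟩) ∧
    (∀ δ : Derivation k X X,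
      (q ⟨0, δ⟩).left = 0 ∧ ∀ x : X, (q ⟨0, δ⟩).right x = (⇑δ)^[p] x) ∧
    ∀ a : L, ψ (pw a) = q (ψ a)

/-! ### The natural action on the tensor algebra `T(X)` -/

/-- For `φ : L → T(X)`, `a ↦ a · w`, this is the map
`a ↦ a · (x ⊗ w) = ∑ x y_i ⊗ (a_i · w) + (δ x) ⊗ w` where `ψ a = ∑ y_i ⊗ a_i + δ`. -/
def actStepAux (ψ : L →ₗ⁅k⁆ Wreath k X L) (x : X) (w : TensorAlgebra k X)
    (φ : L →ₗ[k] TensorAlgebra k X) : L →ₗ[k] TensorAlgebra k X :=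
  TensorProduct.lift ((LinearMap.mul k (TensorAlgebra k X)).compl₁₂
      (TensorAlgebra.ι k ∘ₗ LinearMap.mulLeft k x) φ) ∘ₗ coord ψ +
    { toFun := fun a => TensorAlgebra.ι k (top ψ a x) * w
      map_add' := fun a b => by simp [add_mul]
      map_smul' := fun c a => by simp }

/-- The linear map `(w, φ) ↦ (x ⊗ w, actStepAux ψ x w φ)`, linear in the letter `x`. -/
def actStep (ψ : L →ₗ⁅k⁆ Wreath k X L) :
    X →ₗ[k] Module.End k (TensorAlgebra k X × (L →ₗ[k] TensorAlgebra k X)) :=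
  LinearMap.mk₂ k
    (fun x P => (TensorAlgebra.ι k x * P.1, actStepAux ψ x P.1 P.2))
    (by
      intro x y P
      refine Prod.ext (by simp [add_mul]) (LinearMap.ext fun a => ?_)
      simp only [actStepAux, LinearMap.add_apply, LinearMap.comp_apply, Prod.mk_add_mk,
        LinearMap.coe_mk, AddHom.coe_mk, map_add, add_mul]
      generalize coord ψ a = u
      have : TensorProduct.lift ((LinearMap.mul k (TensorAlgebra k X)).compl₁₂
            (TensorAlgebra.ι k ∘ₗ LinearMap.mulLeft k (x + y)) P.2) u =
          TensorProduct.lift ((LinearMap.mul k (TensorAlgebra k X)).compl₁₂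
            (TensorAlgebra.ι k ∘ₗ LinearMap.mulLeft k x) P.2) u +
          TensorProduct.lift ((LinearMap.mul k (TensorAlgebra k X)).compl₁₂
            (TensorAlgebra.ι k ∘ₗ LinearMap.mulLeft k y) P.2) u := by
        induction u with
        | zero => simp
        | add u v hu hv => simp only [map_add, hu, hv]; abel
        | tmul z b => simp [add_mul]
      rw [this]; abel)
    (by
      intro c x P
      refine Prod.ext (by simp) (LinearMap.ext fun a => ?_)
      simp only [actStepAux, LinearMap.add_apply, LinearMap.comp_apply, Prod.smul_mk,
        LinearMap.coe_mk, AddHom.coe_mk, LinearMap.smul_apply, Derivation.map_smul, map_smul,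
        smul_mul_assoc, smul_add]
      congr 1
      generalize coord ψ a = u
      induction u with
      | zero => simp
      | add u v hu hv => simp only [map_add, hu, hv, smul_add]
      | tmul z b => simp)
    (by
      intro x P Q
      refine Prod.ext (by simp [mul_add]) (LinearMap.ext fun a => ?_)
      simp only [actStepAux, LinearMap.add_apply, LinearMap.comp_apply, Prod.mk_add_mk,
        LinearMap.coe_mk, AddHom.coe_mk, Prod.fst_add, Prod.snd_add, mul_add]
      generalize coord ψ a = u
      have : TensorProduct.lift ((LinearMap.mul k (TensorAlgebra k X)).compl₁₂
            (TensorAlgebra.ι k ∘ₗ LinearMap.mulLeft k x) (P.2 + Q.2)) u =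
          TensorProduct.lift ((LinearMap.mul k (TensorAlgebra k X)).compl₁₂
            (TensorAlgebra.ι k ∘ₗ LinearMap.mulLeft k x) P.2) u +
          TensorProduct.lift ((LinearMap.mul k (TensorAlgebra k X)).compl₁₂
            (TensorAlgebra.ι k ∘ₗ LinearMap.mulLeft k x) Q.2) u := by
        induction u with
        | zero => simp
        | add u v hu hv => simp only [map_add, hu, hv]; abel
        | tmul z b => simp [mul_add]
      rw [this]; abel)
    (by
      intro c x P
      refine Prod.ext (by simp) (LinearMap.ext fun a => ?_)
      simp only [actStepAux, LinearMap.add_apply, LinearMap.comp_apply, Prod.smul_mk,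
        LinearMap.coe_mk, AddHom.coe_mk, LinearMap.smul_apply, Prod.smul_fst, Prod.smul_snd,
        mul_smul_comm, smul_add]
      congr 1
      generalize coord ψ a = u
      induction u with
      | zero => simp
      | add u v hu hv => simp only [map_add, hu, hv, smul_add]
      | tmul z b => simp)

/-- The pair `(w, a ↦ a · w)`, built letter by letter. -/
def actPair (ψ : L →ₗ⁅k⁆ Wreath k X L) (w : TensorAlgebra k X) :
    TensorAlgebra k X × (L →ₗ[k] TensorAlgebra k X) :=
  TensorAlgebra.lift k (actStep ψ) w (1, 0)

theorem actPair_ι_mul (ψ : L →ₗ⁅k⁆ Wreath k X L) (x : X) (w : TensorAlgebra k X) :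
    actPair ψ (TensorAlgebra.ι k x * w) = actStep ψ x (actPair ψ w) := by
  simp [actPair]

/-- The natural action of `L` on `T(X)` by `k`-linear endomorphisms. -/
def act (ψ : L →ₗ⁅k⁆ Wreath k X L) : L →ₗ[k] Module.End k (TensorAlgebra k X) where
  toFun a :=
    { toFun := fun w => (actPair ψ w).2 a
      map_add' := fun v w => by simp [actPair]
      map_smul' := fun c w => by simp [actPair] }
  map_add' a b := LinearMap.ext fun w => map_add (actPair ψ w).2 a b
  map_smul' c a := LinearMap.ext fun w => map_smul (actPair ψ w).2 c a

/-- `a · 1 = 0`. -/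
theorem act_one (ψ : L →ₗ⁅k⁆ Wreath k X L) (a : L) : act ψ a 1 = 0 := by
  simp [act, actPair]

theorem actPair_fst (ψ : L →ₗ⁅k⁆ Wreath k X L) (w : TensorAlgebra k X) :
    (actPair ψ w).1 = w := by
  have key : ∀ w v : TensorAlgebra k X, (actPair ψ v).1 = v →
      (actPair ψ (w * v)).1 = w * v := by
    intro w
    induction w using TensorAlgebra.induction with
    | algebraMap r =>
      intro v hv
      rw [← Algebra.smul_def]
      have h : actPair ψ (r • v) = r • actPair ψ v := by simp [actPair]
      rw [h, Prod.smul_fst, hv]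
    | ι x =>
      intro v hv
      rw [actPair_ι_mul]
      simp [actStep, hv]
    | mul a b ha hb =>
      intro v hv
      rw [mul_assoc]
      exact ha _ (hb v hv)
    | add a b ha hb =>
      intro v hv
      have h : actPair ψ (a * v + b * v) = actPair ψ (a * v) + actPair ψ (b * v) := by
        simp [actPair]
      rw [add_mul, h, Prod.fst_add, ha v hv, hb v hv]
  simpa using key w 1 (by simp [actPair])

/-- `a · (x ⊗ w) = ∑ x y_i ⊗ (a_i · w) + (δ x) ⊗ w` where `ψ a = ∑ y_i ⊗ a_i + δ`. -/
theorem act_ι_mul (ψ : L →ₗ⁅k⁆ Wreath k X L) (a : L) (x : X) (w : TensorAlgebra k X) :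
    act ψ a (TensorAlgebra.ι k x * w) =
      TensorProduct.lift ((LinearMap.mul k (TensorAlgebra k X)).compl₁₂
        (TensorAlgebra.ι k ∘ₗ LinearMap.mulLeft k x) ((act ψ).flip w)) (coord ψ a) +
      TensorAlgebra.ι k (top ψ a x) * w := by
  have h : act ψ a (TensorAlgebra.ι k x * w) =
      (actPair ψ (TensorAlgebra.ι k x * w)).2 a := rfl
  have h2 : (actPair ψ w).2 = (act ψ).flip w := rfl
  rw [h, actPair_ι_mul]
  simp only [actStep, LinearMap.mk₂_apply, actStepAux, LinearMap.add_apply, LinearMap.comp_apply,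
    LinearMap.coe_mk, AddHom.coe_mk, actPair_fst, h2]

/-- The self-similar Lie algebra is faithful: its natural action on `T(X)` is faithful. -/
def IsFaithful (ψ : L →ₗ⁅k⁆ Wreath k X L) : Prop :=
  ∀ a : L, (∀ w : TensorAlgebra k X, act ψ a w = 0) → a = 0

/-! ### Contraction -/

/-- The component of the `n`-fold iterate `ψ ^ n` in `X ^ ⊗ n ⊗ L`, where `X ^ ⊗ n` is seen as the
degree-`n` part of `T(X)`. If `ψ a = ∑ y_i ⊗ a_i + δ` then
`ψ ^ (n + 1) a = ∑ y_i ⊗ ψ ^ n a_i + ⋯`. -/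
def iter (ψ : L →ₗ⁅k⁆ Wreath k X L) : ℕ → (L →ₗ[k] TensorAlgebra k X ⊗[k] L)
  | 0 => TensorProduct.mk k (TensorAlgebra k X) L 1
  | n + 1 => TensorProduct.lift
      ((LinearMap.rTensorHom L ∘ₗ LinearMap.mul k (TensorAlgebra k X) ∘ₗ
        TensorAlgebra.ι k).compl₂ (iter ψ n)) ∘ₗ coord ψ

/-- Contraction: for a finite-dimensional `N ≤ L` and every `a`, one has
`ψ ^ n a ∈ X ^ ⊗ n ⊗ N ⊕ Der (X ^ ⊗ n)` for all large `n`. -/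
def IsContracting (ψ : L →ₗ⁅k⁆ Wreath k X L) : Prop :=
  ∃ N : Submodule k L, FiniteDimensional k N ∧ ∀ a : L, ∃ n₀ : ℕ, ∀ n ≥ n₀,
    iter ψ n a ∈ LinearMap.range (N.subtype.lTensor (TensorAlgebra k X))

/-! ### Gradings -/

/-- Compatible gradings, by real numbers and with dilation `lam`, of the alphabet `X` (as a ring)
and of `L` (as a restricted Lie algebra): for `a` homogeneous of degree `d` and
`ψ a = ∑ y_i ⊗ a_i + δ` one has `deg y_i + lam * deg a_i = d = deg δ`. -/
structure IsGraded (p : ℕ) (pw : L → L) (ψ : L →ₗ⁅k⁆ Wreath k X L) (lam : ℝ)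
    (𝒳 : ℝ → Submodule k X) (ℒ : ℝ → Submodule k L) : Prop where
  alphabet_internal : DirectSum.IsInternal 𝒳
  alphabet_graded : SetLike.GradedMonoid 𝒳
  internal : DirectSum.IsInternal ℒ
  lie_mem : ∀ {i j : ℝ} {a b : L}, a ∈ ℒ i → b ∈ ℒ j → ⁅a, b⁆ ∈ ℒ (i + j)
  pw_mem : p ≠ 0 → ∀ {i : ℝ} {a : L}, a ∈ ℒ i → pw a ∈ ℒ (p * i)
  coord_mem : ∀ {d : ℝ} {a : L}, a ∈ ℒ d → coord ψ a ∈
    ⨆ (i : ℝ) (j : ℝ) (_ : i + lam * j = d),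
      LinearMap.range (TensorProduct.map (𝒳 i).subtype (ℒ j).subtype)
  top_mem : ∀ {d : ℝ} {a : L}, a ∈ ℒ d → ∀ {i : ℝ} {x : X}, x ∈ 𝒳 i → top ψ a x ∈ 𝒳 (i + d)

/-- `L` is generated, as a restricted Lie algebra, by finitely many homogeneous elements of
positive degree. -/
def GeneratedInPositiveDegree (p : ℕ) (pw : L → L) (ℒ : ℝ → Submodule k L) : Prop :=
  ∃ S : Finset L, (∀ s ∈ S, ∃ d > 0, s ∈ ℒ d) ∧
    ∀ H : LieSubalgebra k L, (∀ s ∈ S, s ∈ H) → (p ≠ 0 → ∀ a ∈ H, pw a ∈ H) → H = ⊤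

end Wreath

/-! ### Gelfand-Kirillov dimension -/

section GK

variable (k : Type*) {L : Type*} [Field k] [LieRing L] [LieAlgebra k L]

/-- Membership in `S ^ n`, the span of the `n`-fold products of elements of `S`; in characteristic
`p > 0`, the space `S ^ (p * n)` also contains the `p`-th powers of the elements of `S ^ n`. -/
inductive MemPow (p : ℕ) (pw : L → L) (S : Submodule k L) : ℕ → L → Prop
  | of {a : L} : a ∈ S → MemPow p pw S 1 a
  | zero {n : ℕ} : MemPow p pw S n 0
  | add {n : ℕ} {a b : L} : MemPow p pw S n a → MemPow p pw S n b → MemPow p pw S n (a + b)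
  | smul {n : ℕ} (c : k) {a : L} : MemPow p pw S n a → MemPow p pw S n (c • a)
  | lie {m n : ℕ} {a b : L} :
      MemPow p pw S m a → MemPow p pw S n b → MemPow p pw S (m + n) ⁅a, b⁆
  | pw {n : ℕ} {a : L} : p ≠ 0 → MemPow p pw S n a → MemPow p pw S (p * n) (pw a)

/-- The subspace `S ^ n`. -/
def powSpace (p : ℕ) (pw : L → L) (S : Submodule k L) (n : ℕ) : Submodule k L where
  carrier := {a | MemPow k p pw S n a}
  add_mem' := MemPow.add
  zero_mem' := MemPow.zero
  smul_mem' := fun c _ h => MemPow.smul c h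

/-- The span of all products of at most `n` elements of `S`. -/
def powSpaceLE (p : ℕ) (pw : L → L) (S : Submodule k L) (n : ℕ) : Submodule k L :=
  ⨆ m ∈ Finset.Icc 1 n, powSpace k p pw S m

/-- The (upper) Gelfand-Kirillov dimension of the restricted Lie algebra `L`. -/
def gkDim (p : ℕ) (pw : L → L) : EReal :=
  ⨆ (S : Submodule k L) (_ : FiniteDimensional k S),
    Filter.limsup (fun n : ℕ =>
      ((Real.log (Module.finrank k (powSpaceLE k p pw S n)) / Real.log n : ℝ) : EReal))
      Filter.atTop

end GK

/-! ### The universal enveloping algebra and its growth -/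

section Enveloping

variable (k : Type*) {L : Type*} [Field k] [LieRing L] [LieAlgebra k L]

/-- The relations `a ^ p = pw a` for `a ∈ L`; there are none in characteristic `0`. -/
inductive PowRel (p : ℕ) (pw : L → L) :
    UniversalEnvelopingAlgebra k L → UniversalEnvelopingAlgebra k L → Prop
  | pow_eq (a : L) : p ≠ 0 → PowRel p pw
      (UniversalEnvelopingAlgebra.ι k a ^ p) (UniversalEnvelopingAlgebra.ι k (pw a))

/-- The universal enveloping algebra `U(L)`: the restricted one in positive characteristic, the
ordinary one in characteristic `0`. -/
abbrev Env (p : ℕ) (pw : L → L) : Type _ := RingQuot (PowRel k p pw)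

/-- The canonical map `L → U(L)`. -/
def envι (p : ℕ) (pw : L → L) (a : L) : Env k p pw :=
  RingQuot.mkAlgHom k (PowRel k p pw) (UniversalEnvelopingAlgebra.ι k a)

variable {k}

/-- The span `L_{≤ d}` of the homogeneous elements of `L` of degree at most `d`. -/
def degLE (ℒ : ℝ → Submodule k L) (d : ℝ) : Submodule k L := ⨆ e ≤ d, ℒ e

/-- The homogeneous component of degree `d` of `U(L)`: the span of the products `a_1 ⋯ a_m` with
`a_i` homogeneous of degree `d_i` and `d_1 + ⋯ + d_m = d` (the empty product has degree `0`). -/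
def envDeg (p : ℕ) (pw : L → L) (ℒ : ℝ → Submodule k L) (d : ℝ) :
    Submodule k (Env k p pw) :=
  Submodule.span k {u | ∃ l : List (ℝ × L), (∀ t ∈ l, t.2 ∈ ℒ t.1) ∧
    (l.map Prod.fst).sum = d ∧ (l.map fun t => envι k p pw t.2).prod = u}

/-- The span `U(L)_{≤ d}` of the homogeneous elements of `U(L)` of degree at most `d`. -/
def envDegLE (p : ℕ) (pw : L → L) (ℒ : ℝ → Submodule k L) (d : ℝ) :
    Submodule k (Env k p pw) := ⨆ e ≤ d, envDeg p pw ℒ e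

/-- `f ≾ g`: there is a constant `C > 0` with `f d ≤ C * g (C * d)` for all `d ≥ 1`. -/
def GrowthLE (f g : ℝ → ℝ) : Prop := ∃ C > 0, ∀ d ≥ 1, f d ≤ C * g (C * d)

end Enveloping

/-! ### Weakly branched self-similar Lie algebras -/

section Branched

variable {k X L : Type*} [Field k] [CommRing X] [Algebra k X] [LieRing L] [LieAlgebra k L]

/-- With respect to an augmentation `ε : X → k`: the map `(ε ⊗ 1) ψ : ker π → L` is onto, where
`π : L → Der X` is the projection. -/
def IsRecurrent (ψ : L →ₗ⁅k⁆ Wreath k X L) (ε : X →ₐ[k] k) : Prop :=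
  ∀ b : L, ∃ a : L, top ψ a = 0 ∧
    TensorProduct.lid k L ((ε : X →ₗ[k] k).rTensor L (coord ψ a)) = b

/-- Every `v ∈ X ^ ⊗ n` is of the form `u · (θ ⊗ ⋯ ⊗ θ)` with `u ∈ U(L)`; the action of `U(L)` on
`T(X)` is through the subalgebra of `End T(X)` generated by the image of `L`. -/
def IsTransitive (ψ : L →ₗ⁅k⁆ Wreath k X L) (θ : X) : Prop :=
  ∀ (n : ℕ), ∀ v ∈ LinearMap.range (TensorAlgebra.ι k (M := X)) ^ n,
    ∃ u ∈ Algebra.adjoin k (Set.range (act ψ)), u (TensorAlgebra.ι k θ ^ n) = v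

/-- `L` is regularly weakly branched: the alphabet is `X = k[x]/(x ^ m)` with `m ≥ 1`, the image of
`L` in `Der X` is `k ∂_x`, `L` is recurrent and transitive (with `θ = x ^ (m - 1)`), and there is a
non-zero ideal `K` of `L` with `X ⊗ K ≤ ψ(K)`. -/
def IsRegularlyWeaklyBranched (ψ : L →ₗ⁅k⁆ Wreath k X L) : Prop :=
  ∃ (m : ℕ) (e : AdjoinRoot (Polynomial.X ^ m : Polynomial k) ≃ₐ[k] X)
    (D : Derivation k X X) (ε : X →ₐ[k] k),
    1 ≤ m ∧ D (e (AdjoinRoot.root _)) = 1 ∧ LinearMap.range (top ψ) = Submodule.span k {D} ∧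
    IsRecurrent ψ ε ∧ IsTransitive ψ (e (AdjoinRoot.root _) ^ (m - 1)) ∧
    ∃ K : LieIdeal k L, K ≠ ⊥ ∧
      ∀ u ∈ LinearMap.range ((K.toSubmodule.subtype).lTensor X), ∃ b ∈ K, ψ b = ⟨u, 0⟩

end Branched

end SelfSimilarLie

end

/-! Growth of `L`. Faithfulness makes `ψ` injective, and `ψ` divides degrees by `lam` up to a shift
bounded by the degrees occurring in `X`. Hence `L_{≤ d}` embeds into `X ⊗ L_{≤ (d + c) / lam}` plus
`End X`, and iterating the resulting inequality gives `dim L_{≤ d} = O(d ^ θ₀)`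
(`exists_finrank_degLE_le_rpow`). As the generators have degrees at least some `δ > 0`, degree `d`
involves products of at most `d / δ` generators. So all `L_{≤ d}` are finite-dimensional, and the
growth by degree and the growth by word length control each other (`gkDim_le`, `le_gkDim`,
`exists_finrank_degLE_le_of_gkDim_lt`). An ideal `K` with `X ⊗ K ≤ ψ(K)` yields the opposite
inequality, hence growth at least `c d ^ θ₀` (`exists_rpow_le_finrank_degLE`).

Upper bound for `U(L)`. Reordering factors shows that one monomial for each multiset of homogeneous
basis elements suffices to span. The multisets of degree at most `d` number at most `exp (s d) ∏ (1
- exp (-s deg))⁻¹` for every `s > 0` (`multiset_card_le`). If `dim L_{≤ d} = O(d ^ η)`, the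
logarithm of the product is `O(s ^ (-η))` (`exists_sum_neg_log_le`), and `s = d ^ (-1 / (η + 1))`
balances the two exponents.

Lower bound for `U(L)`. With `D = d ^ (1 / (θ + 1))` there are about `D ^ θ` independent elements of
degree at most `D`; their square-free products have degree at most about `d`, and there are
exponentially many of them. Their independence (`linearIndependent_envProd`) comes from a coproduct
`U(L) → End T(X) ⊗ U(L)` built from the natural action: linear forms on the left factor strip
letters one by one. This needs `act` to be an injective restricted representation (`act_pw`, through
Jacobson's formula) whose image misses the identity, which holds because `L` kills `1 ∈ T(X)`. -/

open scoped TensorProduct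

noncomputable section

namespace SelfSimilarLie

/-! ### Jacobson's formula in associative algebras -/

section Jacobson

/-- The sum of all words of length `n` in `x` and `y` containing `x` exactly `s` times. -/
def wordSum {E : Type*} [Ring E] (x y : E) (n s : ℕ) : E :=
  ∑ T ∈ (Finset.univ : Finset (Fin n)).powersetCard s,
    (List.ofFn fun j : Fin n => if j ∈ T then x else y).prod

/-- Words are sorted by their first letter. The case distinction keeps the truncated `s - 1` from
counting words that contain no `x`. -/
theorem wordSum_succ {E : Type*} [Ring E] (x y : E) (n s : ℕ) :
    wordSum x y (n + 1) s =
      (if s = 0 then 0 else x * wordSum x y n (s - 1)) + y * wordSum x y n s := by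
  classical
  have h0 : ∀ r, ∀ T ∈ ((Finset.univ : Finset (Fin n)).map (Fin.succEmb n)).powersetCard r,
      (0 : Fin (n + 1)) ∉ T := by
    intro r T hT h
    have := (Finset.mem_powersetCard.1 hT).1 h
    simp at this
  have key : ∀ r, ∑ T ∈ ((Finset.univ : Finset (Fin n)).map (Fin.succEmb n)).powersetCard r,
      (List.ofFn fun j : Fin (n + 1) => if j ∈ T then x else y).prod = y * wordSum x y n r := by
    intro r
    rw [Finset.powersetCard_map, Finset.sum_map, wordSum, Finset.mul_sum]
    refine Finset.sum_congr rfl fun T _ => ?_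
    simp [List.ofFn_succ]
  have key' : ∀ r, ∑ T ∈ ((Finset.univ : Finset (Fin n)).map (Fin.succEmb n)).powersetCard r,
      (List.ofFn fun j : Fin (n + 1) => if j ∈ insert 0 T then x else y).prod =
        x * wordSum x y n r := by
    intro r
    rw [Finset.powersetCard_map, Finset.sum_map, wordSum, Finset.mul_sum]
    refine Finset.sum_congr rfl fun T _ => ?_
    simp [List.ofFn_succ, Fin.succ_ne_zero]
  have hu : (Finset.univ : Finset (Fin (n + 1))) =
      insert 0 ((Finset.univ : Finset (Fin n)).map (Fin.succEmb n)) := by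
    ext i
    refine Fin.cases ?_ (fun j => ?_) i <;> simp
  have h0' : (0 : Fin (n + 1)) ∉ (Finset.univ : Finset (Fin n)).map (Fin.succEmb n) := by simp
  obtain _ | s := s
  · rw [if_pos rfl, zero_add, ← key 0, wordSum]
    simp
  · rw [if_neg (Nat.succ_ne_zero s), Nat.add_sub_cancel, ← key, ← key', wordSum, hu,
      Finset.powersetCard_succ_insert h0', Finset.sum_union, add_comm, Finset.sum_image]
    · intro T hT T' hT' h
      rw [← Finset.erase_insert (h0 s T hT), ← Finset.erase_insert (h0 s T' hT'), h]
    · rw [Finset.disjoint_left]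
      intro T hT hT'
      obtain ⟨T', -, rfl⟩ := Finset.mem_image.1 hT'
      exact h0 _ _ hT (Finset.mem_insert_self _ _)

theorem jacobsonTerm_eq {k M : Type*} [Field k] [LieRing M] [LieAlgebra k M] (p i : ℕ) (a b : M) :
    jacobsonTerm k p i a b = (i : k)⁻¹ •
      wordSum (LieAlgebra.ad k M a) (LieAlgebra.ad k M b) (p - 1) (i - 1) a := by
  rw [jacobsonTerm, wordSum, LinearMap.sum_apply]

open Polynomial in
-- In `A[t]` the variable is central, so in the iterated commutator with `t a + b` the power of `t`
-- counts how often `a` was chosen.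
theorem map_wordSum_ad {k M A : Type*} [Field k] [LieRing M] [LieAlgebra k M] [Ring A]
    [Algebra k A] (σ : M →ₗ[k] A) (hσ : ∀ x y, σ ⁅x, y⁆ = σ x * σ y - σ y * σ x) (a b c : M)
    (n s : ℕ) :
    σ (wordSum (LieAlgebra.ad k M a) (LieAlgebra.ad k M b) n s c) =
      ((fun g => (C (σ a) * X + C (σ b)) * g - g * (C (σ a) * X + C (σ b)))^[n]
        (C (σ c))).coeff s := by
  induction n generalizing s with
  | zero =>
    obtain _ | s := s
    · simp [wordSum]
    · simp [wordSum]
  | succ n ih =>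
    rw [Function.iterate_succ_apply', wordSum_succ]
    generalize hg : (fun g => (C (σ a) * X + C (σ b)) * g - g * (C (σ a) * X + C (σ b)))^[n]
        (C (σ c)) = g at ih
    have hX : ∀ (u : A) (g : A[X]), C u * X * g = C u * g * X := fun u g => by
      rw [mul_assoc, X_mul, mul_assoc]
    obtain _ | s := s
    · simp [hσ, ih, add_mul, mul_add, hX, ← mul_assoc]
    · simp [hσ, ih, add_mul, mul_add, hX, ← mul_assoc, coeff_mul_X]
      abel

/-- Pascal's rule: `p.choose (j + 1)` vanishes in `E`, so consecutive coefficients in row `p - 1`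
are opposite. -/
theorem choose_prime_sub_one {E : Type*} [Ring E] {p : ℕ} (hp : p.Prime) (h : (p : E) = 0) (j : ℕ)
    (hj : j < p) : ((p - 1).choose j : E) = (-1) ^ j := by
  induction j with
  | zero => simp
  | succ j ih =>
    have h1 : p.choose (j + 1) = (p - 1).choose j + (p - 1).choose (j + 1) := by
      conv_lhs => rw [← Nat.sub_add_cancel hp.one_le]
      rw [Nat.choose_succ_succ]
    obtain ⟨r, hr⟩ := hp.dvd_choose_self (Nat.succ_ne_zero j) hj
    have h2 : ((p.choose (j + 1) : ℕ) : E) = 0 := by rw [hr, Nat.cast_mul, h, zero_mul]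
    rw [h1, Nat.cast_add, ih (by omega)] at h2
    rw [pow_succ, mul_neg_one]
    exact eq_neg_of_add_eq_zero_right h2

/-- The binomial coefficients are signs, and they cancel those of the powers of `-y`. -/
theorem Commute.sub_pow_prime_sub_one {E : Type*} [Ring E] {p : ℕ} (hp : p.Prime)
    (h : (p : E) = 0) {x y : E} (hxy : Commute x y) :
    (x - y) ^ (p - 1) = ∑ j ∈ Finset.range p, x ^ j * y ^ (p - 1 - j) := by
  rw [sub_eq_add_neg, hxy.neg_right.add_pow, Nat.sub_add_cancel hp.one_le]
  refine Finset.sum_congr rfl fun j hj => ?_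
  have hj := Finset.mem_range.1 hj
  rw [← Nat.choose_symm (by omega), choose_prime_sub_one hp h _ (by omega), neg_pow, mul_assoc,
    ← ((Commute.neg_one_left _).pow_left _).eq, ← mul_assoc ((-1 : E) ^ _), ← pow_add, Even.neg_one_pow ⟨_, rfl⟩, one_mul]

/-- The commutator with `x` is the difference of left and right multiplication by `x`, which
commute. -/
theorem commutator_iterate_prime_sub_one {A : Type*} [Ring A] {p : ℕ} (hp : p.Prime)
    (h : (p : A) = 0) (x g : A) :
    (fun g => x * g - g * x)^[p - 1] g = ∑ j ∈ Finset.range p, x ^ j * g * x ^ (p - 1 - j) := by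
  have hE : (p : Module.End ℤ A) = 0 := by
    ext u
    simp [h]
  have key := Commute.sub_pow_prime_sub_one hp hE
    (x := LinearMap.mulLeft ℤ x) (y := LinearMap.mulRight ℤ x) (LinearMap.commute_mulLeft_right x x)
  have := LinearMap.congr_fun key g
  rw [Module.End.pow_apply, LinearMap.sum_apply] at this
  refine Eq.trans this (Finset.sum_congr rfl fun j _ => ?_)
  simp [LinearMap.pow_mulLeft, LinearMap.pow_mulRight, mul_assoc]

open Polynomial in
theorem derivative_pow_eq_sum {A : Type*} [Ring A] (g : A[X]) (n : ℕ) :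
    derivative (g ^ n) = ∑ j ∈ Finset.range n, g ^ j * derivative g * g ^ (n - 1 - j) := by
  induction n with
  | zero => simp
  | succ n ih =>
    rw [pow_succ, derivative_mul, ih, Finset.sum_range_succ, Finset.sum_mul]
    congr 1
    · refine Finset.sum_congr rfl fun j hj => ?_
      have := Finset.mem_range.1 hj
      rw [mul_assoc, ← pow_succ]
      congr 2
      omega
    · simp

open Polynomial in
/-- Jacobson's formula, for the images in an associative algebra of elements of a Lie algebra. -/
theorem add_pow_jacobson {k M A : Type*} [Field k] [LieRing M] [LieAlgebra k M] [Ring A]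
    [Algebra k A] {p : ℕ} [CharP k p] (hp : p.Prime)
    (σ : M →ₗ[k] A) (hσ : ∀ x y, σ ⁅x, y⁆ = σ x * σ y - σ y * σ x) (a b : M) :
    (σ a + σ b) ^ p = σ a ^ p + σ b ^ p +
      ∑ i ∈ Finset.Icc 1 (p - 1), σ (jacobsonTerm k p i a b) := by
  set h : A[X] := C (σ a) * X + C (σ b) with hh
  have hpA : (p : A[X]) = 0 := by
    rw [← map_natCast (algebraMap k A[X]), CharP.cast_eq_zero, map_zero]
  -- The `t`-derivative of `(t a + b) ^ p` and `ad (t a + b) ^ (p - 1) a` both equal `∑ h ^ j a h ^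
  -- (p - 1 - j)`. Comparing coefficients of `t ^ (i - 1)` determines those of `h ^ p` for `0 < i <
  -- p`, where `i` is invertible.
  have hder : derivative (h ^ p) =
      (fun g => h * g - g * h)^[p - 1] (C (σ a)) := by
    rw [commutator_iterate_prime_sub_one hp hpA, derivative_pow_eq_sum]
    simp [hh]
  have hcoeff : ∀ i ∈ Finset.Icc 1 (p - 1), (h ^ p).coeff i = σ (jacobsonTerm k p i a b) := by
    intro i hi
    obtain ⟨hi1, hi2⟩ := Finset.mem_Icc.1 hi
    rw [jacobsonTerm_eq, map_smul, map_wordSum_ad σ hσ, ← hh, ← hder, coeff_derivative]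
    have hne : (i : k) ≠ 0 := by
      rw [Ne, CharP.cast_eq_zero_iff k p]
      exact Nat.not_dvd_of_pos_of_lt hi1 (by have := hp.one_le; omega)
    have : ((i - 1 : ℕ) : A) + 1 = algebraMap k A (i : k) := by
      rw [map_natCast, ← Nat.cast_succ, Nat.succ_eq_add_one, Nat.sub_add_cancel hi1]
    rw [this, Nat.sub_add_cancel hi1, ← Algebra.commutes, ← Algebra.smul_def, smul_smul,
      inv_mul_cancel₀ hne, one_smul]
  have hdeg : (h ^ p).natDegree ≤ p := by
    refine natDegree_pow_le.trans ?_
    calc p * h.natDegree ≤ p * 1 := by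
          gcongr
          exact natDegree_linear_le
      _ = p := mul_one p
  have heval : (h ^ p).eval 1 = (σ a + σ b) ^ p := by
    refine (map_pow (eval₂RingHom' (RingHom.id A) 1 fun a => Commute.one_right _) h p).trans ?_
    congr 1
    change h.eval 1 = _
    simp [hh]
  have h0 : (h ^ p).coeff 0 = σ b ^ p := by
    refine (map_pow (constantCoeff (R := A)) h p).trans ?_
    simp [hh]
  have hP : (h ^ p).coeff p = σ a ^ p := by
    have := coeff_pow_of_natDegree_le (p := h) (n := 1) (m := p) natDegree_linear_le
    rw [mul_one] at this
    simpa [hh] using this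
  rw [← heval, eval_eq_sum_range' (Nat.lt_succ_of_le hdeg)]
  simp only [one_pow, mul_one]
  rw [Finset.sum_range_succ, hP, Finset.range_eq_Ico, Finset.sum_eq_sum_Ico_succ_bot hp.pos, h0,
    ← Finset.sum_congr rfl hcoeff]
  have : Finset.Icc 1 (p - 1) = Finset.Ico (0 + 1) p := by
    ext i
    have := hp.pos
    simp only [Finset.mem_Icc, Finset.mem_Ico]
    omega
  rw [this]
  abel

end Jacobson

/-! ### The natural action is a restricted representation -/

section Action

variable {k X L : Type*} [Field k] [CommRing X] [Algebra k X] [LieRing L] [LieAlgebra k L]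

/-- Induction by prepending letters, the recursion that governs `act`. -/
theorem tensorAlgebra_induction {P : TensorAlgebra k X → Prop} (one : P 1)
    (add : ∀ v w, P v → P w → P (v + w)) (smul : ∀ (c : k) w, P w → P (c • w))
    (step : ∀ x w, P w → P (TensorAlgebra.ι k x * w)) (w : TensorAlgebra k X) : P w := by
  have key : ∀ w v : TensorAlgebra k X, P v → P (w * v) := by
    intro w
    induction w using TensorAlgebra.induction with
    | algebraMap r => intro v hv; rw [← Algebra.smul_def]; exact smul r v hv
    | ι x => exact step x
    | mul a b ha hb => intro v hv; rw [mul_assoc]; exact ha _ (hb v hv)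
    | add a b ha hb => intro v hv; rw [add_mul]; exact add _ _ (ha v hv) (hb v hv)
  simpa using key w 1 one

/-- The two kinds of generators are those on which `IsRestricted` prescribes the `p`-mapping `q`. -/
theorem wreath_induction {P : Wreath k X L → Prop} (tmul : ∀ (x : X) (a : L), P ⟨x ⊗ₜ a, 0⟩)
    (der : ∀ δ, P ⟨0, δ⟩) (add : ∀ u v, P u → P v → P (u + v)) (u : Wreath k X L) : P u := by
  obtain ⟨t, δ⟩ := u
  have h : (⟨t, δ⟩ : Wreath k X L) = ⟨t, 0⟩ + ⟨0, δ⟩ := by simp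
  rw [h]
  clear h
  refine add _ _ ?_ (der δ)
  induction t with
  | zero => exact der 0
  | tmul x a => exact tmul x a
  | add s t hs ht =>
    have h : (⟨s + t, 0⟩ : Wreath k X L) = ⟨s, 0⟩ + ⟨t, 0⟩ := by simp
    rw [h]
    exact add _ _ hs ht

theorem derAction_tmul (δ : Derivation k X X) (x : X) (a : L) :
    derAction k X L δ (x ⊗ₜ a) = δ x ⊗ₜ a := rfl

/-- The action of the wreath product on `X ⊗ T(X)`. -/
def wreathAct (ψ : L →ₗ⁅k⁆ Wreath k X L) :
    Wreath k X L →ₗ[k] Module.End k (X ⊗[k] TensorAlgebra k X) :=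
  TensorProduct.homTensorHomMap (RingHom.id k) X (TensorAlgebra k X) X (TensorAlgebra k X) ∘ₗ
      TensorProduct.map (LinearMap.mul k X) (act ψ) ∘ₗ
      LieAlgebra.SemiDirectSum.projl (derAction k X L) +
    { toFun := fun u => (u.right : X →ₗ[k] X).rTensor (TensorAlgebra k X)
      map_add' := fun u v => by
        rw [← LinearMap.rTensor_add]
        rfl
      map_smul' := fun c u => by
        rw [RingHom.id_apply, ← LinearMap.rTensor_smul]
        rfl }

theorem wreathAct_tmul (ψ : L →ₗ⁅k⁆ Wreath k X L) (y : X) (a : L) :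
    wreathAct ψ ⟨y ⊗ₜ a, 0⟩ = TensorProduct.map (LinearMap.mul k X y) (act ψ a) := by
  ext
  simp [wreathAct]

theorem wreathAct_der (ψ : L →ₗ⁅k⁆ Wreath k X L) (δ : Derivation k X X) :
    wreathAct ψ ⟨0, δ⟩ = (δ : X →ₗ[k] X).rTensor (TensorAlgebra k X) := by
  ext
  simp [wreathAct]

variable (k X) in
/-- Concatenation of a letter and a tensor. -/
def consTensor : X ⊗[k] TensorAlgebra k X →ₗ[k] TensorAlgebra k X :=
  TensorProduct.lift (LinearMap.mul k (TensorAlgebra k X) ∘ₗ TensorAlgebra.ι k)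

theorem consTensor_tmul (x : X) (w : TensorAlgebra k X) :
    consTensor k X (x ⊗ₜ w) = TensorAlgebra.ι k x * w := by
  simp [consTensor]

/-- Concatenation intertwines the two actions, so an identity at `x ⊗ w` becomes one about a single
letter together with the same identity at the shorter tensor `w`. -/
theorem act_consTensor (ψ : L →ₗ⁅k⁆ Wreath k X L) (a : L) (z : X ⊗[k] TensorAlgebra k X) :
    act ψ a (consTensor k X z) = consTensor k X (wreathAct ψ (ψ a) z) := by
  induction z with
  | zero => simp
  | add u v hu hv => simp only [map_add, hu, hv]
  | tmul x w =>
    rw [consTensor_tmul, act_ι_mul]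
    change TensorProduct.lift _ (ψ a).left + TensorAlgebra.ι k ((ψ a).right x) * w = _
    generalize ψ a = u
    induction u using wreath_induction with
    | tmul y b => simp [wreathAct_tmul, consTensor_tmul, mul_comm]
    | der δ => simp [wreathAct_der, consTensor_tmul]
    | add u v hu hv =>
      rw [map_add, LinearMap.add_apply, map_add, ← hu, ← hv]
      simp only [LieAlgebra.SemiDirectSum.add_eq_mk, map_add, Derivation.add_apply, add_mul]
      abel

/-- The bracket identity for `act` is assumed only at the one tensor `w`, so that this can serve
inside the induction on `w` which proves it. -/
theorem wreathAct_lie_tmul (ψ : L →ₗ⁅k⁆ Wreath k X L) (w : TensorAlgebra k X)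
    (hw : ∀ a b, act ψ ⁅a, b⁆ w = act ψ a (act ψ b w) - act ψ b (act ψ a w))
    (u v : Wreath k X L) (x : X) :
    wreathAct ψ ⁅u, v⁆ (x ⊗ₜ w) =
      wreathAct ψ u (wreathAct ψ v (x ⊗ₜ w)) - wreathAct ψ v (wreathAct ψ u (x ⊗ₜ w)) := by
  induction u using wreath_induction with
  | add u u' h h' =>
    simp only [add_lie, map_add, LinearMap.add_apply, h, h']
    abel
  | tmul y a =>
    induction v using wreath_induction with
    | add v v' h h' =>
      simp only [lie_add, map_add, LinearMap.add_apply, h, h']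
      abel
    | tmul z b =>
      have h : ⁅(⟨y ⊗ₜ a, 0⟩ : Wreath k X L), (⟨z ⊗ₜ b, 0⟩ : Wreath k X L)⁆ = ⟨(y * z) ⊗ₜ ⁅a, b⁆, 0⟩ := by
        simp
      rw [h]
      simp only [wreathAct_tmul, TensorProduct.map_tmul, hw, TensorProduct.tmul_sub,
        LinearMap.mul_apply']
      rw [mul_assoc, mul_left_comm z y x]
    | der δ =>
      have h : ⁅(⟨y ⊗ₜ a, 0⟩ : Wreath k X L), (⟨0, δ⟩ : Wreath k X L)⁆ = - ⟨δ y ⊗ₜ a, 0⟩ := by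
        simp [derAction_tmul]
      rw [h, map_neg]
      simp [wreathAct_tmul, wreathAct_der, TensorProduct.add_tmul, mul_comm]
  | der δ =>
    induction v using wreath_induction with
    | add v v' h h' =>
      simp only [lie_add, map_add, LinearMap.add_apply, h, h']
      abel
    | tmul y a =>
      have h : ⁅(⟨0, δ⟩ : Wreath k X L), (⟨y ⊗ₜ a, 0⟩ : Wreath k X L)⁆ = ⟨δ y ⊗ₜ a, 0⟩ := by
        simp [derAction_tmul]
      rw [h]
      simp [wreathAct_tmul, wreathAct_der, TensorProduct.add_tmul, mul_comm]
    | der δ' =>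
      have h : ⁅(⟨0, δ⟩ : Wreath k X L), (⟨0, δ'⟩ : Wreath k X L)⁆ = ⟨0, ⁅δ, δ'⁆⟩ := by
        simp
      rw [h]
      simp only [wreathAct_der, LinearMap.rTensor_tmul, Derivation.coeFn_coe,
        Derivation.commutator_apply, TensorProduct.sub_tmul]

theorem act_lie_apply (ψ : L →ₗ⁅k⁆ Wreath k X L) (a b : L) (w : TensorAlgebra k X) :
    act ψ ⁅a, b⁆ w = act ψ a (act ψ b w) - act ψ b (act ψ a w) := by
  induction w using tensorAlgebra_induction generalizing a b with
  | one => simp [act_one]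
  | add v w hv hw =>
    simp only [map_add, hv, hw]
    abel
  | smul c w hw => simp only [map_smul, hw, smul_sub]
  | step x w hw =>
    simp only [← consTensor_tmul, act_consTensor, LieHom.map_lie,
      wreathAct_lie_tmul ψ w hw, map_sub]

theorem act_lie (ψ : L →ₗ⁅k⁆ Wreath k X L) (a b : L) :
    act ψ ⁅a, b⁆ = act ψ a * act ψ b - act ψ b * act ψ a :=
  LinearMap.ext fun w => act_lie_apply ψ a b w

theorem wreathAct_lie (ψ : L →ₗ⁅k⁆ Wreath k X L) (u v : Wreath k X L) :
    wreathAct ψ ⁅u, v⁆ = wreathAct ψ u * wreathAct ψ v - wreathAct ψ v * wreathAct ψ u :=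
  TensorProduct.ext' fun x w =>
    wreathAct_lie_tmul ψ w (fun a b => act_lie_apply ψ a b w) u v x

theorem act_pow_consTensor (ψ : L →ₗ⁅k⁆ Wreath k X L) (a : L) (z : X ⊗[k] TensorAlgebra k X)
    (n : ℕ) :
    (act ψ a ^ n) (consTensor k X z) = consTensor k X ((wreathAct ψ (ψ a) ^ n) z) := by
  induction n with
  | zero => simp
  | succ n ih => rw [pow_succ', Module.End.mul_apply, ih, act_consTensor, pow_succ',
      Module.End.mul_apply]

/-- By the induction on tensors it suffices that `wreathAct` turns `q` into the `p`-th power on `x ⊗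
w`. This is prescribed on the generators of the wreath product and propagates to sums by Jacobson's
formula. -/
theorem act_pw {p : ℕ} [CharP k p] (hp : p ≠ 0) {pw : L → L} {ψ : L →ₗ⁅k⁆ Wreath k X L}
    (hres : IsRestricted p pw ψ) (a : L) : act ψ (pw a) = act ψ a ^ p := by
  have hpp : p.Prime := (CharP.char_is_prime_or_zero k p).resolve_right hp
  obtain ⟨-, q, hq, hq1, hq2, hq3⟩ := hres hp
  have hmulpow : ∀ (y : X) (n : ℕ), LinearMap.mul k X y ^ n = LinearMap.mul k X (y ^ n) := by
    intro y n
    exact LinearMap.pow_mulLeft k X y n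
  have key : ∀ w : TensorAlgebra k X, (∀ a, act ψ (pw a) w = (act ψ a ^ p) w) →
      ∀ (u : Wreath k X L) (x : X), wreathAct ψ (q u) (x ⊗ₜ w) = (wreathAct ψ u ^ p) (x ⊗ₜ w) := by
    intro w hw u x
    induction u using wreath_induction with
    | tmul y b =>
      rw [hq1, wreathAct_tmul, wreathAct_tmul, TensorProduct.map_pow, hmulpow]
      simp [hw]
    | der δ =>
      have h : q ⟨0, δ⟩ = ⟨0, (q ⟨0, δ⟩).right⟩ :=
        LieAlgebra.SemiDirectSum.ext (hq2 δ).1 rfl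
      rw [h, wreathAct_der, wreathAct_der, LinearMap.rTensor_pow]
      simp only [LinearMap.rTensor_tmul, Module.End.pow_apply, Derivation.coeFn_coe, (hq2 δ).2]
    | add u v hu hv =>
      -- The correction terms in the additivity axiom for `q` are mapped to those of Jacobson's
      -- formula for endomorphisms.
      rw [hq.add, map_add, map_add, map_add, add_pow_jacobson hpp (wreathAct ψ) (wreathAct_lie ψ),
        map_sum]
      simp only [LinearMap.add_apply, hu, hv]
  ext w
  induction w using tensorAlgebra_induction generalizing a with
  | one =>
    rw [act_one, ← Nat.sub_add_cancel hpp.one_le, pow_succ, Module.End.mul_apply, act_one,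
      map_zero]
  | add v w hv hw => simp only [map_add, hv, hw]
  | smul c w hw => simp only [map_smul, hw]
  | step x w hw =>
    rw [← consTensor_tmul, act_consTensor, act_pow_consTensor, hq3, key w hw]

theorem act_injective {ψ : L →ₗ⁅k⁆ Wreath k X L} (hfaith : IsFaithful ψ) :
    Function.Injective (act ψ) := by
  refine (injective_iff_map_eq_zero _).2 fun a ha => hfaith a fun w => ?_
  rw [ha, LinearMap.zero_apply]

/-- A faithful self-similarity structure is injective. -/
theorem eq_zero_of_map_eq_zero {ψ : L →ₗ⁅k⁆ Wreath k X L} (hfaith : IsFaithful ψ) {a : L}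
    (ha : ψ a = 0) : a = 0 := by
  refine hfaith a fun w => ?_
  induction w using tensorAlgebra_induction with
  | one => exact act_one ψ a
  | add v w hv hw => rw [map_add, hv, hw, add_zero]
  | smul c w hw => rw [map_smul, hw, smul_zero]
  | step x w hw => rw [← consTensor_tmul, act_consTensor, ha, map_zero,
      LinearMap.zero_apply, map_zero]

end Action

/-! ### Generation of restricted Lie algebras -/

section Generation

variable {k L : Type*} [Field k] [LieRing L] [LieAlgebra k L]

theorem IsPMap.map_zero {p : ℕ} (hp : p ≠ 0) {pw : L → L} (h : IsPMap k p pw) : pw 0 = 0 := by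
  have := h.smul 0 0
  rwa [zero_smul, zero_pow hp, zero_smul] at this

/-- The index monoid is left arbitrary: it will be real degrees, lengths of products, or a single
point when only closure under brackets matters. -/
theorem wordSum_ad_mem {ι : Type*} [AddCommMonoid ι] (Q : ι → Submodule k L)
    (hQ : ∀ {i j : ι} {a b : L}, a ∈ Q i → b ∈ Q j → ⁅a, b⁆ ∈ Q (i + j)) {i j : ι} {a b c : L}
    (ha : a ∈ Q i) (hb : b ∈ Q i) (hc : c ∈ Q j) (n s : ℕ) :
    wordSum (LieAlgebra.ad k L a) (LieAlgebra.ad k L b) n s c ∈ Q (n • i + j) := by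
  induction n generalizing s with
  | zero =>
    obtain _ | s := s
    · simpa [wordSum] using hc
    · simp [wordSum]
  | succ n ih =>
    rw [wordSum_succ, succ_nsmul', add_assoc, LinearMap.add_apply]
    refine add_mem ?_ (hQ hb (ih s))
    split_ifs
    · exact zero_mem _
    · exact hQ ha (ih _)

theorem jacobsonTerm_mem {ι : Type*} [AddCommMonoid ι] (Q : ι → Submodule k L)
    (hQ : ∀ {i j : ι} {a b : L}, a ∈ Q i → b ∈ Q j → ⁅a, b⁆ ∈ Q (i + j)) {i : ι} {a b : L}
    (ha : a ∈ Q i) (hb : b ∈ Q i) (p r : ℕ) :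
    jacobsonTerm k p r a b ∈ Q ((p - 1) • i + i) := by
  rw [jacobsonTerm_eq]
  exact Submodule.smul_mem _ _ (wordSum_ad_mem Q hQ ha hb ha _ _)

theorem mem_of_mem_iSup_of_le {ι : Type*} {ℒ P : ι → Submodule k L} (hind : iSupIndep ℒ)
    (hP : ∀ i, P i ≤ ℒ i) {i : ι} {a : L} (ha : a ∈ ℒ i) (ha' : a ∈ ⨆ j, P j) : a ∈ P i := by
  have h : ⨆ j, P j ≤ P i ⊔ ⨆ (j) (_ : j ≠ i), ℒ j := by
    refine iSup_le fun j => ?_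
    by_cases hj : j = i
    · exact hj ▸ le_sup_left
    · exact (hP j).trans (le_trans (le_iSup₂_of_le j hj le_rfl) le_sup_right)
  obtain ⟨x, hx, y, hy, hxy⟩ := Submodule.mem_sup.1 (h ha')
  have hy0 : y = 0 := by
    refine Submodule.disjoint_def.1 (hind i) y ?_ hy
    rw [← add_sub_cancel_left x y, hxy]
    exact sub_mem ha (hP i hx)
  rw [← hxy, hy0, add_zero]
  exact hx

/-- To bound the homogeneous components of a graded restricted Lie algebra it suffices to bound
the generators. -/
theorem component_le_of_generated {p : ℕ} {pw : L → L} (hpm : p ≠ 0 → IsPMap k p pw)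
    {ℒ : ℝ → Submodule k L} (hint : DirectSum.IsInternal ℒ)
    (hlie : ∀ {i j : ℝ} {a b : L}, a ∈ ℒ i → b ∈ ℒ j → ⁅a, b⁆ ∈ ℒ (i + j))
    (hpw : p ≠ 0 → ∀ {i : ℝ} {a : L}, a ∈ ℒ i → pw a ∈ ℒ (p * i)) {S : Set L}
    (hS : ∀ H : LieSubalgebra k L, (∀ s ∈ S, s ∈ H) → (p ≠ 0 → ∀ a ∈ H, pw a ∈ H) → H = ⊤)
    {Q : ℝ → Submodule k L}
    (hQlie : ∀ {i j : ℝ} {a b : L}, a ∈ Q i → b ∈ Q j → ⁅a, b⁆ ∈ Q (i + j))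
    (hQpw : p ≠ 0 → ∀ {i : ℝ} {a : L}, a ∈ Q i → pw a ∈ Q (p * i))
    (hSQ : ∀ s ∈ S, ∃ d, s ∈ ℒ d ∧ s ∈ Q d) (d : ℝ) : ℒ d ≤ Q d := by
  set P : ℝ → Submodule k L := fun d => ℒ d ⊓ Q d with hP
  have hHlie : ∀ {a b : L}, a ∈ ⨆ d, P d → b ∈ ⨆ d, P d → ⁅a, b⁆ ∈ ⨆ d, P d := by
    intro a b ha hb
    induction ha using Submodule.iSup_induction' with
    | zero => simp
    | add x y _ _ hx hy => rw [add_lie]; exact add_mem hx hy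
    | mem i x hx =>
      induction hb using Submodule.iSup_induction' with
      | zero => simp
      | add u v _ _ hu hv => rw [lie_add]; exact add_mem hu hv
      | mem j y hy =>
        exact Submodule.mem_iSup_of_mem (i + j) ⟨hlie hx.1 hy.1, hQlie hx.2 hy.2⟩
  -- The homogeneous elements satisfying the bound span a restricted subalgebra that contains the
  -- generators, hence all of `L`; independence of the degrees then isolates degree `d`.
  let H : LieSubalgebra k L := { (⨆ d, P d : Submodule k L) with lie_mem' := hHlie }
  have hH : H = ⊤ := by
    refine hS H (fun s hs => ?_) fun hp a ha => ?_
    · obtain ⟨d, h⟩ := hSQ s hs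
      exact Submodule.mem_iSup_of_mem (p := P) d h
    · change a ∈ ⨆ d, P d at ha
      change pw a ∈ ⨆ d, P d
      induction ha using Submodule.iSup_induction' with
      | zero => rw [(hpm hp).map_zero hp]; exact zero_mem _
      | mem i x hx => exact Submodule.mem_iSup_of_mem (p * i) ⟨hpw hp hx.1, hQpw hp hx.2⟩
      | add x y hx hy hx' hy' =>
        rw [(hpm hp).add]
        refine add_mem (add_mem hx' hy') (sum_mem fun r _ => ?_)
        exact jacobsonTerm_mem (fun _ : PUnit => ⨆ d, P d) hHlie (i := PUnit.unit) hx hy p r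
  intro a ha
  have ha' : a ∈ ⨆ d, P d := by
    change a ∈ H
    rw [hH]
    trivial
  exact (mem_of_mem_iSup_of_le hint.submodule_iSupIndep (fun _ => inf_le_left) ha ha').2

theorem MemPow.eq_zero {p : ℕ} {pw : L → L} (hpm : p ≠ 0 → IsPMap k p pw) {S : Submodule k L}
    {n : ℕ} {a : L} (h : MemPow k p pw S n a) (hn : n = 0) : a = 0 := by
  induction h with
  | of _ => simp at hn
  | zero => rfl
  | add _ _ iha ihb => rw [iha hn, ihb hn, add_zero]
  | smul c _ iha => rw [iha hn, smul_zero]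
  | lie _ _ iha ihb => rw [iha (by omega), zero_lie]
  | pw hp _ iha => rw [iha ((Nat.mul_eq_zero.1 hn).resolve_left hp), (hpm hp).map_zero hp]

/-- The `p`-mapping is not linear, but modulo brackets it is additive and semilinear. So the `p`-th
powers of a finite spanning set, the brackets of shorter products and `S` itself suffice, by
induction on the length. -/
theorem powSpace_fg {p : ℕ} [CharP k p] {pw : L → L} (hpm : p ≠ 0 → IsPMap k p pw)
    {S : Submodule k L} (hS : S.FG) (n : ℕ) : (powSpace k p pw S n).FG := by
  induction n using Nat.strong_induction_on with
  | _ n ih =>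
  obtain rfl | hn := Nat.eq_zero_or_pos n
  · convert Submodule.fg_bot
    exact (Submodule.eq_bot_iff _).2 fun a ha => MemPow.eq_zero hpm ha rfl
  choose! B hB using ih
  set br : L →ₗ[k] L →ₗ[k] L := (LieModule.toEnd k L L : L →ₗ[k] Module.End k L)
  set C₁ : Submodule k L := ⨆ i ∈ Finset.Ioo 0 n,
    Submodule.map₂ br (powSpace k p pw S i) (powSpace k p pw S (n - i)) with hC₁
  set C₂ : Submodule k L := ⨆ i ∈ Finset.range n, Submodule.span k (pw '' B i) with hC₂
  have hfg : (S ⊔ C₁ ⊔ C₂).FG := by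
    refine (hS.sup (Submodule.fg_biSup _ _ fun i hi => ?_)).sup
      (Submodule.fg_biSup _ _ fun i _ => Submodule.fg_span ((B i).finite_toSet.image pw))
    obtain ⟨h1, h2⟩ := Finset.mem_Ioo.1 hi
    exact Submodule.FG.map₂ _ ⟨_, hB i h2⟩ ⟨_, hB (n - i) (by omega)⟩
  have hlie : ∀ {i j : ℕ} {a b : L}, i + j = n → MemPow k p pw S i a → MemPow k p pw S j b →
      ⁅a, b⁆ ∈ C₁ := by
    intro i j a b hij ha hb
    obtain rfl | hi := Nat.eq_zero_or_pos i
    · rw [ha.eq_zero hpm rfl, zero_lie]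
      exact zero_mem _
    obtain rfl | hj := Nat.eq_zero_or_pos j
    · rw [hb.eq_zero hpm rfl, lie_zero]
      exact zero_mem _
    refine Submodule.mem_iSup_of_mem i (Submodule.mem_iSup_of_mem
      (Finset.mem_Ioo.2 ⟨hi, by omega⟩) ?_)
    rw [← hij, Nat.add_sub_cancel_left]
    exact Submodule.apply_mem_map₂ br ha hb
  have key : ∀ m a, MemPow k p pw S m a → m = n → a ∈ S ⊔ C₁ ⊔ C₂ := by
    intro m a h hm
    induction h with
    | of h => exact Submodule.mem_sup_left (Submodule.mem_sup_left h)
    | zero => exact zero_mem _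
    | add _ _ iha ihb => exact add_mem (iha hm) (ihb hm)
    | smul c _ iha => exact Submodule.smul_mem _ c (iha hm)
    | lie ha hb _ _ => exact Submodule.mem_sup_left (Submodule.mem_sup_right (hlie hm ha hb))
    | @pw m a hp ha iha =>
      clear iha
      have hpp : p.Prime := (CharP.char_is_prime_or_zero k p).resolve_right hp
      have hmn : m < n := by
        have := hpp.two_le
        have : m ≠ 0 := by rintro rfl; omega
        nlinarith
      have ha' : a ∈ Submodule.span k (B m : Set L) := by rw [hB m hmn]; exact ha
      induction ha' using Submodule.span_induction with
      | mem x hx =>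
        exact Submodule.mem_sup_right (Submodule.mem_iSup_of_mem m (Submodule.mem_iSup_of_mem
          (Finset.mem_range.2 hmn) (Submodule.subset_span ⟨x, hx, rfl⟩)))
      | zero => rw [(hpm hp).map_zero hp]; exact zero_mem _
      | smul c x hx ihx =>
        rw [(hpm hp).smul]
        refine Submodule.smul_mem _ _ (ihx ?_)
        rw [hB m hmn] at hx
        exact hx
      | add x y hx hy ihx ihy =>
        rw [hB m hmn] at hx hy
        rw [(hpm hp).add]
        refine add_mem (add_mem (ihx hx) (ihy hy)) (sum_mem fun r _ =>
          Submodule.mem_sup_left (Submodule.mem_sup_right ?_))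
        rw [jacobsonTerm_eq]
        refine Submodule.smul_mem _ _ ?_
        -- Peeling the outermost of the `p - 1` letters off a Jacobson term exhibits it as a bracket
        -- of two products whose lengths add up to `n`.
        have hw : ∀ s, MemPow k p pw S ((p - 2) • m + m)
            (wordSum (LieAlgebra.ad k L x) (LieAlgebra.ad k L y) (p - 2) s x) := fun s =>
          wordSum_ad_mem (powSpace k p pw S) MemPow.lie hx hy hx _ _
        have h2 := hpp.two_le
        have hpm2 : m + ((p - 2) • m + m) = n := by
          rw [← hm, smul_eq_mul]
          obtain ⟨q, rfl⟩ := Nat.exists_eq_add_of_le h2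
          rw [Nat.add_sub_cancel_left]
          ring
        rw [show p - 1 = (p - 2) + 1 by omega, wordSum_succ, LinearMap.add_apply]
        refine add_mem ?_ (hlie hpm2 hy (hw _))
        split_ifs
        · exact zero_mem _
        · exact hlie hpm2 hx (hw _)
  have hle : powSpace k p pw S n ≤ S ⊔ C₁ ⊔ C₂ := fun a ha => key n a ha rfl
  have := (Submodule.fg_iff_finiteDimensional _).1 hfg
  exact (Submodule.fg_iff_finiteDimensional _).2 (Submodule.finiteDimensional_of_le hle)

theorem powSpaceLE_finiteDimensional {p : ℕ} [CharP k p] {pw : L → L}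
    (hpm : p ≠ 0 → IsPMap k p pw) {S : Submodule k L} (hS : S.FG) (n : ℕ) :
    FiniteDimensional k (powSpaceLE k p pw S n) :=
  (Submodule.fg_iff_finiteDimensional _).1
    (Submodule.fg_biSup _ _ fun m _ => powSpace_fg hpm hS m)

/-- If the generators have degree at least `δ`, then an element of degree `d` is a combination of
products of at most `d / δ` generators. -/
theorem component_le_iSup_powSpace {p : ℕ} {pw : L → L} (hpm : p ≠ 0 → IsPMap k p pw)
    {ℒ : ℝ → Submodule k L} (hint : DirectSum.IsInternal ℒ)
    (hlie : ∀ {i j : ℝ} {a b : L}, a ∈ ℒ i → b ∈ ℒ j → ⁅a, b⁆ ∈ ℒ (i + j))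
    (hpw : p ≠ 0 → ∀ {i : ℝ} {a : L}, a ∈ ℒ i → pw a ∈ ℒ (p * i)) {S : Set L}
    (hS : ∀ H : LieSubalgebra k L, (∀ s ∈ S, s ∈ H) → (p ≠ 0 → ∀ a ∈ H, pw a ∈ H) → H = ⊤)
    {δ : ℝ} (hSδ : ∀ s ∈ S, ∃ d ≥ δ, s ∈ ℒ d) (d : ℝ) :
    ℒ d ≤ ⨆ (m : ℕ) (_ : 1 ≤ m ∧ m * δ ≤ d), powSpace k p pw (Submodule.span k S) m := by
  rw [iSup_subtype']
  let Q : ℝ → Submodule k L := fun t =>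
    ⨆ m : {m : ℕ // 1 ≤ m ∧ m * δ ≤ t}, powSpace k p pw (Submodule.span k S) m
  have hmem : ∀ {t : ℝ} {m : ℕ} {a : L}, 1 ≤ m → m * δ ≤ t →
      MemPow k p pw (Submodule.span k S) m a → a ∈ Q t := fun h1 h2 h =>
    Submodule.mem_iSup_of_mem ⟨_, h1, h2⟩ h
  have hind : ∀ {t : ℝ} {C : L → Prop}, (∀ (m : ℕ) a, 1 ≤ m → m * δ ≤ t →
      MemPow k p pw (Submodule.span k S) m a → C a) → C 0 →
      (∀ a b, a ∈ Q t → b ∈ Q t → C a → C b → C (a + b)) → ∀ a ∈ Q t, C a := by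
    intro t C h1 h2 h3 a ha
    induction ha using Submodule.iSup_induction' with
    | mem m x hx => exact h1 m x m.2.1 m.2.2 hx
    | zero => exact h2
    | add x y hx hy hx' hy' => exact h3 x y hx hy hx' hy'
  have hQlie : ∀ {i j : ℝ} {a b : L}, a ∈ Q i → b ∈ Q j → ⁅a, b⁆ ∈ Q (i + j) := by
    intro i j a b ha hb
    refine hind (C := fun a => ⁅a, b⁆ ∈ Q (i + j)) (fun m a hm1 hm2 ha => ?_) ?_
      (fun a a' _ _ h h' => ?_) a ha
    · refine hind (C := fun b => ⁅a, b⁆ ∈ Q (i + j)) (fun n b hn1 hn2 hb => ?_) ?_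
        (fun b b' _ _ h h' => ?_) b hb
      · refine hmem (by omega) ?_ (MemPow.lie ha hb)
        push_cast
        linarith
      · rw [lie_zero]; exact zero_mem _
      · rw [lie_add]; exact add_mem h h'
    · rw [zero_lie]; exact zero_mem _
    · rw [add_lie]; exact add_mem h h'
  refine component_le_of_generated hpm hint hlie hpw hS (Q := Q) hQlie (fun hp i a ha => ?_)
    (fun s hs => ?_) d
  · refine hind (C := fun a => pw a ∈ Q (p * i)) (fun m a hm1 hm2 ha => ?_) ?_
      (fun a a' ha ha' h h' => ?_) a ha
    · refine hmem (Nat.one_le_iff_ne_zero.2 (mul_ne_zero hp (by omega))) ?_ (MemPow.pw hp ha)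
      push_cast
      rw [mul_assoc]
      gcongr
    · rw [(hpm hp).map_zero hp]; exact zero_mem _
    · rw [(hpm hp).add]
      refine add_mem (add_mem h h') (sum_mem fun r _ => ?_)
      have := jacobsonTerm_mem Q hQlie ha ha' p r
      rwa [← succ_nsmul, Nat.sub_add_cancel (Nat.one_le_iff_ne_zero.2 hp), nsmul_eq_mul] at this
  · obtain ⟨d, hd, hsd⟩ := hSδ s hs
    exact ⟨d, hsd, hmem le_rfl (by simpa using hd) (MemPow.of (Submodule.subset_span hs))⟩

end Generation

/-! ### Growth of graded self-similar Lie algebras -/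

/-! ### Iteration of scaling inequalities for real functions -/

section RealGrowth

theorem rpow_log_div_log_pow {m lam : ℝ} (hm : 0 < m) (hlam : 1 < lam) (n : ℕ) :
    (lam ^ n) ^ (Real.log m / Real.log lam) = m ^ n := by
  have h0 : 0 < lam := by linarith
  have hl : Real.log lam ≠ 0 := (Real.log_pos hlam).ne'
  rw [← Real.rpow_natCast, ← Real.rpow_mul h0.le, Real.rpow_def_of_pos h0, ← Real.rpow_natCast m,
    Real.rpow_def_of_pos hm]
  congr 1
  field_simp

theorem exists_le_rpow_of_le_mul_add {f : ℝ → ℝ} (hf : Monotone f) (hf0 : ∀ d, 0 ≤ f d)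
    {m lam c D : ℝ} (hm : 2 ≤ m) (hlam : 1 < lam) (hc : 0 ≤ c) (hD : 0 ≤ D)
    (h : ∀ d, f d ≤ m * f ((d + c) / lam) + D) :
    ∃ C > 0, ∀ d ≥ 1, f d ≤ C * d ^ (Real.log m / Real.log lam) := by
  have h1 : 0 < lam - 1 := by linarith
  have h0 : 0 < lam := by linarith
  -- The fixed point of `d ↦ (d + c) / lam`; measured from it, the step is pure scaling. Adding `D`
  -- to `f` removes the constant term, since `2 * D ≤ m * D`.
  set e := c / (lam - 1) with he
  have hiter : ∀ n : ℕ, f (e + lam ^ n) + D ≤ m ^ n * (f (e + 1) + D) := by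
    intro n
    induction n with
    | zero => simp
    | succ n ih =>
      have h2 : (e + lam ^ (n + 1) + c) / lam = e + lam ^ n := by
        rw [he]
        field_simp
        ring
      have h3 := h (e + lam ^ (n + 1))
      rw [h2] at h3
      calc f (e + lam ^ (n + 1)) + D ≤ m * f (e + lam ^ n) + 2 * D := by linarith
        _ ≤ m * f (e + lam ^ n) + m * D := by gcongr
        _ = m * (f (e + lam ^ n) + D) := by ring
        _ ≤ m * (m ^ n * (f (e + 1) + D)) := by gcongr
        _ = _ := by ring
  have hA : 0 ≤ f (e + 1) + D := add_nonneg (hf0 _) hD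
  refine ⟨m * (f (e + 1) + D + 1), by nlinarith, fun d hd => ?_⟩
  obtain ⟨n, hn1, hn2⟩ := exists_nat_pow_near hd hlam
  have he0 : 0 ≤ e := by positivity
  have hth : 0 ≤ Real.log m / Real.log lam :=
    div_nonneg (Real.log_nonneg (by linarith)) (Real.log_nonneg hlam.le)
  calc f d ≤ f (e + lam ^ (n + 1)) := hf (by linarith)
    _ ≤ m ^ (n + 1) * (f (e + 1) + D) := by linarith [hiter (n + 1)]
    _ ≤ m ^ (n + 1) * (f (e + 1) + D + 1) :=
      mul_le_mul_of_nonneg_left (by linarith) (by positivity)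
    _ = m * (f (e + 1) + D + 1) * (lam ^ n) ^ (Real.log m / Real.log lam) := by
      rw [rpow_log_div_log_pow (by linarith) hlam]
      ring
    _ ≤ _ := by gcongr

theorem exists_rpow_le_of_mul_le {f : ℝ → ℝ} (hf : Monotone f) {m lam t₀ : ℝ} (hm : 0 < m)
    (hm1 : 1 ≤ m) (hlam : 1 < lam) (ht₀ : 0 < t₀) (h1 : 1 ≤ f t₀)
    (h : ∀ t ≥ t₀, m * f t ≤ f (lam * t)) :
    ∃ c > 0, ∀ d ≥ t₀, c * d ^ (Real.log m / Real.log lam) ≤ f d := by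
  have h0 : 0 < lam := by linarith
  have hiter : ∀ n : ℕ, m ^ n ≤ f (lam ^ n * t₀) := by
    intro n
    induction n with
    | zero => simpa using h1
    | succ n ih =>
      have h2 : t₀ ≤ lam ^ n * t₀ := le_mul_of_one_le_left ht₀.le (one_le_pow₀ hlam.le)
      calc m ^ (n + 1) = m * m ^ n := pow_succ' _ _
        _ ≤ m * f (lam ^ n * t₀) := by gcongr
        _ ≤ f (lam * (lam ^ n * t₀)) := h _ h2
        _ = _ := by rw [pow_succ', mul_assoc]
  set θ := Real.log m / Real.log lam with hθ
  have hth : 0 ≤ θ := div_nonneg (Real.log_nonneg hm1) (Real.log_nonneg hlam.le)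
  -- `t₀ ^ θ` accounts for the starting point and `m` for rounding `d / t₀` down to a power of
  -- `lam`.
  refine ⟨((t₀ ^ θ) * m)⁻¹, by positivity, fun d hd => ?_⟩
  have hd0 : 0 < d := ht₀.trans_le hd
  obtain ⟨n, hn1, hn2⟩ := exists_nat_pow_near ((one_le_div ht₀).2 hd) hlam
  have h3 : d ^ θ ≤ m ^ (n + 1) * t₀ ^ θ := by
    rw [← rpow_log_div_log_pow hm hlam, ← Real.mul_rpow (by positivity) ht₀.le]
    exact Real.rpow_le_rpow hd0.le ((div_lt_iff₀ ht₀).1 hn2).le hth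
  calc ((t₀ ^ θ) * m)⁻¹ * d ^ θ ≤ ((t₀ ^ θ) * m)⁻¹ * (m ^ (n + 1) * t₀ ^ θ) := by gcongr
    _ = m ^ n := by
      have : t₀ ^ θ ≠ 0 := (Real.rpow_pos_of_pos ht₀ _).ne'
      rw [pow_succ']
      field_simp
    _ ≤ f (lam ^ n * t₀) := hiter n
    _ ≤ f d := hf ((le_div_iff₀ ht₀).1 hn1)

end RealGrowth

/-! ### Polynomial upper bound for `L` from self-similarity -/

section Growth

variable {k X L : Type*} [Field k] [CommRing X] [Algebra k X] [LieRing L] [LieAlgebra k L]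

theorem degLE_mono (ℒ : ℝ → Submodule k L) : Monotone (degLE ℒ) := fun _ _ h =>
  iSup₂_le fun e he => le_iSup₂_of_le e (he.trans h) le_rfl

theorem le_degLE (ℒ : ℝ → Submodule k L) {e d : ℝ} (h : e ≤ d) : ℒ e ≤ degLE ℒ d :=
  le_iSup₂_of_le e h le_rfl

theorem exists_mem_degLE {ℒ : ℝ → Submodule k L} (hint : DirectSum.IsInternal ℒ) (a : L) :
    ∃ d, a ∈ degLE ℒ d := by
  have ha : a ∈ ⨆ d, ℒ d := by
    rw [hint.submodule_iSup_eq_top]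
    trivial
  induction ha using Submodule.iSup_induction' with
  | mem i x hx => exact ⟨i, le_degLE ℒ le_rfl hx⟩
  | zero => exact ⟨0, zero_mem _⟩
  | add x y _ _ hx hy =>
    obtain ⟨d, hd⟩ := hx
    obtain ⟨e, he⟩ := hy
    exact ⟨max d e, add_mem (degLE_mono ℒ (le_max_left _ _) hd)
      (degLE_mono ℒ (le_max_right _ _) he)⟩

theorem exists_le_degLE_of_fg {ℒ : ℝ → Submodule k L} (hint : DirectSum.IsInternal ℒ)
    {N : Submodule k L} (hN : N.FG) : ∃ d, N ≤ degLE ℒ d := by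
  obtain ⟨B, rfl⟩ := hN
  choose D hD using exists_mem_degLE hint
  obtain ⟨M, hM⟩ := (B.finite_toSet.image D).bddAbove
  exact ⟨M, Submodule.span_le.2 fun a ha => degLE_mono ℒ (hM ⟨a, ha, rfl⟩) (hD a)⟩

theorem exists_generation_bound {p : ℕ} {pw : L → L} {ψ : L →ₗ⁅k⁆ Wreath k X L}
    (hpm : p ≠ 0 → IsPMap k p pw) {lam : ℝ} {𝒳 : ℝ → Submodule k X} {ℒ : ℝ → Submodule k L}
    (hgraded : IsGraded p pw ψ lam 𝒳 ℒ) (hgen : GeneratedInPositiveDegree p pw ℒ) :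
    ∃ δ > 0, ∃ S : Submodule k L, S.FG ∧ (∀ d < δ, ℒ d = ⊥) ∧
      ∀ d, degLE ℒ d ≤ powSpaceLE k p pw S ⌊d / δ⌋₊ := by
  obtain ⟨S, hS1, hS2⟩ := hgen
  have hδ : ∃ δ > 0, ∀ s ∈ (S : Set L), ∃ d ≥ δ, s ∈ ℒ d := by
    choose! D hD0 hD using hS1
    -- The extra `1` keeps the minimum defined, and positive, when there are no generators.
    have hne : (insert 1 (S.image D)).Nonempty := Finset.insert_nonempty _ _
    refine ⟨(insert 1 (S.image D)).min' hne, ?_, fun s hs => ⟨D s, ?_, hD s hs⟩⟩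
    · refine (Finset.lt_min'_iff _ hne).2 fun y hy => ?_
      obtain rfl | hy := Finset.mem_insert.1 hy
      · exact one_pos
      · obtain ⟨s, hs, rfl⟩ := Finset.mem_image.1 hy
        exact hD0 s hs
    · exact Finset.min'_le _ _ (Finset.mem_insert_of_mem (Finset.mem_image_of_mem D hs))
  obtain ⟨δ, hδ, hSδ⟩ := hδ
  have key := component_le_iSup_powSpace hpm hgraded.internal hgraded.lie_mem hgraded.pw_mem
    hS2 hSδ
  refine ⟨δ, hδ, Submodule.span k S, ⟨S, rfl⟩, fun d hd => ?_, fun d => ?_⟩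
  · refine eq_bot_iff.2 ((key d).trans (iSup₂_le fun m hm => ?_))
    have : (1 : ℝ) ≤ m := by exact_mod_cast hm.1
    nlinarith [hm.2]
  · refine iSup₂_le fun e he => (key e).trans (iSup₂_le fun m hm => ?_)
    refine le_iSup₂_of_le (f := fun m (_ : m ∈ Finset.Icc 1 ⌊d / δ⌋₊) =>
      powSpace k p pw (Submodule.span k S) m) m (Finset.mem_Icc.2 ⟨hm.1, ?_⟩) le_rfl
    exact Nat.le_floor ((le_div_iff₀ hδ).2 (hm.2.trans he))

theorem exists_abs_degree_le [FiniteDimensional k X] {𝒳 : ℝ → Submodule k X}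
    (hint : DirectSum.IsInternal 𝒳) : ∃ c ≥ 0, ∀ i, 𝒳 i ≠ ⊥ → |i| ≤ c := by
  have hfin : {i | 𝒳 i ≠ ⊥}.Finite :=
    WellFoundedGT.finite_ne_bot_of_iSupIndep hint.submodule_iSupIndep
  obtain ⟨M, hM⟩ := (hfin.image fun i => |i|).bddAbove
  exact ⟨max M 0, le_max_right _ _, fun i hi => (hM ⟨i, hi, rfl⟩).trans (le_max_left _ _)⟩

/-- From `i + lam * j = e ≤ d` and `|i| ≤ c` one gets `j ≤ (d + c) / lam`. -/
theorem coord_mem_range_lTensor {p : ℕ} {pw : L → L} {ψ : L →ₗ⁅k⁆ Wreath k X L} {lam : ℝ}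
    (hlam : 1 < lam) {𝒳 : ℝ → Submodule k X} {ℒ : ℝ → Submodule k L}
    (hgraded : IsGraded p pw ψ lam 𝒳 ℒ) {c : ℝ} (hc : ∀ i, 𝒳 i ≠ ⊥ → |i| ≤ c) {d : ℝ} {a : L}
    (ha : a ∈ degLE ℒ d) :
    coord ψ a ∈ LinearMap.range ((degLE ℒ ((d + c) / lam)).subtype.lTensor X) := by
  have h0 : 0 < lam := by linarith
  suffices h : degLE ℒ d ≤ (LinearMap.range
      ((degLE ℒ ((d + c) / lam)).subtype.lTensor X)).comap (coord ψ) from h ha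
  refine iSup₂_le fun e he a ha => ?_
  suffices hle : (⨆ (i : ℝ) (j : ℝ) (_ : i + lam * j = e),
      LinearMap.range (TensorProduct.map (𝒳 i).subtype (ℒ j).subtype)) ≤
      LinearMap.range ((degLE ℒ ((d + c) / lam)).subtype.lTensor X) from hle (hgraded.coord_mem ha)
  refine iSup_le fun i => iSup_le fun j => iSup_le fun hij => ?_
  rintro _ ⟨z, rfl⟩
  induction z with
  | zero => rw [map_zero]; exact zero_mem _
  | add u v hu hv => rw [map_add]; exact add_mem hu hv
  | tmul x y =>
    by_cases hi : 𝒳 i = ⊥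
    · have hx : (x : X) = 0 := (Submodule.mem_bot k).1 (hi ▸ x.2)
      simp [hx]
    · have hj : j ≤ (d + c) / lam := by
        rw [le_div_iff₀ h0]
        linarith [neg_abs_le i, hc i hi]
      exact ⟨x ⊗ₜ ⟨y, le_degLE ℒ hj y.2⟩, by simp⟩

theorem finrank_range_lTensor [FiniteDimensional k X] (W : Submodule k L) :
    Module.finrank k (LinearMap.range (W.subtype.lTensor X)) =
      Module.finrank k X * Module.finrank k W := by
  rw [LinearMap.finrank_range_of_inj (Module.Flat.lTensor_preserves_injective_linearMap _
    W.injective_subtype), Module.finrank_tensorProduct]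

/-- The recursion behind the exponent `θ₀`: `ψ` is injective, its first component lands in `X ⊗ L_{≤
(d + c) / lam}`, and derivations embed into `End X`. -/
theorem finrank_degLE_le [FiniteDimensional k X] {p : ℕ} {pw : L → L}
    {ψ : L →ₗ⁅k⁆ Wreath k X L} (hfaith : IsFaithful ψ) {lam : ℝ}
    (hlam : 1 < lam) {𝒳 : ℝ → Submodule k X} {ℒ : ℝ → Submodule k L}
    (hgraded : IsGraded p pw ψ lam 𝒳 ℒ) (hfin : ∀ d, FiniteDimensional k (degLE ℒ d)) :
    ∃ c ≥ 0, ∀ d, Module.finrank k (degLE ℒ d) ≤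
      Module.finrank k X * Module.finrank k (degLE ℒ ((d + c) / lam)) +
        Module.finrank k (X →ₗ[k] X) := by
  obtain ⟨c, hc0, hc⟩ := exists_abs_degree_le hgraded.alphabet_internal
  refine ⟨c, hc0, fun d => ?_⟩
  set R := LinearMap.range ((degLE ℒ ((d + c) / lam)).subtype.lTensor X) with hR
  let tl : L →ₗ[k] (X →ₗ[k] X) :=
    { toFun := fun a => (top ψ a : X →ₗ[k] X)
      map_add' := fun a b => by ext; simp
      map_smul' := fun r a => by ext; simp }
  let f : degLE ℒ d →ₗ[k] R × (X →ₗ[k] X) :=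
    LinearMap.prod ((coord ψ ∘ₗ (degLE ℒ d).subtype).codRestrict R fun a =>
      coord_mem_range_lTensor hlam hgraded hc a.2) (tl ∘ₗ (degLE ℒ d).subtype)
  have hf : Function.Injective f := by
    refine (injective_iff_map_eq_zero f).2 fun a ha => ?_
    have h1 : coord ψ a = 0 := congrArg (fun z => (z.1 : X ⊗[k] L)) ha
    have h2 : tl a = 0 := congrArg (fun z => z.2) ha
    refine Subtype.ext (eq_zero_of_map_eq_zero hfaith (LieAlgebra.SemiDirectSum.ext h1 ?_))
    exact Derivation.ext fun x => LinearMap.congr_fun h2 x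
  have := LinearMap.finrank_le_finrank_of_injective hf
  rwa [Module.finrank_prod, hR, finrank_range_lTensor] at this

theorem derivation_eq_zero_of_finrank_le_one [FiniteDimensional k X]
    (h : Module.finrank k X ≤ 1) (δ : Derivation k X X) : δ = 0 := by
  obtain ⟨v, hv⟩ := finrank_le_one_iff.1 h
  obtain ⟨r, hr⟩ := hv 1
  ext x
  obtain ⟨s, rfl⟩ := hv x
  by_cases hr0 : r = 0
  · rw [hr0, zero_smul] at hr
    have := subsingleton_of_zero_eq_one hr
    exact Subsingleton.elim _ _
  · rw [← inv_smul_smul₀ hr0 v, hr]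
    simp

/-- An alphabet of dimension at most one has no non-zero derivation, so nothing can act
non-trivially. This settles the case in which the recursion has factor less than `2`. -/
theorem eq_zero_of_finrank_le_one [FiniteDimensional k X] {ψ : L →ₗ⁅k⁆ Wreath k X L}
    (hfaith : IsFaithful ψ) (h : Module.finrank k X ≤ 1) (a : L) : a = 0 := by
  refine hfaith a fun w => ?_
  induction w using tensorAlgebra_induction generalizing a with
  | one => exact act_one ψ a
  | add v w hv hw => rw [map_add, hv, hw, add_zero]
  | smul r w hw => rw [map_smul, hw, smul_zero]
  | step x w hw =>
    have h0 : (act ψ).flip w = 0 := LinearMap.ext fun b => hw b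
    rw [act_ι_mul, derivation_eq_zero_of_finrank_le_one h (top ψ a), h0]
    generalize coord ψ a = u
    induction u with
    | zero => simp
    | add u v hu hv =>
      simp only [Derivation.zero_apply, map_zero, zero_mul, add_zero] at hu hv
      simp [hu, hv]
    | tmul y b => simp

theorem exists_finrank_degLE_le_rpow [FiniteDimensional k X] {p : ℕ} {pw : L → L}
    {ψ : L →ₗ⁅k⁆ Wreath k X L} (hfaith : IsFaithful ψ) {lam : ℝ}
    (hlam : 1 < lam) {𝒳 : ℝ → Submodule k X} {ℒ : ℝ → Submodule k L}
    (hgraded : IsGraded p pw ψ lam 𝒳 ℒ) (hfin : ∀ d, FiniteDimensional k (degLE ℒ d)) :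
    ∃ C > 0, ∀ d ≥ 1, (Module.finrank k (degLE ℒ d) : ℝ) ≤
      C * d ^ (Real.log (Module.finrank k X) / Real.log lam) := by
  by_cases hX : Module.finrank k X ≤ 1
  · refine ⟨1, one_pos, fun d hd => ?_⟩
    have : Subsingleton L := ⟨fun a b => by
      rw [eq_zero_of_finrank_le_one hfaith hX a, eq_zero_of_finrank_le_one hfaith hX b]⟩
    rw [Module.finrank_zero_of_subsingleton]
    have : 0 ≤ d := by linarith
    simp only [Nat.cast_zero]
    positivity
  · obtain ⟨c, hc0, hc⟩ := finrank_degLE_le hfaith hlam hgraded hfin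
    refine exists_le_rpow_of_le_mul_add (f := fun d => (Module.finrank k (degLE ℒ d) : ℝ))
      (fun d e h => ?_) (fun d => Nat.cast_nonneg _) (by exact_mod_cast not_le.1 hX) hlam hc0
      (Nat.cast_nonneg (Module.finrank k (X →ₗ[k] X))) fun d => by exact_mod_cast hc d
    exact Nat.cast_le.2 (Submodule.finrank_mono (degLE_mono ℒ h))

end Growth

/-! ### Growth of weakly branched self-similar Lie algebras -/

/-! ### Homogeneous bases and degrees in tensor products -/

section GradedBasis

variable {k V W : Type*} [Field k] [AddCommGroup V] [Module k V] [AddCommGroup W] [Module k W]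

/-- A basis of homogeneous elements. -/
def gradedBasis {𝒱 : ℝ → Submodule k V} (hint : DirectSum.IsInternal 𝒱) :
    Module.Basis (Σ d : ℝ, Module.Basis.ofVectorSpaceIndex k (𝒱 d)) k V :=
  hint.collectedBasis fun d => Module.Basis.ofVectorSpace k (𝒱 d)

theorem gradedBasis_mem {𝒱 : ℝ → Submodule k V} (hint : DirectSum.IsInternal 𝒱)
    (i : Σ d : ℝ, Module.Basis.ofVectorSpaceIndex k (𝒱 d)) : gradedBasis hint i ∈ 𝒱 i.1 :=
  hint.collectedBasis_mem _ i

theorem gradedBasis_repr_of_ne {𝒱 : ℝ → Submodule k V} (hint : DirectSum.IsInternal 𝒱) {d : ℝ}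
    {v : V} (hv : v ∈ 𝒱 d) {i : Σ d : ℝ, Module.Basis.ofVectorSpaceIndex k (𝒱 d)} (hi : i.1 ≠ d) :
    (gradedBasis hint).repr v i = 0 :=
  hint.collectedBasis_repr_of_mem_ne _ hi.symm hv

/-- The span of the homogeneous elements of `V ⊗ W` whose degree is in `A`, where the degrees of
`W` are scaled by `lam`. -/
def tensorDegree {𝒱 : ℝ → Submodule k V} {𝒲 : ℝ → Submodule k W} (hV : DirectSum.IsInternal 𝒱)
    (hW : DirectSum.IsInternal 𝒲) (lam : ℝ) (A : Set ℝ) : Submodule k (V ⊗[k] W) :=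
  ⨅ (q) (_ : q.1.1 + lam * q.2.1 ∉ A),
    LinearMap.ker (((gradedBasis hV).tensorProduct (gradedBasis hW)).coord q)

variable {𝒱 : ℝ → Submodule k V} {𝒲 : ℝ → Submodule k W} (hV : DirectSum.IsInternal 𝒱)
    (hW : DirectSum.IsInternal 𝒲) (lam : ℝ)

theorem range_map_le_tensorDegree {A : Set ℝ} {i j : ℝ} (h : i + lam * j ∈ A) :
    LinearMap.range (TensorProduct.map (𝒱 i).subtype (𝒲 j).subtype) ≤
      tensorDegree hV hW lam A := by
  refine le_iInf₂ fun q hq => ?_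
  rintro _ ⟨z, rfl⟩
  induction z with
  | zero => rw [map_zero]; exact zero_mem _
  | add u v hu hv => rw [map_add]; exact add_mem hu hv
  | tmul x y =>
    rw [LinearMap.mem_ker, TensorProduct.map_tmul, Module.Basis.coord_apply,
      Module.Basis.tensorProduct_repr_tmul_apply,
      Submodule.subtype_apply, Submodule.subtype_apply]
    by_cases hi : q.1.1 = i
    · have hj : q.2.1 ≠ j := by
        rintro rfl
        rw [← hi] at h
        exact hq h
      rw [gradedBasis_repr_of_ne hW y.2 hj, zero_smul]
    · rw [gradedBasis_repr_of_ne hV x.2 hi, smul_zero]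

/-- Every coordinate in the homogeneous tensor basis vanishes for one of the two reasons. -/
theorem disjoint_tensorDegree (A : Set ℝ) :
    Disjoint (tensorDegree hV hW lam A) (tensorDegree hV hW lam Aᶜ) := by
  refine Submodule.disjoint_def.2 fun z h1 h2 => ?_
  refine ((gradedBasis hV).tensorProduct (gradedBasis hW)).ext_elem fun q => ?_
  rw [map_zero, Finsupp.zero_apply]
  simp only [tensorDegree, Submodule.mem_iInf, LinearMap.mem_ker, Module.Basis.coord_apply]
    at h1 h2
  by_cases hq : q.1.1 + lam * q.2.1 ∈ A
  · exact h2 q fun h => h hq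
  · exact h1 q hq

end GradedBasis

/-! ### Polynomial lower bound from a branching ideal -/

section Branch

variable {k X L : Type*} [Field k] [CommRing X] [Algebra k X] [LieRing L] [LieAlgebra k L]

/-- The degrees of `X` lie in `[-c, c]`, and a shift by more than `2 * c` leaves this interval. -/
theorem top_eq_zero_of_degree {p : ℕ} {pw : L → L} {ψ : L →ₗ⁅k⁆ Wreath k X L} {lam : ℝ}
    {𝒳 : ℝ → Submodule k X} {ℒ : ℝ → Submodule k L}
    (hgraded : IsGraded p pw ψ lam 𝒳 ℒ) {c : ℝ} (hc : ∀ i, 𝒳 i ≠ ⊥ → |i| ≤ c) {d : ℝ}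
    (hd : 2 * c < d) {a : L} (ha : a ∈ ℒ d) : top ψ a = 0 := by
  ext x
  have hx : x ∈ ⨆ i, 𝒳 i := by
    rw [hgraded.alphabet_internal.submodule_iSup_eq_top]
    trivial
  induction hx using Submodule.iSup_induction' with
  | zero => simp
  | add x y _ _ hx hy => simp only [map_add, hx, hy]
  | mem i x hx =>
    by_cases hi : 𝒳 i = ⊥
    · rw [hi, Submodule.mem_bot] at hx
      simp [hx]
    · have hid : 𝒳 (i + d) = ⊥ := by
        by_contra h
        have h1 := hc _ h
        have h2 := hc _ hi
        rw [abs_le] at h1 h2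
        linarith
      have := hgraded.top_mem ha hx
      rwa [hid, Submodule.mem_bot] at this

/-- The degree of `a` is read off from `ψ a`: the part `b'` of `a` in degrees above `D` has
coordinates of degree above `D`, yet these must also have degree at most `D`, so they vanish. Its
derivation part vanishes by degree too, and `ψ` is injective. -/
theorem mem_degLE_of_coord_mem {p : ℕ} {pw : L → L} {ψ : L →ₗ⁅k⁆ Wreath k X L}
    (hfaith : IsFaithful ψ) {lam : ℝ} (hlam : 1 < lam) {𝒳 : ℝ → Submodule k X}
    {ℒ : ℝ → Submodule k L} (hgraded : IsGraded p pw ψ lam 𝒳 ℒ) {c : ℝ}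
    (hc : ∀ i, 𝒳 i ≠ ⊥ → |i| ≤ c) {e : ℝ} (he : c ≤ lam * e) {a : L}
    (ha : coord ψ a ∈ LinearMap.range ((degLE ℒ e).subtype.lTensor X)) :
    a ∈ degLE ℒ (lam * e + c) := by
  have h0 : 0 < lam := by linarith
  set T := tensorDegree hgraded.alphabet_internal hgraded.internal lam
  set D := lam * e + c with hD
  have hcoord : ∀ {A : Set ℝ} {d : ℝ} {b : L}, b ∈ ℒ d → d ∈ A → coord ψ b ∈ T A := by
    intro A d b hb hd
    have := hgraded.coord_mem hb
    refine (?_ : (⨆ (i : ℝ) (j : ℝ) (_ : i + lam * j = d),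
      LinearMap.range (TensorProduct.map (𝒳 i).subtype (ℒ j).subtype)) ≤ T A) this
    exact iSup_le fun i => iSup_le fun j => iSup_le fun h =>
      range_map_le_tensorDegree _ _ _ (h ▸ hd)
  have hu : coord ψ a ∈ T (Set.Iic D) := by
    obtain ⟨z, hz⟩ := ha
    rw [← hz]
    clear hz
    induction z with
    | zero => rw [map_zero]; exact zero_mem _
    | add u v hu hv => rw [map_add]; exact add_mem hu hv
    | tmul x y =>
      rw [LinearMap.lTensor_tmul, Submodule.subtype_apply]
      have hx : x ∈ ⨆ i, 𝒳 i := by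
        rw [hgraded.alphabet_internal.submodule_iSup_eq_top]
        trivial
      induction hx using Submodule.iSup_induction' with
      | zero => rw [TensorProduct.zero_tmul]; exact zero_mem _
      | add x y _ _ hx hy => rw [TensorProduct.add_tmul]; exact add_mem hx hy
      | mem i x hx =>
        suffices h : degLE ℒ e ≤ (T (Set.Iic D)).comap (TensorProduct.mk k X L x) from h y.2
        refine iSup₂_le fun j hj b hb => ?_
        by_cases hi : 𝒳 i = ⊥
        · rw [hi, Submodule.mem_bot] at hx
          rw [Submodule.mem_comap, hx, map_zero, LinearMap.zero_apply]
          exact zero_mem _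
        · refine range_map_le_tensorDegree hgraded.alphabet_internal hgraded.internal lam
            (i := i) (j := j) ?_ ⟨⟨x, hx⟩ ⊗ₜ ⟨b, hb⟩, rfl⟩
          have h1 := (abs_le.1 (hc i hi)).2
          have h2 : lam * j ≤ lam * e := by gcongr
          exact (by linarith : i + lam * j ≤ lam * e + c)
  have htop : a ∈ degLE ℒ D ⊔ ⨆ (d) (_ : D < d), ℒ d := by
    have h : (⨆ d, ℒ d) ≤ degLE ℒ D ⊔ ⨆ (d) (_ : D < d), ℒ d := by
      refine iSup_le fun d => ?_
      obtain h | h := le_or_gt d D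
      · exact le_sup_of_le_left (le_degLE ℒ h)
      · exact le_sup_of_le_right (le_iSup₂_of_le d h le_rfl)
    rw [hgraded.internal.submodule_iSup_eq_top] at h
    exact h trivial
  obtain ⟨b, hb, b', hb', rfl⟩ := Submodule.mem_sup.1 htop
  have h1 : coord ψ b ∈ T (Set.Iic D) := by
    suffices h : degLE ℒ D ≤ (T (Set.Iic D)).comap (coord ψ) from h hb
    exact iSup₂_le fun d hd b hb => hcoord hb hd
  have h2 : coord ψ b' ∈ T (Set.Iic D)ᶜ := by
    suffices h : (⨆ (d) (_ : D < d), ℒ d) ≤ (T (Set.Iic D)ᶜ).comap (coord ψ) from h hb'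
    exact iSup₂_le fun d hd b hb => hcoord hb (not_le.2 hd)
  have h3 : coord ψ b' = 0 := by
    refine Submodule.disjoint_def.1 (disjoint_tensorDegree _ _ lam (Set.Iic D)) _ ?_ h2
    rw [map_add] at hu
    simpa using sub_mem hu h1
  -- `he` gives `2 * c ≤ D`, so derivations of degree above `D` are zero.
  have h4 : top ψ b' = 0 := by
    suffices h : (⨆ (d) (_ : D < d), ℒ d) ≤ LinearMap.ker (top ψ) from h hb'
    exact iSup₂_le fun d hd b hb => top_eq_zero_of_degree hgraded hc (by linarith) hb
  rw [eq_zero_of_map_eq_zero hfaith (LieAlgebra.SemiDirectSum.ext h3 h4 : ψ b' = 0), add_zero]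
  exact hb

/-- Preimages under `ψ` of `X ⊗ (K ∩ L_{≤ e})` lie in `K ∩ L_{≤ lam * e + c}`, so the dimension is
multiplied by at least `dim X` when the degree is essentially multiplied by `lam`. -/
theorem exists_rpow_le_finrank_degLE [FiniteDimensional k X] {p : ℕ} {pw : L → L}
    {ψ : L →ₗ⁅k⁆ Wreath k X L} (hfaith : IsFaithful ψ) {lam : ℝ} (hlam : 1 < lam)
    {𝒳 : ℝ → Submodule k X} {ℒ : ℝ → Submodule k L} (hgraded : IsGraded p pw ψ lam 𝒳 ℒ)
    (hfin : ∀ d, FiniteDimensional k (degLE ℒ d)) {K : Submodule k L} (hK : K ≠ ⊥)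
    (hψK : ∀ u ∈ LinearMap.range (K.subtype.lTensor X), ∃ b ∈ K, ψ b = ⟨u, 0⟩) :
    2 ≤ Module.finrank k X ∧ ∃ c > 0, ∃ d₀ > 0, ∀ d ≥ d₀,
      c * d ^ (Real.log (Module.finrank k X) / Real.log lam) ≤
        (Module.finrank k (degLE ℒ d) : ℝ) := by
  obtain ⟨b₀, hb₀, hb₀0⟩ := Submodule.exists_mem_ne_zero_of_ne_bot hK
  have hX : 2 ≤ Module.finrank k X := by
    by_contra h
    exact hb₀0 (eq_zero_of_finrank_le_one hfaith (by omega) b₀)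
  refine ⟨hX, ?_⟩
  obtain ⟨c, hc0, hc⟩ := exists_abs_degree_le hgraded.alphabet_internal
  have h0 : 0 < lam := by linarith
  have h1 : 0 < lam - 1 := by linarith
  have hfinK : ∀ d, FiniteDimensional k (K ⊓ degLE ℒ d : Submodule k L) := fun d =>
    Submodule.finiteDimensional_of_le inf_le_right
  have hmonoK : ∀ {d e : ℝ}, d ≤ e → K ⊓ degLE ℒ d ≤ K ⊓ degLE ℒ e := fun h =>
    inf_le_inf_left _ (degLE_mono ℒ h)
  have hstep : ∀ e, c ≤ lam * e → Module.finrank k X * Module.finrank k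
      (K ⊓ degLE ℒ e : Submodule k L) ≤
      Module.finrank k (K ⊓ degLE ℒ (lam * e + c) : Submodule k L) := by
    intro e he
    rw [← finrank_range_lTensor]
    refine (Submodule.finrank_mono (?_ : _ ≤ (K ⊓ degLE ℒ (lam * e + c)).map (coord ψ))).trans
      (Submodule.finrank_map_le _ _)
    intro u hu
    have hmono : ∀ {V W : Submodule k L}, V ≤ W →
        LinearMap.range (V.subtype.lTensor X) ≤ LinearMap.range (W.subtype.lTensor X) := by
      intro V W h
      rw [← Submodule.subtype_comp_inclusion V W h, LinearMap.lTensor_comp]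
      exact LinearMap.range_comp_le_range _ _
    obtain ⟨b, hbK, hb⟩ := hψK u (hmono inf_le_left hu)
    have hcb : coord ψ b = u := by
      change (ψ b).left = u
      rw [hb]
    refine ⟨b, ⟨hbK, mem_degLE_of_coord_mem hfaith hlam hgraded hc he ?_⟩, hcb⟩
    rw [hcb]
    exact hmono inf_le_right hu
  obtain ⟨d₁, hd₁⟩ := exists_mem_degLE hgraded.internal b₀
  -- `-s` is the fixed point of `e ↦ lam * e + c`. The threshold `t₀` is large enough for `b₀` to be
  -- counted and for `c ≤ lam * (t - s)` to hold.
  set s := c / (lam - 1) with hs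
  have hs0 : 0 ≤ s := by positivity
  set t₀ := max (d₁ + s) (c + s + 1) with ht₀
  have ht0 : 0 < t₀ := lt_of_lt_of_le (by linarith) (le_max_right _ _)
  set f : ℝ → ℝ := fun t => (Module.finrank k (K ⊓ degLE ℒ (t - s) : Submodule k L) : ℝ) with hf
  have hbase : 1 ≤ f t₀ := by
    have hne : (K ⊓ degLE ℒ (t₀ - s) : Submodule k L) ≠ ⊥ := by
      refine (Submodule.ne_bot_iff _).2 ⟨b₀, ⟨hb₀, degLE_mono ℒ ?_ hd₁⟩, hb₀0⟩
      linarith [le_max_left (d₁ + s) (c + s + 1)]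
    exact Nat.one_le_cast.2 (Submodule.one_le_finrank_iff.2 hne)
  have hmul : ∀ t ≥ t₀, (Module.finrank k X : ℝ) * f t ≤ f (lam * t) := by
    intro t ht
    have ht' : c + s + 1 ≤ t := (le_max_right _ _).trans ht
    have h2 : lam * (t - s) + c = lam * t - s := by
      rw [hs]
      field_simp
      ring
    have h3 := hstep (t - s) (by nlinarith)
    rw [h2] at h3
    simp only [hf]
    exact_mod_cast h3
  obtain ⟨r, hr, h⟩ := exists_rpow_le_of_mul_le (f := f)
    (fun d e h => Nat.cast_le.2 (Submodule.finrank_mono (hmonoK (by linarith))))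
    (by exact_mod_cast (by omega : 0 < Module.finrank k X))
    (by exact_mod_cast (by omega : 1 ≤ Module.finrank k X)) hlam ht0 hbase hmul
  refine ⟨r, hr, t₀, ht0, fun d hd => (h d hd).trans (Nat.cast_le.2 ?_)⟩
  exact Submodule.finrank_mono (inf_le_right.trans (degLE_mono ℒ (by linarith)))

end Branch

/-! ### Counting multisets of weights -/

section Counting

theorem exp_neg_le_rpow_neg {a t : ℝ} (ha : 0 < a) (ht : 0 < t) :
    Real.exp (-t) ≤ a ^ a * t ^ (-a) := by
  have h1 : t / a ≤ Real.exp (t / a) := by linarith [Real.add_one_le_exp (t / a)]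
  have h2 : (t / a) ^ a ≤ Real.exp t := by
    calc (t / a) ^ a ≤ Real.exp (t / a) ^ a := Real.rpow_le_rpow (by positivity) h1 ha.le
      _ = Real.exp t := by
        rw [← Real.exp_mul]
        congr 1
        field_simp
  rw [Real.div_rpow ht.le ha.le, div_le_iff₀ (by positivity)] at h2
  rw [Real.exp_neg, Real.rpow_neg ht.le, ← div_eq_mul_inv, inv_le_iff_one_le_mul₀ (Real.exp_pos t),
    div_mul_eq_mul_div, one_le_div (by positivity)]
  linarith

/-- Expand the logarithm as `∑ exp (-n y) / n` and bound each exponential by a multiple of `(n y) ^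
(-a)`; the series `∑ n ^ (-1 - a)` converges. -/
theorem exists_neg_log_one_sub_exp_le {a : ℝ} (ha : 0 < a) :
    ∃ A > 0, ∀ y > 0, -Real.log (1 - Real.exp (-y)) ≤ A * y ^ (-a) := by
  have hsum : Summable fun n : ℕ => ((n + 1 : ℕ) : ℝ) ^ (-(1 + a)) :=
    (summable_nat_add_iff 1 (f := fun n : ℕ => (n : ℝ) ^ (-(1 + a)))).2
      (Real.summable_nat_rpow.2 (by linarith))
  refine ⟨a ^ a * (∑' n : ℕ, ((n + 1 : ℕ) : ℝ) ^ (-(1 + a)) + 1), ?_, fun y hy => ?_⟩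
  · have : 0 ≤ ∑' n : ℕ, ((n + 1 : ℕ) : ℝ) ^ (-(1 + a)) := tsum_nonneg fun n => by positivity
    positivity
  · have hx : |Real.exp (-y)| < 1 := by
      rw [abs_of_pos (Real.exp_pos _), Real.exp_lt_one_iff]
      linarith
    have h1 := Real.hasSum_pow_div_log_of_abs_lt_one hx
    have h2 := (hsum.hasSum.mul_left (a ^ a * y ^ (-a)))
    have h3 := hasSum_le (fun n => ?_) h1 h2
    · refine h3.trans ?_
      have : 0 ≤ a ^ a * y ^ (-a) := by positivity
      nlinarith
    · have hn : (0 : ℝ) < ((n + 1 : ℕ) : ℝ) := by positivity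
      rw [← Real.exp_nat_mul]
      have h4 := exp_neg_le_rpow_neg ha (mul_pos hn hy)
      rw [Real.mul_rpow hn.le hy.le] at h4
      rw [neg_add, Real.rpow_add hn, Real.rpow_neg_one, div_le_iff₀ (by exact_mod_cast hn),
        mul_neg]
      refine h4.trans (le_of_eq ?_)
      push_cast
      field_simp

/-- The hypothesis says that the `r`-th smallest value of `v` is at least `r`, counting from one.
The induction removes a largest value. -/
theorem sum_le_sum_range_of_card_le {ι : Type*} [DecidableEq ι] {φ : ℝ → ℝ}
    (hφ : AntitoneOn φ (Set.Ioi 0)) (v : ι → ℝ) (J : Finset ι)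
    (hJ : ∀ i ∈ J, ((J.filter fun j => v j ≤ v i).card : ℝ) ≤ v i) :
    ∑ i ∈ J, φ (v i) ≤ ∑ r ∈ Finset.range J.card, φ (r + 1) := by
  obtain ⟨M, hM⟩ : ∃ M, J.card = M := ⟨_, rfl⟩
  induction M generalizing J with
  | zero => simp [Finset.card_eq_zero.1 hM]
  | succ M ih =>
    have hne : J.Nonempty := Finset.card_pos.1 (by omega)
    obtain ⟨i, hi, hmax⟩ := J.exists_max_image v hne
    have hcard : (J.erase i).card = M := by rw [Finset.card_erase_of_mem hi, hM]; rfl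
    have h1 := ih (J.erase i) (fun j hj => ?_) hcard
    · rw [← Finset.add_sum_erase J _ hi, hM, Finset.sum_range_succ, add_comm]
      rw [hcard] at h1
      refine add_le_add h1 (hφ (Set.mem_Ioi.2 (by positivity)) ?_ ?_)
      all_goals
        have h2 := hJ i hi
        rw [Finset.filter_true_of_mem hmax, hM] at h2
        push_cast at h2
      · exact lt_of_lt_of_le (by positivity) h2
      · exact h2
    · refine le_trans ?_ (hJ j (Finset.mem_of_mem_erase hj))
      exact_mod_cast Finset.card_le_card (Finset.filter_subset_filter _ (Finset.erase_subset _ _))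

theorem sum_range_sqrt_inv_le (n : ℕ) :
    ∑ r ∈ Finset.range n, (Real.sqrt (r + 1))⁻¹ ≤ 2 * Real.sqrt n := by
  induction n with
  | zero => simp
  | succ n ih =>
    rw [Finset.sum_range_succ]
    push_cast
    have h1 : Real.sqrt n ≤ Real.sqrt (n + 1) := Real.sqrt_le_sqrt (by linarith)
    have h2 : 0 < Real.sqrt ((n : ℝ) + 1) := Real.sqrt_pos.2 (by positivity)
    have h3 : Real.sqrt ((n : ℝ) + 1) ^ 2 = n + 1 := Real.sq_sqrt (by positivity)
    have h4 : Real.sqrt (n : ℝ) ^ 2 = n := Real.sq_sqrt (by positivity)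
    have h5 : (Real.sqrt ((n : ℝ) + 1))⁻¹ ≤ 2 * (Real.sqrt (n + 1) - Real.sqrt n) := by
      rw [inv_le_iff_one_le_mul₀ h2]
      nlinarith [Real.sqrt_nonneg (n : ℝ)]
    linarith

/-- Split near `r = R`: the square-root bound contributes at most `4 * A * R` before, the
inverse-square bound at most `A * R` after. -/
theorem sum_range_min_le {A R : ℝ} (hA : 0 ≤ A) (hR : 1 ≤ R) (M : ℕ) :
    ∑ r ∈ Finset.range M, min (A * Real.sqrt (R / ((r : ℝ) + 1))) (A * (R / ((r : ℝ) + 1)) ^ 2) ≤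
      5 * A * R := by
  have hR0 : 0 < R := by linarith
  set κ := ⌈R⌉₊ with hκ
  have hκ1 : R ≤ κ := Nat.le_ceil R
  have hκ2 : (κ : ℝ) ≤ 2 * R := by linarith [Nat.ceil_lt_add_one hR0.le]
  have hκ0 : κ ≠ 0 := by
    intro h
    rw [h] at hκ1
    norm_num at hκ1
    linarith
  have hpos : ∀ r : ℕ,
      0 ≤ min (A * Real.sqrt (R / ((r : ℝ) + 1))) (A * (R / ((r : ℝ) + 1)) ^ 2) :=
    fun r => le_min (by positivity) (by positivity)
  calc _ ≤ ∑ r ∈ Finset.range (κ + M),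
        min (A * Real.sqrt (R / ((r : ℝ) + 1))) (A * (R / ((r : ℝ) + 1)) ^ 2) :=
        Finset.sum_le_sum_of_subset_of_nonneg
          (Finset.range_subset_range.2 (Nat.le_add_left _ _)) fun r _ _ => hpos r
    _ ≤ A * Real.sqrt R * ∑ r ∈ Finset.range κ, (Real.sqrt (r + 1))⁻¹ +
        A * R ^ 2 * ∑ r ∈ Finset.Ioc κ (κ + M), ((r : ℝ) ^ 2)⁻¹ := by
      rw [Finset.sum_range_add, Finset.mul_sum, Finset.mul_sum]
      refine add_le_add (Finset.sum_le_sum fun r _ => (min_le_left _ _).trans (le_of_eq ?_)) ?_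
      · rw [Real.sqrt_div hR0.le, div_eq_mul_inv, mul_assoc]
      · have : Finset.Ioc κ (κ + M) = (Finset.range M).map
            (addLeftEmbedding (κ + 1)) := by
          ext x
          simp only [Finset.mem_Ioc, Finset.mem_map, Finset.mem_range, addLeftEmbedding_apply]
          constructor
          · intro h
            exact ⟨x - κ - 1, by omega, by omega⟩
          · rintro ⟨y, hy, rfl⟩
            omega
        rw [this, Finset.sum_map]
        refine Finset.sum_le_sum fun r _ => (min_le_right _ _).trans (le_of_eq ?_)
        rw [addLeftEmbedding_apply]
        push_cast
        rw [show (κ : ℝ) + 1 + r = κ + r + 1 by ring, div_pow, div_eq_mul_inv, mul_assoc]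
    _ ≤ A * Real.sqrt R * (2 * Real.sqrt κ) + A * R ^ 2 * (κ : ℝ)⁻¹ := by
      gcongr
      · exact sum_range_sqrt_inv_le κ
      · refine (sum_Ioc_inv_sq_le_sub hκ0 (Nat.le_add_right _ _)).trans ?_
        have : (0 : ℝ) ≤ ((κ + M : ℕ) : ℝ)⁻¹ := by positivity
        linarith
    _ ≤ A * Real.sqrt R * (2 * (2 * Real.sqrt R)) + A * R ^ 2 * R⁻¹ := by
      gcongr
      rw [show (2 : ℝ) * Real.sqrt R = Real.sqrt (4 * R) by
        rw [Real.sqrt_mul (by norm_num), show (4 : ℝ) = 2 ^ 2 by norm_num,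
          Real.sqrt_sq (by norm_num)]]
      exact Real.sqrt_le_sqrt (by linarith)
    _ = 5 * A * R := by
      have : Real.sqrt R * Real.sqrt R = R := Real.mul_self_sqrt hR0.le
      have h2 : R ^ 2 * R⁻¹ = R := by field_simp
      linear_combination 4 * A * this + A * h2

/-- With `R = C * s ^ (-η)` and `v = C * deg ^ η` one has `R / v = (s * deg) ^ (-η)`. Bounding the
logarithm with exponent `η / 2` handles small degrees, where `v` is below `R`, and exponent `2 * η`
handles large ones; the counting hypothesis reduces the sum to integer values of `v`. -/
theorem exists_sum_neg_log_le {η : ℝ} (hη : 0 < η) :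
    ∃ A > 0, ∀ {ι : Type*} [DecidableEq ι] (deg : ι → ℝ) (J : Finset ι) (C s : ℝ),
      0 < C → 0 < s → 1 ≤ C * s ^ (-η) → (∀ i ∈ J, 0 < deg i) →
      (∀ i ∈ J, ((J.filter fun j => deg j ≤ deg i).card : ℝ) ≤ C * deg i ^ η) →
      ∑ i ∈ J, -Real.log (1 - Real.exp (-(s * deg i))) ≤ A * (C * s ^ (-η)) := by
  obtain ⟨A₁, hA₁, h₁⟩ := exists_neg_log_one_sub_exp_le (a := η / 2) (by positivity)
  obtain ⟨A₂, hA₂, h₂⟩ := exists_neg_log_one_sub_exp_le (a := η * 2) (by positivity)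
  set A := max A₁ A₂ with hA
  have hA0 : 0 < A := lt_max_of_lt_left hA₁
  refine ⟨5 * A, by positivity, fun deg J C s hC hs hR hpos hcard => ?_⟩
  set R := C * s ^ (-η) with hRdef
  have hR0 : 0 < R := by linarith
  set φ : ℝ → ℝ := fun v => min (A * Real.sqrt (R / v)) (A * (R / v) ^ 2) with hφ
  have hanti : AntitoneOn φ (Set.Ioi 0) := by
    intro x hx y hy hxy
    have hx : 0 < x := hx
    have hy : 0 < y := hy
    have h : R / y ≤ R / x := by gcongr
    exact min_le_min (by gcongr) (by gcongr)
  calc _ ≤ ∑ i ∈ J, φ (C * deg i ^ η) := by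
        refine Finset.sum_le_sum fun i hi => ?_
        have hd := hpos i hi
        have hy : 0 < s * deg i := mul_pos hs hd
        have hu : R / (C * deg i ^ η) = (s * deg i) ^ (-η) := by
          rw [hRdef, Real.mul_rpow hs.le hd.le, Real.rpow_neg hd.le]
          field_simp
        refine le_min ((h₁ _ hy).trans ?_) ((h₂ _ hy).trans ?_)
        · rw [hu, Real.sqrt_eq_rpow, ← Real.rpow_mul hy.le]
          rw [show -η * (1 / 2) = -(η / 2) by ring]
          gcongr
          exact le_max_left _ _
        · rw [hu, ← Real.rpow_mul_natCast hy.le]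
          rw [show -η * ((2 : ℕ) : ℝ) = -(η * 2) by push_cast; ring]
          gcongr
          exact le_max_right _ _
    _ ≤ ∑ r ∈ Finset.range J.card, φ (r + 1) := by
        refine sum_le_sum_range_of_card_le hanti _ J fun i hi => ?_
        refine le_trans (Nat.cast_le.2 (Finset.card_le_card fun j hj => ?_)) (hcard i hi)
        rw [Finset.mem_filter] at hj ⊢
        refine ⟨hj.1, ?_⟩
        exact (Real.rpow_le_rpow_iff (hpos j hj.1).le (hpos i hi).le hη).1
          (le_of_mul_le_mul_left hj.2 hC)
    _ ≤ 5 * A * R := sum_range_min_le hA0.le hR _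

/-- Rankin's trick: give each multiset the weight `exp (s * (d - degree)) ≥ 1`, drop the degree
restriction, and factor the sum into geometric series. -/
theorem multiset_card_le {ι : Type*} [DecidableEq ι] {deg : ι → ℝ} {δ : ℝ} (hδ : 0 < δ)
    (hdeg : ∀ i, δ ≤ deg i) {d : ℝ} (J : Finset ι) (hJ : ∀ i, deg i ≤ d → i ∈ J) {s : ℝ}
    (hs : 0 < s) :
    {m : Multiset ι | (m.map deg).sum ≤ d}.Finite ∧
      ({m : Multiset ι | (m.map deg).sum ≤ d}.ncard : ℝ) ≤
        Real.exp (s * d + ∑ i ∈ J, -Real.log (1 - Real.exp (-(s * deg i)))) := by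
  have hpos : ∀ i, 0 < deg i := fun i => hδ.trans_le (hdeg i)
  set F := {m : Multiset ι | (m.map deg).sum ≤ d} with hF
  -- No multiplicity exceeds `N`, since each occurrence costs at least `δ`.
  set N := ⌊d / δ⌋₊ with hN
  set P : Finset (J → ℕ) := Fintype.piFinset fun _ : J => Finset.range (N + 1) with hP
  set G : Finset (J → ℕ) := P.filter fun n => ∑ i, n i * deg i ≤ d with hG
  let Φ : Multiset ι → J → ℕ := fun m i => m.count i.1
  have hmem : ∀ m ∈ F, ∀ i ∈ m, i ∈ J := by
    intro m hm i hi
    refine hJ i (le_trans ?_ hm)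
    refine Multiset.single_le_sum (fun x hx => ?_) _ (Multiset.mem_map_of_mem deg hi)
    obtain ⟨j, -, rfl⟩ := Multiset.mem_map.1 hx
    exact (hpos j).le
  have hsum : ∀ m ∈ F, ∑ i, (Φ m i) * deg i = (m.map deg).sum := by
    intro m hm
    rw [Finset.sum_multiset_map_count, Finset.sum_coe_sort J fun i => (m.count i : ℝ) * deg i]
    refine (Finset.sum_subset (fun i hi => hmem m hm i (Multiset.mem_toFinset.1 hi))
      fun i _ hi => ?_).symm.trans (Finset.sum_congr rfl fun i _ => (nsmul_eq_mul _ _).symm)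
    rw [Multiset.count_eq_zero_of_notMem fun h => hi (Multiset.mem_toFinset.2 h)]
    simp
  have hmaps : ∀ m ∈ F, Φ m ∈ (G : Set (J → ℕ)) := by
    intro m hm
    have h1 : ∑ i, (Φ m i) * deg i ≤ d := (hsum m hm).le.trans hm
    refine Finset.mem_coe.2 (Finset.mem_filter.2 ⟨Fintype.mem_piFinset.2 fun i => ?_, h1⟩)
    rw [Finset.mem_range, Nat.lt_succ_iff]
    refine Nat.le_floor ((le_div_iff₀ hδ).2 ?_)
    calc (Φ m i : ℝ) * δ ≤ Φ m i * deg i := by gcongr; exact hdeg i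
      _ ≤ ∑ i, (Φ m i) * deg i := Finset.single_le_sum
        (f := fun i : J => (Φ m i : ℝ) * deg i)
        (fun j _ => mul_nonneg (Nat.cast_nonneg _) (hpos j).le) (Finset.mem_univ i)
      _ ≤ d := h1
  have hinj : Set.InjOn Φ F := by
    intro m hm m' hm' h
    refine Multiset.ext.2 fun i => ?_
    by_cases hi : i ∈ J
    · exact congrFun h ⟨i, hi⟩
    · rw [Multiset.count_eq_zero_of_notMem fun h => hi (hmem m hm i h),
        Multiset.count_eq_zero_of_notMem fun h => hi (hmem m' hm' i h)]
  refine ⟨Set.Finite.of_injOn hmaps hinj G.finite_toSet, ?_⟩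
  have hq : ∀ i, 0 ≤ Real.exp (-(s * deg i)) ∧ Real.exp (-(s * deg i)) < 1 := fun i =>
    ⟨(Real.exp_pos _).le, Real.exp_lt_one_iff.2 (neg_lt_zero.2 (mul_pos hs (hpos i)))⟩
  calc (F.ncard : ℝ) ≤ G.card := by
        rw [← Set.ncard_coe_finset]
        exact_mod_cast Set.ncard_le_ncard_of_injOn Φ hmaps hinj G.finite_toSet
    _ = ∑ n ∈ G, 1 := by simp
    _ ≤ ∑ n ∈ G, Real.exp (s * d) * ∏ i : J, Real.exp (-(s * deg i)) ^ n i := by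
        refine Finset.sum_le_sum fun n hn => ?_
        have h1 := (Finset.mem_filter.1 hn).2
        simp_rw [← Real.exp_nat_mul]
        rw [← Real.exp_sum, ← Real.exp_add, Real.one_le_exp_iff]
        have : ∑ i, (n i : ℝ) * -(s * deg i) = -(s * ∑ i, n i * deg i) := by
          rw [Finset.mul_sum, ← Finset.sum_neg_distrib]
          exact Finset.sum_congr rfl fun i _ => by ring
        rw [this]
        nlinarith
    _ ≤ ∑ n ∈ P, Real.exp (s * d) * ∏ i : J, Real.exp (-(s * deg i)) ^ n i :=
        Finset.sum_le_sum_of_subset_of_nonneg (Finset.filter_subset _ _) fun n _ _ => by positivity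
    _ = Real.exp (s * d) * ∏ i : J, ∑ n ∈ Finset.range (N + 1), Real.exp (-(s * deg i)) ^ n := by
        rw [← Finset.mul_sum, Finset.prod_univ_sum]
    _ ≤ Real.exp (s * d) * ∏ i : J, (1 - Real.exp (-(s * deg i)))⁻¹ := by
        refine mul_le_mul_of_nonneg_left (Finset.prod_le_prod (fun i _ => ?_) fun i _ => ?_)
          (Real.exp_pos _).le
        · exact Finset.sum_nonneg fun n _ => pow_nonneg (hq i).1 n
        · rw [← tsum_geometric_of_lt_one (hq i).1 (hq i).2]
          exact (summable_geometric_of_lt_one (hq i).1 (hq i).2).sum_le_tsum _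
            fun n _ => pow_nonneg (hq i).1 n
    _ = _ := by
        rw [Finset.prod_coe_sort J fun i => (1 - Real.exp (-(s * deg i)))⁻¹, Real.exp_add,
          Real.exp_sum]
        congr 1
        refine Finset.prod_congr rfl fun i _ => ?_
        rw [Real.exp_neg (Real.log _), Real.exp_log (by linarith [(hq i).2])]

end Counting

/-! ### Ordered monomials span the enveloping algebra -/

section Spanning

variable {k L : Type*} [Field k] [LieRing L] [LieAlgebra k L] {p : ℕ} {pw : L → L}

variable (k p pw) in
/-- The canonical map `L → U(L)` as a linear map. -/
def envLinear : L →ₗ[k] Env k p pw where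
  toFun := envι k p pw
  map_add' a b := by simp [envι]
  map_smul' c a := by simp [envι]

theorem envLinear_apply (a : L) : envLinear k p pw a = envι k p pw a := rfl

theorem envLinear_lie (a b : L) : envLinear k p pw ⁅a, b⁆ =
    envLinear k p pw a * envLinear k p pw b - envLinear k p pw b * envLinear k p pw a := by
  simp only [envLinear_apply, envι, LieHom.map_lie]
  rw [← map_mul (RingQuot.mkAlgHom k (PowRel k p pw)),
    ← map_mul (RingQuot.mkAlgHom k (PowRel k p pw)), ← map_sub]
  rfl

variable {ℒ : ℝ → Submodule k L}

/-- The product in `U(L)` of a word in homogeneous basis elements of `L`. -/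
def envWord (p : ℕ) (pw : L → L) (hint : DirectSum.IsInternal ℒ)
    (l : List (Σ d : ℝ, Module.Basis.ofVectorSpaceIndex k (ℒ d))) : Env k p pw :=
  (l.map fun i => envLinear k p pw (gradedBasis hint i)).prod

variable (hint : DirectSum.IsInternal ℒ)

theorem envWord_cons (i : Σ d : ℝ, Module.Basis.ofVectorSpaceIndex k (ℒ d))
    (l : List (Σ d : ℝ, Module.Basis.ofVectorSpaceIndex k (ℒ d))) :
    envWord p pw hint (i :: l) =
      envLinear k p pw (gradedBasis hint i) * envWord p pw hint l := by
  simp [envWord]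

/-- The span of the words of length less than `n` and degree `e`. -/
def shortWords (p : ℕ) (pw : L → L) (hint : DirectSum.IsInternal ℒ) (n : ℕ) (e : ℝ) :
    Submodule k (Env k p pw) :=
  Submodule.span k {u | ∃ l, l.length < n ∧ (l.map Sigma.fst).sum = e ∧ envWord p pw hint l = u}

theorem mem_span_gradedBasis {d : ℝ} {a : L} (ha : a ∈ ℒ d) :
    a ∈ Submodule.span k (gradedBasis hint '' {i | i.1 = d}) := by
  rw [Module.Basis.mem_span_image]
  intro i hi
  by_contra h
  exact (Finsupp.mem_support_iff.1 hi) (gradedBasis_repr_of_ne hint ha h)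

theorem mul_mem_shortWords {d e : ℝ} {a : L} (ha : a ∈ ℒ d) {n : ℕ} {u : Env k p pw}
    (hu : u ∈ shortWords p pw hint n e) :
    envLinear k p pw a * u ∈ shortWords p pw hint (n + 1) (d + e) := by
  replace ha := mem_span_gradedBasis hint ha
  induction hu using Submodule.span_induction with
  | zero => rw [mul_zero]; exact zero_mem _
  | add x y _ _ hx hy => rw [mul_add]; exact add_mem hx hy
  | smul c x _ hx => rw [mul_smul_comm]; exact Submodule.smul_mem _ c hx
  | mem u hu =>
    obtain ⟨l, hl1, hl2, rfl⟩ := hu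
    induction ha using Submodule.span_induction with
    | zero => rw [map_zero, zero_mul]; exact zero_mem _
    | add x y _ _ hx hy => rw [map_add, add_mul]; exact add_mem hx hy
    | smul c x _ hx => rw [map_smul, smul_mul_assoc]; exact Submodule.smul_mem _ c hx
    | mem x hx =>
      obtain ⟨i, hi, rfl⟩ := hx
      refine Submodule.subset_span ⟨i :: l, by simpa using hl1, ?_, envWord_cons hint i l⟩
      rw [List.map_cons, List.sum_cons, hl2]
      exact congrArg (· + e) hi

theorem envWord_mem_shortWords (l : List (Σ d : ℝ, Module.Basis.ofVectorSpaceIndex k (ℒ d)))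
    {n : ℕ} (hn : l.length < n) :
    envWord p pw hint l ∈ shortWords p pw hint n (l.map Sigma.fst).sum :=
  Submodule.subset_span ⟨l, hn, rfl, rfl⟩

/-- Exchanging two adjacent letters costs a word with their bracket in place of both: shorter by one
letter, and of the same degree. -/
theorem envWord_sub_mem_of_perm
    (hlie : ∀ {i j : ℝ} {a b : L}, a ∈ ℒ i → b ∈ ℒ j → ⁅a, b⁆ ∈ ℒ (i + j))
    {l l' : List (Σ d : ℝ, Module.Basis.ofVectorSpaceIndex k (ℒ d))} (h : l.Perm l') :
    envWord p pw hint l - envWord p pw hint l' ∈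
      shortWords p pw hint l.length (l.map Sigma.fst).sum := by
  induction h with
  | nil => rw [sub_self]; exact zero_mem _
  | cons i _ ih =>
    rw [envWord_cons, envWord_cons, ← mul_sub, List.map_cons, List.sum_cons, List.length_cons]
    exact mul_mem_shortWords hint (gradedBasis_mem hint i) ih
  | swap i j l =>
    simp only [envWord_cons, ← mul_assoc]
    rw [← sub_mul, ← envLinear_lie]
    simp only [List.map_cons, List.sum_cons, ← add_assoc]
    exact mul_mem_shortWords hint (hlie (gradedBasis_mem hint j) (gradedBasis_mem hint i))
      (envWord_mem_shortWords hint l (Nat.lt_succ_self _))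
  | trans h₁ _ ih₁ ih₂ =>
    rw [← h₁.length_eq, ← (h₁.map Sigma.fst).sum_eq] at ih₂
    rw [← sub_add_sub_cancel]
    exact add_mem ih₁ ih₂

/-- The elementary half of the Poincaré–Birkhoff–Witt theorem, by induction on the length. Any fixed
arrangement of each multiset will do, here `Multiset.toList`, so the basis needs no order. -/
theorem envWord_mem_span_multiset
    (hlie : ∀ {i j : ℝ} {a b : L}, a ∈ ℒ i → b ∈ ℒ j → ⁅a, b⁆ ∈ ℒ (i + j)) (e : ℝ) (n : ℕ) :
    shortWords p pw hint n e ≤ Submodule.span k ((fun m => envWord p pw hint m.toList) ''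
      {m : Multiset (Σ d : ℝ, Module.Basis.ofVectorSpaceIndex k (ℒ d)) |
        (m.map Sigma.fst).sum = e}) := by
  induction n with
  | zero =>
    refine Submodule.span_le.2 ?_
    rintro _ ⟨l, hl, -⟩
    exact absurd hl (Nat.not_lt_zero _)
  | succ n ih =>
    refine Submodule.span_le.2 ?_
    rintro _ ⟨l, hl, rfl, rfl⟩
    have hperm : l.Perm (l : Multiset _).toList :=
      Multiset.coe_eq_coe.1 (Multiset.coe_toList _).symm
    rw [← sub_add_cancel (envWord p pw hint l) (envWord p pw hint (l : Multiset _).toList)]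
    refine add_mem (ih ?_) (Submodule.subset_span ⟨(l : Multiset _), by simp, rfl⟩)
    refine Submodule.span_mono ?_ (envWord_sub_mem_of_perm hint hlie hperm)
    rintro _ ⟨l', h1, h2, rfl⟩
    exact ⟨l', by omega, h2, rfl⟩

theorem envDeg_le_span_multiset
    (hlie : ∀ {i j : ℝ} {a b : L}, a ∈ ℒ i → b ∈ ℒ j → ⁅a, b⁆ ∈ ℒ (i + j)) (e : ℝ) :
    envDeg p pw ℒ e ≤ Submodule.span k ((fun m => envWord p pw hint m.toList) ''
      {m : Multiset (Σ d : ℝ, Module.Basis.ofVectorSpaceIndex k (ℒ d)) |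
        (m.map Sigma.fst).sum = e}) := by
  refine Submodule.span_le.2 ?_
  rintro _ ⟨l, hl, rfl, rfl⟩
  refine envWord_mem_span_multiset hint hlie _ (l.length + 1) ?_
  induction l with
  | nil => exact Submodule.subset_span ⟨[], by simp [envWord]⟩
  | cons t l ih =>
    simp only [List.map_cons, List.prod_cons, List.sum_cons, List.length_cons]
    rw [← envLinear_apply]
    exact mul_mem_shortWords hint (hl t List.mem_cons_self)
      (ih fun s hs => hl s (List.mem_cons_of_mem _ hs))

theorem envDegLE_le_span_multiset
    (hlie : ∀ {i j : ℝ} {a b : L}, a ∈ ℒ i → b ∈ ℒ j → ⁅a, b⁆ ∈ ℒ (i + j)) (d : ℝ) :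
    envDegLE p pw ℒ d ≤ Submodule.span k ((fun m => envWord p pw hint m.toList) ''
      {m : Multiset (Σ d : ℝ, Module.Basis.ofVectorSpaceIndex k (ℒ d)) |
        (m.map Sigma.fst).sum ≤ d}) := by
  refine iSup₂_le fun e he => (envDeg_le_span_multiset hint hlie e).trans
    (Submodule.span_mono (Set.image_mono fun m hm => ?_))
  exact le_of_eq_of_le hm he

end Spanning

/-! ### Upper bound for the growth of `U(L)` -/

section EnvGrowth

variable {k L : Type*} [Field k] [LieRing L] [LieAlgebra k L] {p : ℕ} {pw : L → L}
  {ℒ : ℝ → Submodule k L}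

theorem card_le_finrank_degLE (hint : DirectSum.IsInternal ℒ)
    (hfin : ∀ d, FiniteDimensional k (degLE ℒ d)) {d : ℝ}
    (J : Finset (Σ d : ℝ, Module.Basis.ofVectorSpaceIndex k (ℒ d))) (hJ : ∀ i ∈ J, i.1 ≤ d) :
    J.card ≤ Module.finrank k (degLE ℒ d) := by
  let v : J → degLE ℒ d := fun i => ⟨gradedBasis hint i, le_degLE ℒ (hJ i i.2)
    (gradedBasis_mem hint i)⟩
  have hv : LinearIndependent k v := by
    refine LinearIndependent.of_comp (degLE ℒ d).subtype ?_
    exact (gradedBasis hint).linearIndependent.comp (fun i : J => i.1) Subtype.val_injective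
  simpa using hv.fintype_card_le_finrank

theorem exists_finset_degree_le (hint : DirectSum.IsInternal ℒ)
    (hfin : ∀ d, FiniteDimensional k (degLE ℒ d)) (d : ℝ) :
    ∃ J : Finset (Σ d : ℝ, Module.Basis.ofVectorSpaceIndex k (ℒ d)), ∀ i, i ∈ J ↔ i.1 ≤ d := by
  classical
  have h : {i : Σ d : ℝ, Module.Basis.ofVectorSpaceIndex k (ℒ d) | i.1 ≤ d}.Finite := by
    by_contra h
    obtain ⟨J, hJ, hcard⟩ := Set.Infinite.exists_subset_card_eq h
      (Module.finrank k (degLE ℒ d) + 1)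
    have := card_le_finrank_degLE hint hfin J fun i hi => hJ hi
    omega
  exact ⟨h.toFinset, fun i => by simp⟩

theorem le_degree_gradedBasis (hint : DirectSum.IsInternal ℒ) {δ : ℝ} (hδ : ∀ d < δ, ℒ d = ⊥)
    (i : Σ d : ℝ, Module.Basis.ofVectorSpaceIndex k (ℒ d)) : δ ≤ i.1 := by
  by_contra h
  have h1 := gradedBasis_mem hint i
  rw [hδ _ (not_le.1 h), Submodule.mem_bot] at h1
  exact (gradedBasis hint).ne_zero i h1

theorem finrank_envDegLE_le (hint : DirectSum.IsInternal ℒ)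
    (hlie : ∀ {i j : ℝ} {a b : L}, a ∈ ℒ i → b ∈ ℒ j → ⁅a, b⁆ ∈ ℒ (i + j)) {δ : ℝ} (hδ0 : 0 < δ)
    (hδ : ∀ d < δ, ℒ d = ⊥) {d : ℝ}
    {J : Finset (Σ d : ℝ, Module.Basis.ofVectorSpaceIndex k (ℒ d))} (hJ : ∀ i, i ∈ J ↔ i.1 ≤ d)
    {s : ℝ} (hs : 0 < s) :
    FiniteDimensional k (envDegLE p pw ℒ d) ∧
      (Module.finrank k (envDegLE p pw ℒ d) : ℝ) ≤
        Real.exp (s * d + ∑ i ∈ J, -Real.log (1 - Real.exp (-(s * i.1)))) := by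
  classical
  obtain ⟨h1, h2⟩ := multiset_card_le hδ0 (le_degree_gradedBasis hint hδ) J
    (fun i hi => (hJ i).2 hi) hs
  have hle := envDegLE_le_span_multiset (p := p) (pw := pw) hint hlie d
  set F := (fun m => envWord p pw hint m.toList) ''
    {m : Multiset (Σ d : ℝ, Module.Basis.ofVectorSpaceIndex k (ℒ d)) |
      (m.map Sigma.fst).sum ≤ d} with hF
  have hFfin : F.Finite := h1.image _
  have := FiniteDimensional.span_of_finite k hFfin
  refine ⟨Submodule.finiteDimensional_of_le hle, le_trans (Nat.cast_le.2 ?_) h2⟩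
  refine (Submodule.finrank_mono hle).trans ((?_ : _ ≤ F.ncard).trans (Set.ncard_image_le h1))
  have hF' : F = (hFfin.toFinset : Set (Env k p pw)) := by simp
  rw [hF', Set.ncard_coe_finset]
  exact finrank_span_finset_le_card _

theorem envDegLE_finiteDimensional (hint : DirectSum.IsInternal ℒ)
    (hlie : ∀ {i j : ℝ} {a b : L}, a ∈ ℒ i → b ∈ ℒ j → ⁅a, b⁆ ∈ ℒ (i + j)) {δ : ℝ} (hδ0 : 0 < δ)
    (hδ : ∀ d < δ, ℒ d = ⊥) (hfin : ∀ d, FiniteDimensional k (degLE ℒ d)) (d : ℝ) :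
    FiniteDimensional k (envDegLE p pw ℒ d) := by
  classical
  obtain ⟨J, hJ⟩ := exists_finset_degree_le hint hfin d
  exact (finrank_envDegLE_le hint hlie hδ0 hδ hJ one_pos).1

theorem envDegLE_growthLE (hint : DirectSum.IsInternal ℒ)
    (hlie : ∀ {i j : ℝ} {a b : L}, a ∈ ℒ i → b ∈ ℒ j → ⁅a, b⁆ ∈ ℒ (i + j)) {δ : ℝ} (hδ0 : 0 < δ)
    (hδ : ∀ d < δ, ℒ d = ⊥) (hfin : ∀ d, FiniteDimensional k (degLE ℒ d)) {η C : ℝ} (hη : 0 < η)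
    (hC : 0 < C) (hgrowth : ∀ d ≥ 1, (Module.finrank k (degLE ℒ d) : ℝ) ≤ C * d ^ η) :
    GrowthLE (fun d => (Module.finrank k (envDegLE p pw ℒ d) : ℝ))
      (fun d => Real.exp (d ^ (η / (η + 1)))) := by
  classical
  obtain ⟨A, hA, hsum⟩ := exists_sum_neg_log_le hη
  -- Basis elements may have degree below `1`, so the growth bound is extended to all degrees `≥ δ`;
  -- `1 ≤ B` ensures `1 ≤ B * s ^ (-η)` below.
  set B := max (max C (C * δ ^ (-η))) 1 with hB
  have hB1 : 1 ≤ B := le_max_right _ _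
  have hgrowth' : ∀ t ≥ δ, (Module.finrank k (degLE ℒ t) : ℝ) ≤ B * t ^ η := by
    intro t ht
    have ht0 : 0 < t := hδ0.trans_le ht
    obtain h | h := le_total 1 t
    · refine (hgrowth t h).trans ?_
      gcongr
      exact (le_max_left _ _).trans (le_max_left _ _)
    · calc (Module.finrank k (degLE ℒ t) : ℝ) ≤ Module.finrank k (degLE ℒ 1) :=
            Nat.cast_le.2 (Submodule.finrank_mono (degLE_mono ℒ h))
        _ ≤ C := by simpa using hgrowth 1 le_rfl
        _ = C * δ ^ (-η) * δ ^ η := by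
          rw [mul_assoc, ← Real.rpow_add hδ0, neg_add_cancel, Real.rpow_zero, mul_one]
        _ ≤ B * t ^ η := by
          gcongr
          exact (le_max_right _ _).trans (le_max_left _ _)
  set α := η / (η + 1) with hα
  have hα0 : 0 < α := by positivity
  -- The exponent will be at most `E * d ^ α`, and rescaling `d` by `E ^ α⁻¹` absorbs the factor
  -- `E`.
  set E := 1 + A * B with hE
  have hE0 : 0 < E := by positivity
  have hE1 : 1 ≤ E ^ α⁻¹ := Real.one_le_rpow (by rw [hE]; nlinarith) (by positivity)
  refine ⟨E ^ α⁻¹, by positivity, fun d hd => ?_⟩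
  have hd0 : 0 < d := by linarith
  obtain ⟨J, hJ⟩ := exists_finset_degree_le hint hfin d
  -- This choice makes `s * d` and `s ^ (-η)` both equal to `d ^ α`.
  set s := d ^ (-(η + 1)⁻¹) with hs
  have hs0 : 0 < s := by positivity
  have hsη : s ^ (-η) = d ^ α := by
    rw [hs, ← Real.rpow_mul hd0.le, hα]
    congr 1
    field_simp
  have hsd : s * d = d ^ α := by
    have : d ^ (-(η + 1)⁻¹) * d ^ (1 : ℝ) = d ^ α := by
      rw [← Real.rpow_add hd0, hα]
      congr 1
      field_simp
      ring
    rwa [Real.rpow_one] at this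
  have hdα : 1 ≤ d ^ α := Real.one_le_rpow hd hα0.le
  have h1 := hsum (fun i : Σ d : ℝ, Module.Basis.ofVectorSpaceIndex k (ℒ d) => i.1) J B s
    (by linarith) hs0 (by rw [hsη]; nlinarith)
    (fun i _ => hδ0.trans_le (le_degree_gradedBasis hint hδ i)) fun i hi =>
      le_trans (Nat.cast_le.2 (card_le_finrank_degLE hint hfin _
        fun j hj => (Finset.mem_filter.1 hj).2))
        (hgrowth' i.1 (le_degree_gradedBasis hint hδ i))
  refine (finrank_envDegLE_le hint hlie hδ0 hδ hJ hs0).2.trans ?_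
  have h2 : (E ^ α⁻¹ * d) ^ α = E * d ^ α := by
    rw [Real.mul_rpow (by positivity) hd0.le, ← Real.rpow_mul hE0.le, inv_mul_cancel₀ hα0.ne',
      Real.rpow_one]
  beta_reduce
  rw [h2]
  refine le_trans (Real.exp_le_exp.2 ?_) (le_mul_of_one_le_left (Real.exp_pos _).le hE1)
  rw [hsη] at h1
  rw [hsd, hE]
  linarith

end EnvGrowth

/-! ### Linear independence of square-free monomials in the enveloping algebra -/

section Comultiplication

variable {k L A : Type*} [Field k] [LieRing L] [LieAlgebra k L] [Ring A] [Algebra k A] {p : ℕ}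
  {pw : L → L}

attribute [local instance] LieRing.ofAssociativeRing in
theorem exists_env_lift (ρ : L →ₗ[k] A) (hρ : ∀ a b, ρ ⁅a, b⁆ = ρ a * ρ b - ρ b * ρ a)
    (hpw : p ≠ 0 → ∀ a, ρ (pw a) = ρ a ^ p) :
    ∃ F : Env k p pw →ₐ[k] A, ∀ a, F (envLinear k p pw a) = ρ a := by
  let f : L →ₗ⁅k⁆ A := { ρ with map_lie' := fun {a b} => hρ a b }
  let F : UniversalEnvelopingAlgebra k L →ₐ[k] A := UniversalEnvelopingAlgebra.lift k f
  have hF : ∀ a, F (UniversalEnvelopingAlgebra.ι k a) = ρ a := fun a =>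
    UniversalEnvelopingAlgebra.lift_ι_apply' k f a
  refine ⟨RingQuot.liftAlgHom k ⟨F, ?_⟩, fun a => ?_⟩
  · rintro _ _ ⟨a, hp⟩
    rw [map_pow, hF, hF, hpw hp]
  · rw [envLinear_apply, envι, RingQuot.liftAlgHom_mkAlgHom_apply, hF]

theorem envLinear_pw (hp : p ≠ 0) (a : L) :
    envLinear k p pw (pw a) = envLinear k p pw a ^ p := by
  rw [envLinear_apply, envLinear_apply, envι, envι, ← map_pow]
  exact (RingQuot.mkAlgHom_rel k (PowRel.pow_eq a hp)).symm

/-- The usual coproduct with its left factor pushed into `A`. The two summands commute, so in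
characteristic `p` the `p`-th power of their sum is the sum of their `p`-th powers. -/
theorem exists_comul [CharP k p] (ρ : L →ₗ[k] A)
    (hρ : ∀ a b, ρ ⁅a, b⁆ = ρ a * ρ b - ρ b * ρ a) (hpw : p ≠ 0 → ∀ a, ρ (pw a) = ρ a ^ p) :
    ∃ Δ : Env k p pw →ₐ[k] A ⊗[k] Env k p pw,
      ∀ a, Δ (envLinear k p pw a) = ρ a ⊗ₜ 1 + 1 ⊗ₜ envLinear k p pw a := by
  refine exists_env_lift ((TensorProduct.mk k A (Env k p pw)).flip 1 ∘ₗ ρ +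
    TensorProduct.mk k A (Env k p pw) 1 ∘ₗ envLinear k p pw) (fun a b => ?_) fun hp a => ?_
  · simp only [LinearMap.add_apply, LinearMap.comp_apply, LinearMap.flip_apply,
      TensorProduct.mk_apply, hρ, envLinear_lie, add_mul, mul_add,
      Algebra.TensorProduct.tmul_mul_tmul, one_mul, mul_one, TensorProduct.sub_tmul,
      TensorProduct.tmul_sub]
    abel
  · have hpp : p.Prime := (CharP.char_is_prime_or_zero k p).resolve_right hp
    simp only [LinearMap.add_apply, LinearMap.comp_apply, LinearMap.flip_apply,
      TensorProduct.mk_apply, hpw hp, envLinear_pw hp]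
    have hcomm : Commute (ρ a ⊗ₜ[k] (1 : Env k p pw)) (1 ⊗ₜ[k] envLinear k p pw a) := by
      simp [Commute, SemiconjBy, Algebra.TensorProduct.tmul_mul_tmul]
    obtain ⟨r, hr⟩ := hcomm.exists_add_pow_prime_eq hpp
    have h0 : ((p : ℕ) : A ⊗[k] Env k p pw) = 0 := by
      rw [← map_natCast (algebraMap k (A ⊗[k] Env k p pw)), CharP.cast_eq_zero, map_zero]
    rw [hr, h0, zero_mul, zero_mul, zero_mul, add_zero, Algebra.TensorProduct.tmul_pow,
      Algebra.TensorProduct.tmul_pow, one_pow, one_pow]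

variable (k p pw) in
/-- The product in `U(L)` of a list of elements of `L`. -/
def envProd (l : List L) : Env k p pw := (l.map (envLinear k p pw)).prod

theorem envProd_cons (a : L) (l : List L) :
    envProd k p pw (a :: l) = envLinear k p pw a * envProd k p pw l := by
  simp [envProd]

variable (k p pw) in
/-- The span of the products of at most `n - 2` elements of `L`. -/
def lowProducts (n : ℕ) : Submodule k (Env k p pw) :=
  Submodule.span k {u | ∃ l : List L, l.length + 2 ≤ n ∧ envProd k p pw l = u}

theorem lowProducts_mono : Monotone (lowProducts k p pw) := fun _ _ h =>
  Submodule.span_mono fun _ ⟨l, hl, hu⟩ => ⟨l, hl.trans h, hu⟩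

theorem mul_mem_lowProducts (a : L) {n : ℕ} {u : Env k p pw} (hu : u ∈ lowProducts k p pw n) :
    envLinear k p pw a * u ∈ lowProducts k p pw (n + 1) := by
  induction hu using Submodule.span_induction with
  | zero => rw [mul_zero]; exact zero_mem _
  | add x y _ _ hx hy => rw [mul_add]; exact add_mem hx hy
  | smul c x _ hx => rw [mul_smul_comm]; exact Submodule.smul_mem _ c hx
  | mem u hu =>
    obtain ⟨l, hl, rfl⟩ := hu
    exact Submodule.subset_span ⟨a :: l, by rw [List.length_cons]; omega, envProd_cons a l⟩

variable (k p pw A) in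
/-- The subspace `A ⊗ lowProducts n`. -/
def lowTensors (n : ℕ) : Submodule k (A ⊗[k] Env k p pw) :=
  LinearMap.range ((lowProducts k p pw n).subtype.lTensor A)

theorem tmul_mem_lowTensors (x : A) {n : ℕ} {u : Env k p pw} (hu : u ∈ lowProducts k p pw n) :
    x ⊗ₜ u ∈ lowTensors k A p pw n :=
  ⟨x ⊗ₜ ⟨u, hu⟩, rfl⟩

theorem lowTensors_le {n : ℕ} {P : Submodule k (A ⊗[k] Env k p pw)}
    (h : ∀ (x : A), ∀ u ∈ lowProducts k p pw n, x ⊗ₜ u ∈ P) : lowTensors k A p pw n ≤ P := by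
  rintro _ ⟨z, rfl⟩
  induction z with
  | zero => rw [map_zero]; exact zero_mem _
  | add u v hu hv => rw [map_add]; exact add_mem hu hv
  | tmul x u => exact h x u u.2

theorem lowTensors_mono : Monotone (lowTensors k A p pw) := fun _ _ h =>
  lowTensors_le fun x _ hu => tmul_mem_lowTensors x (lowProducts_mono h hu)

theorem left_mul_mem_lowTensors (x : A) {n : ℕ} {z : A ⊗[k] Env k p pw}
    (hz : z ∈ lowTensors k A p pw n) : x ⊗ₜ 1 * z ∈ lowTensors k A p pw n := by
  suffices h : lowTensors k A p pw n ≤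
      (lowTensors k A p pw n).comap (LinearMap.mulLeft k (x ⊗ₜ 1)) from h hz
  refine lowTensors_le fun y u hu => ?_
  rw [Submodule.mem_comap, LinearMap.mulLeft_apply, Algebra.TensorProduct.tmul_mul_tmul, one_mul]
  exact tmul_mem_lowTensors _ hu

theorem right_mul_mem_lowTensors (a : L) {n : ℕ} {z : A ⊗[k] Env k p pw}
    (hz : z ∈ lowTensors k A p pw n) :
    1 ⊗ₜ envLinear k p pw a * z ∈ lowTensors k A p pw (n + 1) := by
  suffices h : lowTensors k A p pw n ≤ (lowTensors k A p pw (n + 1)).comap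
      (LinearMap.mulLeft k (1 ⊗ₜ envLinear k p pw a)) from h hz
  refine lowTensors_le fun y u hu => ?_
  rw [Submodule.mem_comap, LinearMap.mulLeft_apply, Algebra.TensorProduct.tmul_mul_tmul, one_mul]
  exact tmul_mem_lowTensors _ (mul_mem_lowProducts a hu)

variable (p pw) in
/-- The part of the coproduct of `a₁ ⋯ aₙ` where exactly one factor goes to the left. -/
def linearPart (ρ : L →ₗ[k] A) : List L → A ⊗[k] Env k p pw
  | [] => 0
  | a :: l => ρ a ⊗ₜ envProd k p pw l + 1 ⊗ₜ envLinear k p pw a * linearPart ρ l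

theorem linearPart_mem (ρ : L →ₗ[k] A) (l : List L) :
    linearPart p pw ρ l ∈ lowTensors k A p pw (l.length + 1) := by
  induction l with
  | nil => exact zero_mem _
  | cons a l ih =>
    exact add_mem (tmul_mem_lowTensors _ (Submodule.subset_span ⟨l, le_rfl, rfl⟩))
      (right_mul_mem_lowTensors a ih)

/-- The coproduct of a product is sorted by the number of factors sent to the left: none, exactly
one, or at least two. The last kind leaves at most `n - 2` factors on the right, whence the offset
in `lowProducts`. -/
theorem comul_envProd_sub_mem (ρ : L →ₗ[k] A) {Δ : Env k p pw →ₐ[k] A ⊗[k] Env k p pw}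
    (hΔ : ∀ a, Δ (envLinear k p pw a) = ρ a ⊗ₜ 1 + 1 ⊗ₜ envLinear k p pw a) (l : List L) :
    Δ (envProd k p pw l) - 1 ⊗ₜ envProd k p pw l - linearPart p pw ρ l ∈
      lowTensors k A p pw l.length := by
  induction l with
  | nil =>
    have h : Δ (envProd k p pw []) - 1 ⊗ₜ envProd k p pw [] - linearPart p pw ρ [] = 0 := by
      simp [envProd, linearPart, Algebra.TensorProduct.one_def]
    rw [h]
    exact zero_mem _
  | cons a l ih =>
    have h : Δ (envProd k p pw (a :: l)) - 1 ⊗ₜ envProd k p pw (a :: l) -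
        linearPart p pw ρ (a :: l) = ρ a ⊗ₜ 1 * linearPart p pw ρ l +
        (ρ a ⊗ₜ 1 * (Δ (envProd k p pw l) - 1 ⊗ₜ envProd k p pw l - linearPart p pw ρ l) +
        1 ⊗ₜ envLinear k p pw a *
          (Δ (envProd k p pw l) - 1 ⊗ₜ envProd k p pw l - linearPart p pw ρ l)) := by
      simp only [envProd_cons, map_mul, hΔ, linearPart, add_mul, mul_sub,
        Algebra.TensorProduct.tmul_mul_tmul, one_mul, mul_one]
      abel
    rw [h]
    exact add_mem (left_mul_mem_lowTensors _ (linearPart_mem ρ l))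
      (add_mem (left_mul_mem_lowTensors _ (lowTensors_mono (Nat.le_succ _) ih))
        (right_mul_mem_lowTensors a ih))

/-- Contraction of the left factor with a linear form. -/
def slice {B : Type*} [Ring B] [Algebra k B] (f : A →ₗ[k] k) : A ⊗[k] B →ₗ[k] B :=
  (TensorProduct.lid k B).toLinearMap ∘ₗ f.rTensor B

theorem slice_tmul {B : Type*} [Ring B] [Algebra k B] (f : A →ₗ[k] k) (x : A) (u : B) :
    slice f (x ⊗ₜ[k] u) = f x • u := by
  simp [slice]

theorem slice_right_mul {B : Type*} [Ring B] [Algebra k B] (f : A →ₗ[k] k) (u : B)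
    (z : A ⊗[k] B) : slice f (1 ⊗ₜ u * z) = u * slice f z := by
  induction z with
  | zero => simp
  | add x y hx hy => rw [mul_add, map_add, map_add, mul_add, hx, hy]
  | tmul x v => simp [slice_tmul, Algebra.TensorProduct.tmul_mul_tmul]

theorem slice_mem_lowProducts (f : A →ₗ[k] k) {n : ℕ} {z : A ⊗[k] Env k p pw}
    (hz : z ∈ lowTensors k A p pw n) : slice f z ∈ lowProducts k p pw n := by
  suffices h : lowTensors k A p pw n ≤ (lowProducts k p pw n).comap (slice f) from h hz
  refine lowTensors_le fun x u hu => ?_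
  rw [Submodule.mem_comap, slice_tmul]
  exact Submodule.smul_mem _ _ hu

/-- A form killing `1` discards the terms with nothing on the left, so slicing removes at least one
factor. -/
theorem slice_comul_mem (ρ : L →ₗ[k] A) {Δ : Env k p pw →ₐ[k] A ⊗[k] Env k p pw}
    (hΔ : ∀ a, Δ (envLinear k p pw a) = ρ a ⊗ₜ 1 + 1 ⊗ₜ envLinear k p pw a) {f : A →ₗ[k] k}
    (hf : f 1 = 0) {n : ℕ} {u : Env k p pw} (hu : u ∈ lowProducts k p pw (n + 1)) :
    slice f (Δ u) ∈ lowProducts k p pw n := by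
  suffices h : lowProducts k p pw (n + 1) ≤ (lowProducts k p pw n).comap
      (slice f ∘ₗ Δ.toLinearMap) from h hu
  refine Submodule.span_le.2 ?_
  rintro _ ⟨l, hl, rfl⟩
  change slice f (Δ (envProd k p pw l)) ∈ lowProducts k p pw n
  have h1 := slice_mem_lowProducts f (add_mem (lowTensors_mono (Nat.le_succ _)
    (comul_envProd_sub_mem ρ hΔ l)) (linearPart_mem (p := p) (pw := pw) ρ l))
  rw [sub_add_cancel, map_sub, slice_tmul, hf, zero_smul, sub_zero] at h1
  exact lowProducts_mono (by omega) h1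

theorem slice_linearPart {ι : Type*} [DecidableEq ι] (ρ : L →ₗ[k] A) (v : ι → L) (j : ι)
    {f : A →ₗ[k] k} (hf : ∀ i, f (ρ (v i)) = if i = j then 1 else 0) {l : List ι}
    (hl : l.Nodup) :
    slice f (linearPart p pw ρ (l.map v)) =
      if j ∈ l then envProd k p pw ((l.erase j).map v) else 0 := by
  induction l with
  | nil => simp [linearPart]
  | cons i l ih =>
    obtain ⟨hi, hl⟩ := List.nodup_cons.1 hl
    rw [List.map_cons, linearPart, map_add, slice_tmul, slice_right_mul, ih hl, hf]
    by_cases hij : i = j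
    · subst hij
      simp [hi]
    · rw [if_neg hij, zero_smul, zero_add, List.erase_cons_tail (by simpa using hij)]
      by_cases hj : j ∈ l
      · simp [hj, envProd_cons]
      · simp [hj, Ne.symm hij]

/-- Successive contraction of iterated coproducts with linear forms. -/
def sliceAll {ι : Type*} (Δ : Env k p pw →ₐ[k] A ⊗[k] Env k p pw) (f : ι → A →ₗ[k] k) :
    List ι → (Env k p pw →ₗ[k] Env k p pw)
  | [] => LinearMap.id
  | j :: J => sliceAll Δ f J ∘ₗ slice (f j) ∘ₗ Δ.toLinearMap

/-- There are more slices than factors, and each slice uses up at least one. -/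
theorem sliceAll_eq_zero {ι : Type*} (ρ : L →ₗ[k] A) {Δ : Env k p pw →ₐ[k] A ⊗[k] Env k p pw}
    (hΔ : ∀ a, Δ (envLinear k p pw a) = ρ a ⊗ₜ 1 + 1 ⊗ₜ envLinear k p pw a)
    {f : ι → A →ₗ[k] k} (hf : ∀ j, f j 1 = 0) (J : List ι) {u : Env k p pw}
    (hu : u ∈ lowProducts k p pw (J.length + 1)) : sliceAll Δ f J u = 0 := by
  induction J generalizing u with
  | nil =>
    have h : lowProducts k p pw 1 ≤ ⊥ := by
      refine Submodule.span_le.2 ?_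
      rintro _ ⟨l, hl, -⟩
      omega
    exact (Submodule.mem_bot k).1 (h hu)
  | cons j J ih => exact ih (slice_comul_mem ρ hΔ (hf j) hu)

/-- Only the part of the coproduct with exactly one factor on the left survives all the slices, and
the form dual to `v j` removes precisely the letter `j`. -/
theorem sliceAll_envProd {ι : Type*} [DecidableEq ι] (ρ : L →ₗ[k] A)
    {Δ : Env k p pw →ₐ[k] A ⊗[k] Env k p pw}
    (hΔ : ∀ a, Δ (envLinear k p pw a) = ρ a ⊗ₜ 1 + 1 ⊗ₜ envLinear k p pw a)
    (v : ι → L) {f : ι → A →ₗ[k] k} (hf : ∀ j, f j 1 = 0)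
    (hfv : ∀ j i, f j (ρ (v i)) = if i = j then 1 else 0) (J I : List ι) (hI : I.Nodup)
    (hIJ : I.length ≤ J.length) :
    sliceAll Δ f J (envProd k p pw (I.map v)) = if J.Perm I then 1 else 0 := by
  induction J generalizing I with
  | nil =>
    obtain rfl := List.length_eq_zero_iff.1 (Nat.le_zero.1 hIJ)
    simp [sliceAll, envProd]
  | cons j J ih =>
    have h1 := slice_mem_lowProducts (f j) (comul_envProd_sub_mem ρ hΔ (I.map v))
    rw [map_sub, map_sub, slice_tmul, hf, zero_smul, sub_zero,
      slice_linearPart ρ v j (hfv j) hI, List.length_map] at h1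
    have h2 := sliceAll_eq_zero ρ hΔ hf J (lowProducts_mono hIJ h1)
    rw [map_sub, sub_eq_zero] at h2
    refine h2.trans ?_
    by_cases hj : j ∈ I
    · rw [if_pos hj, ih _ (hI.erase j) (by
        rw [List.length_erase_of_mem hj]
        rw [List.length_cons] at hIJ
        omega)]
      simp [List.cons_perm_iff_perm_erase, hj]
    · rw [if_neg hj, map_zero, if_neg]
      exact fun h => hj (h.subset List.mem_cons_self)

/-- Since `1` is not in the range of `ρ`, it remains linearly independent when joined to the `ρ (v
i)`; the forms are coordinates, extended to `A`. -/
theorem exists_dual_forms {ι : Type*} [DecidableEq ι] (ρ : L →ₗ[k] A)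
    (hinj : Function.Injective ρ) (h1 : ∀ a, ρ a ≠ 1) [Nontrivial A] {v : ι → L}
    (hv : LinearIndependent k v) :
    ∃ f : ι → A →ₗ[k] k, (∀ j, f j 1 = 0) ∧
      ∀ j i, f j (ρ (v i)) = if i = j then 1 else 0 := by
  have hu : LinearIndependent k (fun o : Option ι => o.casesOn' (1 : A) fun i => ρ (v i)) := by
    refine linearIndependent_option'.2 ⟨hv.map' ρ (LinearMap.ker_eq_bot.2 hinj), fun h => ?_⟩
    have h2 : Submodule.span k (Set.range fun i => ρ (v i)) ≤ LinearMap.range ρ := by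
      refine Submodule.span_le.2 ?_
      rintro _ ⟨i, rfl⟩
      exact ⟨v i, rfl⟩
    obtain ⟨a, ha⟩ := h2 h
    exact h1 a ha
  have key : ∀ j, ∃ g : A →ₗ[k] k, ∀ o : Option ι,
      g (o.casesOn' (1 : A) fun i => ρ (v i)) = if o = some j then 1 else 0 := by
    intro j
    obtain ⟨g, hg⟩ := LinearMap.exists_extend (Finsupp.lapply (some j) ∘ₗ hu.repr)
    refine ⟨g, fun o => ?_⟩
    have h3 := LinearMap.congr_fun hg ⟨_, Submodule.subset_span ⟨o, rfl⟩⟩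
    refine h3.trans ?_
    simp only [LinearMap.comp_apply, Finsupp.lapply_apply]
    rw [hu.repr_eq_single o _ rfl, Finsupp.single_apply]
  choose g hg using key
  exact ⟨g, fun j => by simpa using hg j none, fun j i => by simpa using hg j (some i)⟩

/-- In a linear relation pick a subset `I₀` of largest size with non-zero coefficient: slicing along
`I₀` kills every other term. -/
theorem linearIndependent_envProd [CharP k p] {ι : Type*} [Nontrivial A] (ρ : L →ₗ[k] A)
    (hρ : ∀ a b, ρ ⁅a, b⁆ = ρ a * ρ b - ρ b * ρ a) (hpw : p ≠ 0 → ∀ a, ρ (pw a) = ρ a ^ p)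
    (hinj : Function.Injective ρ) (h1 : ∀ a, ρ a ≠ 1) {v : ι → L}
    (hv : LinearIndependent k v) :
    LinearIndependent k fun I : Finset ι => envProd k p pw (I.toList.map v) := by
  classical
  obtain ⟨Δ, hΔ⟩ := exists_comul (p := p) (pw := pw) ρ hρ hpw
  -- A homomorphism to the non-trivial ring `A` forces `1 ≠ 0` in `U(L)`.
  obtain ⟨F, -⟩ := exists_env_lift (p := p) (pw := pw) ρ hρ hpw
  have : Nontrivial (Env k p pw) := F.toRingHom.domain_nontrivial
  obtain ⟨f, hf, hfv⟩ := exists_dual_forms ρ hinj h1 hv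
  rw [linearIndependent_iff']
  intro s c hc I hI
  by_contra hcI
  obtain ⟨I₀, hI₀, hmax⟩ := (s.filter fun I => c I ≠ 0).exists_max_image Finset.card
    ⟨I, Finset.mem_filter.2 ⟨hI, hcI⟩⟩
  obtain ⟨hI₀s, hI₀c⟩ := Finset.mem_filter.1 hI₀
  have h2 := congrArg (sliceAll Δ f I₀.toList) hc
  rw [map_sum, map_zero, Finset.sum_eq_single_of_mem I₀ hI₀s] at h2
  · rw [map_smul, sliceAll_envProd ρ hΔ v hf hfv _ _ I₀.nodup_toList le_rfl,
      if_pos (List.Perm.refl _)] at h2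
    exact hI₀c ((smul_eq_zero.1 h2).resolve_right one_ne_zero)
  · intro I' hI' hne
    by_cases hc' : c I' = 0
    · rw [hc', zero_smul, map_zero]
    · have h3 := hmax I' (Finset.mem_filter.2 ⟨hI', hc'⟩)
      rw [map_smul, sliceAll_envProd ρ hΔ v hf hfv _ _ I'.nodup_toList (by simpa using h3),
        if_neg, smul_zero]
      exact fun h => hne (Finset.perm_toList.1 h).symm

end Comultiplication

/-! ### Exponentially many independent elements of `U(L)` -/

section EnvLowerBound

variable {k L : Type*} [Field k] [LieRing L] [LieAlgebra k L] {p : ℕ} {pw : L → L}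
  {ℒ : ℝ → Submodule k L}

theorem mul_mem_envDegLE {a : L} {D e : ℝ} (ha : a ∈ degLE ℒ D) {u : Env k p pw}
    (hu : u ∈ envDegLE p pw ℒ e) : envLinear k p pw a * u ∈ envDegLE p pw ℒ (D + e) := by
  suffices h : envDegLE p pw ℒ e ≤ (envDegLE p pw ℒ (D + e)).comap
      (LinearMap.mulLeft k (envLinear k p pw a)) from h hu
  refine iSup₂_le fun e' he' => Submodule.span_le.2 ?_
  rintro _ ⟨l, hl, hle, rfl⟩
  suffices h : degLE ℒ D ≤ (envDegLE p pw ℒ (D + e)).comap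
      (LinearMap.mulRight k (l.map fun t => envι k p pw t.2).prod ∘ₗ envLinear k p pw) from h ha
  refine iSup₂_le fun D' hD' b hb => ?_
  refine Submodule.mem_iSup_of_mem (D' + e') (Submodule.mem_iSup_of_mem (add_le_add hD' he')
    (Submodule.subset_span ⟨(D', b) :: l, ?_, ?_, ?_⟩))
  · rintro t ht
    obtain rfl | ht := List.mem_cons.1 ht
    · exact hb
    · exact hl t ht
  · simp [hle]
  · simp [envLinear_apply]

theorem envProd_mem_envDegLE {D : ℝ} {l : List L} (hl : ∀ a ∈ l, a ∈ degLE ℒ D) :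
    envProd k p pw l ∈ envDegLE p pw ℒ (l.length * D) := by
  induction l with
  | nil =>
    refine Submodule.mem_iSup_of_mem 0 (Submodule.mem_iSup_of_mem (by simp)
      (Submodule.subset_span ⟨[], by simp [envProd]⟩))
  | cons a l ih =>
    rw [envProd_cons, List.length_cons]
    have := mul_mem_envDegLE (p := p) (pw := pw) (hl a List.mem_cons_self)
      (ih fun b hb => hl b (List.mem_cons_of_mem _ hb))
    convert this using 2
    push_cast
    ring

theorem two_pow_le_finrank_envDegLE [CharP k p] {A : Type*} [Ring A] [Algebra k A] [Nontrivial A]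
    (ρ : L →ₗ[k] A) (hρ : ∀ a b, ρ ⁅a, b⁆ = ρ a * ρ b - ρ b * ρ a)
    (hpw : p ≠ 0 → ∀ a, ρ (pw a) = ρ a ^ p) (hinj : Function.Injective ρ) (h1 : ∀ a, ρ a ≠ 1)
    {D d : ℝ} (hD : 0 ≤ D) [FiniteDimensional k (envDegLE p pw ℒ d)] {M : ℕ}
    (hM : M ≤ Module.finrank k (degLE ℒ D)) (hMd : M * D ≤ d) :
    2 ^ M ≤ Module.finrank k (envDegLE p pw ℒ d) := by
  obtain ⟨v, hv⟩ := exists_linearIndependent_of_le_finrank hM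
  have hv' : LinearIndependent k fun i => (v i : L) :=
    hv.map' (degLE ℒ D).subtype (Submodule.ker_subtype _)
  have hli := linearIndependent_envProd (p := p) (pw := pw) ρ hρ hpw hinj h1 hv'
  have hmem : ∀ I : Finset (Fin M), envProd k p pw (I.toList.map fun i => (v i : L)) ∈
      envDegLE p pw ℒ d := by
    intro I
    have h2 := envProd_mem_envDegLE (p := p) (pw := pw) (ℒ := ℒ) (D := D)
      (l := I.toList.map fun i => (v i : L)) (by simp)
    refine (?_ : envDegLE p pw ℒ _ ≤ envDegLE p pw ℒ d) h2
    refine iSup₂_le fun e he => le_iSup₂_of_le e (he.trans (le_trans ?_ hMd)) le_rfl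
    rw [List.length_map, Finset.length_toList]
    gcongr
    simpa using I.card_le_univ
  have hli' : LinearIndependent k fun I : Finset (Fin M) =>
      (⟨envProd k p pw (I.toList.map fun i => (v i : L)), hmem I⟩ : envDegLE p pw ℒ d) :=
    LinearIndependent.of_comp (envDegLE p pw ℒ d).subtype hli
  simpa using hli'.fintype_card_le_finrank

end EnvLowerBound

/-! ### Gelfand-Kirillov dimension and growth -/

section GelfandKirillov

variable {k L : Type*} [Field k] [LieRing L] [LieAlgebra k L] {p : ℕ} {pw : L → L}
  {ℒ : ℝ → Submodule k L}

theorem lie_mem_degLE (hlie : ∀ {i j : ℝ} {a b : L}, a ∈ ℒ i → b ∈ ℒ j → ⁅a, b⁆ ∈ ℒ (i + j))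
    {s t : ℝ} {a b : L} (ha : a ∈ degLE ℒ s) (hb : b ∈ degLE ℒ t) : ⁅a, b⁆ ∈ degLE ℒ (s + t) := by
  let br : L →ₗ[k] L →ₗ[k] L := (LieModule.toEnd k L L : L →ₗ[k] Module.End k L)
  suffices h : degLE ℒ s ≤ (degLE ℒ (s + t)).comap (br.flip b) from h ha
  refine iSup₂_le fun i hi a ha => ?_
  suffices h : degLE ℒ t ≤ (degLE ℒ (s + t)).comap (br a) from h hb
  exact iSup₂_le fun j hj b hb => le_degLE ℒ (add_le_add hi hj) (hlie ha hb)

theorem pw_mem_degLE (hp : p ≠ 0) (hpm : IsPMap k p pw)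
    (hlie : ∀ {i j : ℝ} {a b : L}, a ∈ ℒ i → b ∈ ℒ j → ⁅a, b⁆ ∈ ℒ (i + j))
    (hpw : ∀ {i : ℝ} {a : L}, a ∈ ℒ i → pw a ∈ ℒ (p * i)) {t : ℝ} {a : L}
    (ha : a ∈ degLE ℒ t) : pw a ∈ degLE ℒ (p * t) := by
  have h : degLE ℒ t = ⨆ i : {i : ℝ // i ≤ t}, ℒ i := iSup_subtype'
  have hmem : ∀ {x}, x ∈ ⨆ i : {i : ℝ // i ≤ t}, ℒ i → x ∈ degLE ℒ t := fun hx => h ▸ hx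
  rw [h] at ha
  induction ha using Submodule.iSup_induction' with
  | zero => rw [hpm.map_zero hp]; exact zero_mem _
  | mem i x hx =>
    refine le_degLE ℒ ?_ (hpw hx)
    have := i.2
    gcongr
  | add x y hx hy hx' hy' =>
    rw [hpm.add]
    refine add_mem (add_mem hx' hy') (sum_mem fun r _ => ?_)
    have := jacobsonTerm_mem (degLE ℒ) (lie_mem_degLE hlie) (hmem hx) (hmem hy) p r
    rwa [← succ_nsmul, Nat.sub_add_cancel (Nat.one_le_iff_ne_zero.2 hp), nsmul_eq_mul] at this

theorem powSpaceLE_le_degLE (hpm : p ≠ 0 → IsPMap k p pw)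
    (hlie : ∀ {i j : ℝ} {a b : L}, a ∈ ℒ i → b ∈ ℒ j → ⁅a, b⁆ ∈ ℒ (i + j))
    (hpw : p ≠ 0 → ∀ {i : ℝ} {a : L}, a ∈ ℒ i → pw a ∈ ℒ (p * i)) {S : Submodule k L} {e : ℝ}
    (he : 0 ≤ e) (hS : S ≤ degLE ℒ e) (n : ℕ) : powSpaceLE k p pw S n ≤ degLE ℒ (n * e) := by
  refine iSup₂_le fun m hm a ha => ?_
  have h1 : (m : ℝ) * e ≤ n * e := by
    have := (Finset.mem_Icc.1 hm).2
    gcongr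
  refine degLE_mono ℒ h1 ?_
  clear h1 hm
  change MemPow k p pw S m a at ha
  induction ha with
  | of h => simpa using hS h
  | zero => exact zero_mem _
  | add _ _ iha ihb => exact add_mem iha ihb
  | smul c _ iha => exact Submodule.smul_mem _ c iha
  | lie _ _ iha ihb =>
    rw [Nat.cast_add, add_mul]
    exact lie_mem_degLE hlie iha ihb
  | pw hp _ iha =>
    rw [Nat.cast_mul, mul_assoc]
    exact pw_mem_degLE (ℒ := ℒ) hp (hpm hp) hlie (fun hx => hpw hp hx) iha

theorem powSpaceLE_le_of_le (S : Submodule k L) {m n : ℕ} (h : m ≤ n) :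
    powSpaceLE k p pw S m ≤ powSpaceLE k p pw S n := by
  refine iSup₂_le fun i hi => ?_
  exact le_iSup₂_of_le (f := fun i (_ : i ∈ Finset.Icc 1 n) => powSpace k p pw S i) i
    (Finset.Icc_subset_Icc_right h hi) le_rfl

theorem tendsto_log_div_log_add (C θ : ℝ) :
    Filter.Tendsto (fun n : ℕ => ((C / Real.log n + θ : ℝ) : EReal)) Filter.atTop
      (nhds (θ : EReal)) := by
  refine (continuous_coe_real_ereal.tendsto θ).comp ?_
  have h := (Real.tendsto_log_atTop.comp tendsto_natCast_atTop_atTop).const_div_atTop C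
  simpa using h.add_const θ

theorem gkDim_nonneg : 0 ≤ gkDim k p pw := by
  refine le_iSup₂_of_le (⊥ : Submodule k L) inferInstance ?_
  refine Filter.le_limsup_of_frequently_le (Filter.Eventually.frequently
    (Filter.Eventually.of_forall fun n => ?_))
  exact_mod_cast div_nonneg (Real.log_natCast_nonneg _) (Real.log_natCast_nonneg _)

/-- A finite-dimensional `S` lies in some `L_{≤ e}`, so products of at most `n` of its elements lie
in `L_{≤ n e}`. -/
theorem gkDim_le (hint : DirectSum.IsInternal ℒ) (hpm : p ≠ 0 → IsPMap k p pw)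
    (hlie : ∀ {i j : ℝ} {a b : L}, a ∈ ℒ i → b ∈ ℒ j → ⁅a, b⁆ ∈ ℒ (i + j))
    (hpw : p ≠ 0 → ∀ {i : ℝ} {a : L}, a ∈ ℒ i → pw a ∈ ℒ (p * i))
    (hfin : ∀ d, FiniteDimensional k (degLE ℒ d)) {C θ : ℝ} (hθ : 0 ≤ θ)
    (hgrowth : ∀ d ≥ 1, (Module.finrank k (degLE ℒ d) : ℝ) ≤ C * d ^ θ) :
    gkDim k p pw ≤ θ := by
  refine iSup₂_le fun S hS => ?_
  obtain ⟨e', he'⟩ := exists_le_degLE_of_fg hint ((Submodule.fg_iff_finiteDimensional S).2 hS)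
  set e := max e' 1 with he
  have he1 : 1 ≤ e := le_max_right _ _
  have hSe : S ≤ degLE ℒ e := he'.trans (degLE_mono ℒ (le_max_left _ _))
  set B := max (C * e ^ θ) 1 with hB
  have hB1 : 1 ≤ B := le_max_right _ _
  rw [← (tendsto_log_div_log_add (Real.log B) θ).limsup_eq]
  refine Filter.limsup_le_limsup ?_
  filter_upwards [Filter.eventually_ge_atTop 2] with n hn
  refine EReal.coe_le_coe_iff.2 ?_
  have hn2 : (2 : ℝ) ≤ n := by exact_mod_cast hn
  have hn0 : (0 : ℝ) < n := by linarith
  have hlog : 0 < Real.log n := Real.log_pos (by linarith)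
  rw [div_add' _ _ _ hlog.ne']
  gcongr
  have h1 : (Module.finrank k (powSpaceLE k p pw S n) : ℝ) ≤ B * (n : ℝ) ^ θ := by
    calc (Module.finrank k (powSpaceLE k p pw S n) : ℝ)
        ≤ Module.finrank k (degLE ℒ (n * e)) := Nat.cast_le.2 (Submodule.finrank_mono
          (powSpaceLE_le_degLE hpm hlie hpw (by linarith) hSe n))
      _ ≤ C * (n * e) ^ θ := hgrowth _ (by nlinarith)
      _ = C * e ^ θ * (n : ℝ) ^ θ := by
        rw [Real.mul_rpow hn0.le (by linarith)]
        ring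
      _ ≤ B * (n : ℝ) ^ θ := by
        gcongr
        exact le_max_left _ _
  rw [← Real.log_rpow hn0, ← Real.log_mul (by positivity) (by positivity)]
  -- In rank zero the convention `Real.log 0 = 0` applies, and the bound needs `1 ≤ B`.
  obtain h0 | h0 := Nat.eq_zero_or_pos (Module.finrank k (powSpaceLE k p pw S n))
  · rw [h0, Nat.cast_zero, Real.log_zero]
    exact Real.log_nonneg (one_le_mul_of_one_le_of_one_le hB1
      (Real.one_le_rpow (by linarith) hθ))
  · exact Real.log_le_log (by exact_mod_cast h0) h1

theorem le_gkDim {S : Submodule k L} (hS : FiniteDimensional k S) {c θ : ℝ} (hc : 0 < c)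
    {n₀ : ℕ} (h : ∀ n ≥ n₀, c * (n : ℝ) ^ θ ≤ Module.finrank k (powSpaceLE k p pw S n)) :
    (θ : EReal) ≤ gkDim k p pw := by
  refine le_iSup₂_of_le S hS ?_
  rw [← (tendsto_log_div_log_add (Real.log c) θ).limsup_eq]
  refine Filter.limsup_le_limsup ?_
  filter_upwards [Filter.eventually_ge_atTop 2, Filter.eventually_ge_atTop n₀] with n hn hn₀
  refine EReal.coe_le_coe_iff.2 ?_
  have hn2 : (2 : ℝ) ≤ n := by exact_mod_cast hn
  have hn0 : (0 : ℝ) < n := by linarith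
  have hlog : 0 < Real.log n := Real.log_pos (by linarith)
  rw [div_add' _ _ _ hlog.ne']
  gcongr
  rw [← Real.log_rpow hn0, ← Real.log_mul hc.ne' (by positivity)]
  exact Real.log_le_log (by positivity) (h n hn₀)

/-- The strict inequality passes to the limsup of the single space `S`, hence to all large `n`. -/
theorem exists_finrank_degLE_le_of_gkDim_lt {S : Submodule k L} (hS : FiniteDimensional k S)
    (hfin : ∀ n, FiniteDimensional k (powSpaceLE k p pw S n)) {δ : ℝ} (hδ : 0 < δ)
    (hgen : ∀ d, degLE ℒ d ≤ powSpaceLE k p pw S ⌊d / δ⌋₊) {η : ℝ} (hη : 0 < η)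
    (h : gkDim k p pw < η) :
    ∃ C > 0, ∀ d ≥ 1, (Module.finrank k (degLE ℒ d) : ℝ) ≤ C * d ^ η := by
  have h1 := lt_of_le_of_lt (le_iSup₂_of_le (f := fun (S : Submodule k L)
    (_ : FiniteDimensional k S) => Filter.limsup (fun n : ℕ =>
      ((Real.log (Module.finrank k (powSpaceLE k p pw S n)) / Real.log n : ℝ) : EReal))
      Filter.atTop) S hS le_rfl) h
  obtain ⟨n₀, hn₀⟩ := Filter.eventually_atTop.1 (Filter.eventually_lt_of_limsup_lt h1)
  have h2 : ∀ n ≥ n₀ + 2, (Module.finrank k (powSpaceLE k p pw S n) : ℝ) ≤ (n : ℝ) ^ η := by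
    intro n hn
    have hn2 : (2 : ℝ) ≤ n := by exact_mod_cast (by omega : 2 ≤ n)
    have hlog : 0 < Real.log n := Real.log_pos (by linarith)
    have h3 := EReal.coe_lt_coe_iff.1 (hn₀ n (by omega))
    rw [div_lt_iff₀ hlog] at h3
    obtain h0 | h0 := Nat.eq_zero_or_pos (Module.finrank k (powSpaceLE k p pw S n))
    · rw [h0, Nat.cast_zero]
      positivity
    · rw [← Real.log_rpow (by linarith)] at h3
      exact ((Real.log_lt_log_iff (by exact_mod_cast h0) (by positivity)).1 h3).le
  refine ⟨(1 / δ + (n₀ + 2)) ^ η, by positivity, fun d hd => ?_⟩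
  have hd0 : 0 < d := by linarith
  set n := max ⌊d / δ⌋₊ (n₀ + 2) with hn
  calc (Module.finrank k (degLE ℒ d) : ℝ) ≤ Module.finrank k (powSpaceLE k p pw S n) :=
        Nat.cast_le.2 (Submodule.finrank_mono ((hgen d).trans
          (powSpaceLE_le_of_le S (le_max_left _ _))))
    _ ≤ (n : ℝ) ^ η := h2 n (le_max_right _ _)
    _ ≤ ((1 / δ + (n₀ + 2)) * d) ^ η := by
      gcongr
      have h4 : (⌊d / δ⌋₊ : ℝ) ≤ d / δ := Nat.floor_le (by positivity)
      rw [hn, Nat.cast_max, add_mul, one_div_mul_eq_div]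
      push_cast
      have h5 : 0 ≤ d / δ := by positivity
      have h6 : (n₀ : ℝ) + 2 ≤ (n₀ + 2) * d := le_mul_of_one_le_right (by positivity) hd
      have h7 : (0 : ℝ) ≤ n₀ + 2 := by positivity
      exact max_le (by linarith) (by linarith)
    _ = _ := Real.mul_rpow (by positivity) hd0.le

theorem tendsto_log_div_of_growthLE {f : ℝ → ℕ} {α : ℝ} (hα : α < 1)
    (h : GrowthLE (fun d => (f d : ℝ)) fun d => Real.exp (d ^ α)) :
    Filter.Tendsto (fun d => Real.log (f d) / d) Filter.atTop (nhds 0) := by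
  obtain ⟨C, hC, h⟩ := h
  set B := max C 1 with hB
  have hB1 : 1 ≤ B := le_max_right _ _
  have hlim : Filter.Tendsto (fun d : ℝ => Real.log B / d + C ^ α * d ^ (-(1 - α)))
      Filter.atTop (nhds 0) := by
    have h1 := Filter.tendsto_id.const_div_atTop (Real.log B) (l := Filter.atTop (α := ℝ))
    have h2 := (tendsto_rpow_neg_atTop (sub_pos.2 hα)).const_mul (C ^ α)
    simpa using h1.add h2
  refine tendsto_of_tendsto_of_tendsto_of_le_of_le' tendsto_const_nhds hlim ?_ ?_
  · filter_upwards [Filter.eventually_ge_atTop 1] with d hd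
    exact div_nonneg (Real.log_natCast_nonneg _) (by linarith)
  · filter_upwards [Filter.eventually_ge_atTop 1] with d hd
    have hd0 : 0 < d := by linarith
    have h1 : Real.log (f d) ≤ Real.log B + (C * d) ^ α := by
      obtain h0 | h0 := Nat.eq_zero_or_pos (f d)
      · rw [h0, Nat.cast_zero, Real.log_zero]
        have := Real.log_nonneg hB1
        positivity
      · rw [← Real.log_exp ((C * d) ^ α), ← Real.log_mul (by positivity) (Real.exp_pos _).ne']
        refine Real.log_le_log (by exact_mod_cast h0) ((h d hd).trans ?_)
        gcongr
        exact le_max_left _ _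
    calc Real.log (f d) / d ≤ (Real.log B + (C * d) ^ α) / d := by gcongr
      _ = _ := by
        rw [add_div, Real.mul_rpow hC.le hd0.le, mul_div_assoc]
        congr 2
        rw [neg_sub, Real.rpow_sub_one hd0.ne']

/-- Within total degree `e`, take `D = e ^ (1 / (θ + 1))`: about `D ^ θ = e ^ α` independent
elements of degree at most `D` are available, and the product of all of them has degree at most `D ^
θ * D = e`. -/
theorem exp_growthLE_finrank_envDegLE [CharP k p] {A : Type*} [Ring A] [Algebra k A]
    [Nontrivial A] (ρ : L →ₗ[k] A) (hρ : ∀ a b, ρ ⁅a, b⁆ = ρ a * ρ b - ρ b * ρ a)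
    (hpw : p ≠ 0 → ∀ a, ρ (pw a) = ρ a ^ p) (hinj : Function.Injective ρ) (h1 : ∀ a, ρ a ≠ 1)
    (hfin : ∀ d, FiniteDimensional k (envDegLE p pw ℒ d)) {c d₀ θ : ℝ} (hc : 0 < c)
    (hθ : 0 < θ)
    (hgrowth : ∀ d ≥ d₀, c * d ^ θ ≤ (Module.finrank k (degLE ℒ d) : ℝ)) :
    GrowthLE (fun d => Real.exp (d ^ (θ / (θ + 1))))
      (fun d => (Module.finrank k (envDegLE p pw ℒ d) : ℝ)) := by
  set α := θ / (θ + 1) with hα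
  have hα0 : 0 < α := by positivity
  set b := min c 1 with hb
  have hb0 : 0 < b := lt_min hc one_pos
  have hl2 : 0 < Real.log 2 := Real.log_pos (by norm_num)
  -- The `2` pays for rounding `M` down, `|d₀| ^ (θ + 1)` makes `D ≥ d₀`, and the last term converts
  -- base `2` and the constant `b` into base `exp 1`.
  set C := max 2 (max (|d₀| ^ (θ + 1)) ((Real.log 2 * b)⁻¹ ^ α⁻¹)) with hC
  have hC2 : 2 ≤ C := le_max_left _ _
  have hC0 : 0 < C := by linarith
  have hC1 : |d₀| ^ (θ + 1) ≤ C := (le_max_left _ _).trans (le_max_right _ _)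
  have hC3 : (Real.log 2 * b)⁻¹ ^ α⁻¹ ≤ C := (le_max_right _ _).trans (le_max_right _ _)
  have hC4 : 1 ≤ Real.log 2 * b * C ^ α := by
    have h2 : (Real.log 2 * b)⁻¹ ≤ C ^ α := by
      calc (Real.log 2 * b)⁻¹ = ((Real.log 2 * b)⁻¹ ^ α⁻¹) ^ α := by
            rw [← Real.rpow_mul (by positivity), inv_mul_cancel₀ hα0.ne', Real.rpow_one]
        _ ≤ C ^ α := by gcongr
    rwa [inv_le_iff_one_le_mul₀' (by positivity)] at h2
  refine ⟨C, hC0, fun d hd => ?_⟩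
  have hd0 : 0 < d := by linarith
  set e := C * d with he
  have he0 : 0 < e := by positivity
  set D := e ^ (θ + 1)⁻¹ with hD
  have hDθ : D ^ θ = e ^ α := by
    rw [hD, ← Real.rpow_mul he0.le, hα, inv_mul_eq_div]
  have hDe : e ^ α * D = e := by
    rw [hD, ← Real.rpow_add he0, hα, ← one_div, ← add_div, div_self (by positivity),
      Real.rpow_one]
  have hDd : d₀ ≤ D := by
    calc d₀ ≤ |d₀| := le_abs_self _
      _ = (|d₀| ^ (θ + 1)) ^ (θ + 1)⁻¹ := by
        rw [← Real.rpow_mul (abs_nonneg _), mul_inv_cancel₀ (by positivity), Real.rpow_one]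
      _ ≤ D := by
        rw [hD]
        gcongr
        exact hC1.trans (le_mul_of_one_le_right hC0.le hd)
  have hD0 : 0 ≤ D := by positivity
  set M := ⌊b * e ^ α⌋₊ with hM
  have hM1 : (M : ℝ) ≤ b * e ^ α := Nat.floor_le (by positivity)
  have hM2 : b * e ^ α < M + 1 := Nat.lt_floor_add_one _
  have h3 : 2 ^ M ≤ Module.finrank k (envDegLE p pw ℒ e) := by
    refine two_pow_le_finrank_envDegLE ρ hρ hpw hinj h1 hD0 ?_ ?_
    · have h4 : (M : ℝ) ≤ Module.finrank k (degLE ℒ D) := by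
        refine le_trans ?_ (hgrowth D hDd)
        rw [hDθ]
        refine hM1.trans ?_
        gcongr
        exact min_le_left _ _
      exact_mod_cast h4
    · calc M * D ≤ b * e ^ α * D := by gcongr
        _ ≤ 1 * e ^ α * D := by
          gcongr
          exact min_le_right _ _
        _ = e := by rw [one_mul, hDe]
  have h4 : Real.exp (d ^ α) ≤ 2 * 2 ^ M := by
    rw [← pow_succ', ← Real.exp_log (show (0 : ℝ) < 2 ^ (M + 1) by positivity), Real.log_pow,
      Real.exp_le_exp]
    push_cast
    have h5 : e ^ α = C ^ α * d ^ α := Real.mul_rpow hC0.le hd0.le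
    have h6 : 0 ≤ d ^ α := by positivity
    calc d ^ α ≤ Real.log 2 * b * C ^ α * d ^ α := le_mul_of_one_le_left h6 hC4
      _ = b * e ^ α * Real.log 2 := by
        rw [h5]
        ring
      _ ≤ _ := by gcongr
  calc Real.exp (d ^ α) ≤ 2 * 2 ^ M := h4
    _ ≤ C * (Module.finrank k (envDegLE p pw ℒ e) : ℝ) := by
      gcongr
      exact_mod_cast h3

end GelfandKirillov

end SelfSimilarLie

end

/-! ### Assembly of the theorem -/

open SelfSimilarLie in
theorem mainTheorem9 {k X L : Type*} [Field k] (p : ℕ) [CharP k p]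
    [CommRing X] [Algebra k X] [FiniteDimensional k X] [LieRing L] [LieAlgebra k L]
    (pw : L → L) (ψ : L →ₗ⁅k⁆ Wreath k X L)
    (hres : IsRestricted p pw ψ) (hfaith : IsFaithful ψ) (hcontr : IsContracting ψ)
    (lam : ℝ) (hlam : 1 < lam) (𝒳 : ℝ → Submodule k X) (ℒ : ℝ → Submodule k L)
    (hgraded : IsGraded p pw ψ lam 𝒳 ℒ) (hnonneg : ∀ d < 0, ℒ d = ⊥)
    (hgen : GeneratedInPositiveDegree p pw ℒ) :
    (∀ d : ℝ, FiniteDimensional k (degLE ℒ d)) ∧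
    (∀ d : ℝ, FiniteDimensional k (envDegLE p pw ℒ d)) ∧
    Filter.Tendsto (fun d : ℝ => Real.log (Module.finrank k (envDegLE p pw ℒ d)) / d)
      Filter.atTop (nhds 0) ∧
    GrowthLE (fun d => (Module.finrank k (envDegLE p pw ℒ d) : ℝ))
      (fun d => Real.exp (d ^
        ((Real.log (Module.finrank k X) / Real.log lam) /
          (Real.log (Module.finrank k X) / Real.log lam + 1)))) ∧
    ∃ θ : ℝ, gkDim k p pw = (θ : EReal) ∧ 0 ≤ θ ∧
      θ ≤ Real.log (Module.finrank k X) / Real.log lam ∧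
      (∀ η > θ, GrowthLE (fun d => (Module.finrank k (envDegLE p pw ℒ d) : ℝ))
        (fun d => Real.exp (d ^ (η / (η + 1))))) ∧
      (0 < θ → GrowthLE (fun d => (Module.finrank k (degLE ℒ d) : ℝ)) (fun d => d ^ θ) →
        GrowthLE (fun d => (Module.finrank k (envDegLE p pw ℒ d) : ℝ))
          (fun d => Real.exp (d ^ (θ / (θ + 1))))) ∧
      (IsRegularlyWeaklyBranched ψ →
        θ = Real.log (Module.finrank k X) / Real.log lam ∧ 0 < θ ∧
        GrowthLE (fun d => (Module.finrank k (envDegLE p pw ℒ d) : ℝ))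
          (fun d => Real.exp (d ^ (θ / (θ + 1)))) ∧
        GrowthLE (fun d => Real.exp (d ^ (θ / (θ + 1))))
          (fun d => (Module.finrank k (envDegLE p pw ℒ d) : ℝ))) := by
  classical
  have hpm : p ≠ 0 → IsPMap k p pw := fun hp => (hres hp).1
  obtain ⟨δ, hδ0, S, hSfg, hδ, hgenle⟩ := exists_generation_bound hpm hgraded hgen
  have hSfin : FiniteDimensional k S := (Submodule.fg_iff_finiteDimensional S).1 hSfg
  have hpowfin : ∀ n, FiniteDimensional k (powSpaceLE k p pw S n) :=
    powSpaceLE_finiteDimensional hpm hSfg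
  have hfin : ∀ d, FiniteDimensional k (degLE ℒ d) := fun d =>
    Submodule.finiteDimensional_of_le (hgenle d)
  have hint := hgraded.internal
  have henvfin : ∀ d, FiniteDimensional k (envDegLE p pw ℒ d) :=
    envDegLE_finiteDimensional hint hgraded.lie_mem hδ0 hδ hfin
  obtain ⟨C, hC, hgrowth⟩ := exists_finrank_degLE_le_rpow hfaith hlam hgraded hfin
  set θ₀ := Real.log (Module.finrank k X) / Real.log lam with hθ₀
  have hθ₀0 : 0 ≤ θ₀ := div_nonneg (Real.log_natCast_nonneg _) (Real.log_nonneg hlam.le)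
  have hupper : ∀ {η B : ℝ}, 0 < η → 0 < B →
      (∀ d ≥ 1, (Module.finrank k (degLE ℒ d) : ℝ) ≤ B * d ^ η) →
      GrowthLE (fun d => (Module.finrank k (envDegLE p pw ℒ d) : ℝ))
        (fun d => Real.exp (d ^ (η / (η + 1)))) := fun hη hB h =>
    envDegLE_growthLE hint hgraded.lie_mem hδ0 hδ hfin hη hB h
  have hgk0 : 0 ≤ gkDim k p pw := gkDim_nonneg
  have hgk1 : gkDim k p pw ≤ θ₀ :=
    gkDim_le hint hpm hgraded.lie_mem hgraded.pw_mem hfin hθ₀0 hgrowth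
  obtain ⟨θ, hθ⟩ : ∃ θ : ℝ, gkDim k p pw = (θ : EReal) :=
    ⟨(gkDim k p pw).toReal, (EReal.coe_toReal (ne_top_of_le_ne_top (EReal.coe_ne_top _) hgk1)
      (ne_bot_of_le_ne_bot EReal.zero_ne_bot hgk0)).symm⟩
  rw [hθ] at hgk0 hgk1
  have hθ0 : 0 ≤ θ := by exact_mod_cast hgk0
  have hθ1 : θ ≤ θ₀ := by exact_mod_cast hgk1
  refine ⟨hfin, henvfin, ?_, ?_, θ, hθ, hθ0, hθ1, fun η hη => ?_, fun hpos hgr => ?_,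
    fun hbranch => ?_⟩
  -- The exponent `θ₀ + 1` is positive even when `θ₀ = 0`, and any exponent of the form `η / (η +
  -- 1)` is below `1`.
  · refine tendsto_log_div_of_growthLE (α := (θ₀ + 1) / (θ₀ + 1 + 1)) ?_
      (hupper (by linarith) hC fun d hd => (hgrowth d hd).trans ?_)
    · rw [div_lt_one (by linarith)]
      linarith
    · have := Real.rpow_le_rpow_of_exponent_le hd (by linarith : θ₀ ≤ θ₀ + 1)
      gcongr
  · obtain h | h := hθ₀0.lt_or_eq
    · exact hupper h hC hgrowth
    · have hX : Module.finrank k X ≤ 1 := by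
        by_contra hX
        have h2 : (1 : ℝ) < Module.finrank k X := by exact_mod_cast not_le.1 hX
        exact (div_pos (Real.log_pos h2) (Real.log_pos hlam)).ne h
      -- For `θ₀ = 0` the algebra `L` is zero and there are no basis elements; taking `s = 1 / d` in
      -- the counting bound gives `exp 1`, which is the right-hand side because `d ^ 0 = 1`.
      refine ⟨1, one_pos, fun d hd => ?_⟩
      obtain ⟨J, hJ⟩ := exists_finset_degree_le hint hfin d
      have hJ0 : J = ∅ := by
        refine Finset.eq_empty_of_forall_notMem fun i _ => ?_
        exact (gradedBasis hint).ne_zero i (eq_zero_of_finrank_le_one hfaith hX _)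
      have hd0 : 0 < d := by linarith
      have h3 := (finrank_envDegLE_le (p := p) (pw := pw) hint hgraded.lie_mem hδ0 hδ hJ
        (inv_pos.2 hd0)).2
      rw [hJ0, Finset.sum_empty, add_zero, inv_mul_cancel₀ hd0.ne'] at h3
      rw [← h]
      simpa using h3
  · obtain ⟨B, hB, h⟩ := exists_finrank_degLE_le_of_gkDim_lt hSfin hpowfin hδ0 hgenle
      (by linarith) (show gkDim k p pw < (η : EReal) by rw [hθ]; exact_mod_cast hη)
    exact hupper (by linarith) hB h
  · obtain ⟨B, hB, h⟩ := hgr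
    refine hupper hpos (B := B * B ^ θ) (by positivity) fun d hd => ?_
    rw [mul_assoc, ← Real.mul_rpow hB.le (by linarith)]
    exact h d hd
  · obtain ⟨-, -, -, -, -, -, -, -, -, K, hK, hψK⟩ := hbranch
    obtain ⟨hX, c, hc, d₀, hd₀, hlow⟩ := exists_rpow_le_finrank_degLE hfaith hlam hgraded hfin
      (K := K.toSubmodule) (fun h => hK ((LieSubmodule.toSubmodule_eq_bot K).1 h)) hψK
    rw [← hθ₀] at hlow
    have hX2 : (1 : ℝ) < Module.finrank k X := by exact_mod_cast hX
    have hθ₀pos : 0 < θ₀ := div_pos (Real.log_pos hX2) (Real.log_pos hlam)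
    have hge : (θ₀ : EReal) ≤ gkDim k p pw := by
      -- In degree `n * δ` the generation bound involves products of at most `n` generators exactly,
      -- so the lower bound by degree becomes one by length.
      refine le_gkDim hSfin (c := c * δ ^ θ₀) (by positivity) (n₀ := ⌈d₀ / δ⌉₊) fun n hn => ?_
      have hn' : d₀ ≤ n * δ := (div_le_iff₀ hδ0).1 (Nat.ceil_le.1 hn)
      calc c * δ ^ θ₀ * (n : ℝ) ^ θ₀ = c * (n * δ) ^ θ₀ := by
            rw [Real.mul_rpow (Nat.cast_nonneg n) hδ0.le]
            ring
        _ ≤ Module.finrank k (degLE ℒ (n * δ)) := hlow _ hn'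
        _ ≤ Module.finrank k (powSpaceLE k p pw S n) := by
            have h := hgenle (n * δ)
            rw [mul_div_cancel_right₀ _ hδ0.ne', Nat.floor_natCast] at h
            exact Nat.cast_le.2 (Submodule.finrank_mono h)
    rw [hθ] at hge
    have hθeq : θ = θ₀ := le_antisymm hθ1 (by exact_mod_cast hge)
    rw [hθeq]
    refine ⟨rfl, hθ₀pos, hupper hθ₀pos hC hgrowth, ?_⟩
    refine exp_growthLE_finrank_envDegLE (act ψ) (act_lie ψ) (fun hp => act_pw hp hres)
      (act_injective hfaith) (fun a ha => ?_) henvfin hc hθ₀pos hlow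
    -- No `a` acts as the identity, because `act ψ a` kills `1`.
    have h := act_one ψ a
    rw [ha, Module.End.one_apply] at h
    exact one_ne_zero h
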